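/- Let $N$ be a connected, simply connected nilpotent Lie group, identified with its Lie algebra through exponential coordinates, and let $K$ be a compact group acting on $N$ by automorphisms. Let $\mathbb D(N)$ be the algebra of left-invariant differential operators on $N$ (generated over $\mathbb C$ by the left-invariant vector fields), and $\mathbb D(N)^K$ the subalgebra of the $K$-invariant ones. The pair $(N,K)$ is a *nilpotent Gelfand pair* if $\mathbb D(N)^K$ is commutative. A *bounded spherical function* is a bounded smooth $K$-invariant function $\varphi$ on $N$ which is an eigenfunction of every operator in $\mathbb D(N)^K$ and equals $1$ at the identity; the set of these functions is denoted by $\Sigma$. For an integrable $K$-invariant function $F$ on $N$ the spherical transform is $$\mathcal G F(\varphi)=\int_N F(x)\,\varphi(x^{-1})\,dx ,\qquad \varphi\in\Sigma .$$ Let $\mathcal D=(D_1,\dots,D_d)$ be a finite system of formally self-adjoint operators that generates the algebra $\mathbb D(N)^K$. Each $\varphi\in\Sigma$ is identified with the tuple $\xi(\varphi)\in\mathbb R^d$ of its eigenvalues, $D_j\varphi=\xi_j(\varphi)\varphi$, and we put $\Sigma_{\mathcal D}=\{\xi(\varphi):\varphi\in\Sigma\}\subset\mathbb R^d$, so that $\mathcal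 GF$ becomes a function on $\Sigma_{\mathcal D}$. Let $\mathcal S(N)^K$ be the space of $K$-invariant Schwartz functions on $N$, and $$\mathcal S(\Sigma_{\mathcal D})=\mathcal S(\mathbb R^d)/\{f: f|_{\Sigma_{\mathcal D}}=0\}$$ with the quotient topology. The pair $(N,K)$ *satisfies Property (S) with respect to $\mathcal D$* if $\mathcal G$ is an isomorphism of topological vector spaces from $\mathcal S(N)^K$ onto $\mathcal S(\Sigma_{\mathcal D})$; it *satisfies Property (S)* if it does so with respect to some such system $\mathcal D$. **Proposition.** Let $(N_1,K_1)$ and $(N_2,K_2)$ be two nilpotent Gelfand pairs satisfying Property (S). Then the product pair $(N_1\times N_2,K_1\times K_2)$, with the componentwise action, is a nilpotent Gelfand pair and satisfies Property (S); moreover, it satisfies Property (S) with respect to every finite system of formally self-adjoint generators of $\mathbb D(N_1\times N_2)^{K_1\times K_2}$. -/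

import Mathlib

open MeasureTheory Filter Topology
open scoped ContDiff SchwartzMap

/-- A connected, simply connected nilpotent Lie group, written in exponential coordinates: the
underlying manifold is the (finite dimensional) real vector space `N`, the group law is smooth, the
line `t ↦ t • x` is the one-parameter subgroup generated by `x` (so `exp` is the identity map, the
neutral element is `0` and the inverse of `x` is `-x`), and the group is nilpotent.
No bound on the step is imposed. -/
class NilpotentLieGroup (N : Type*) [NormedAddCommGroup N] [NormedSpace ℝ N] extends Group N where
  contDiff_group_mul : ContDiff ℝ ∞ (fun p : N × N => p.1 * p.2)
  smul_mul_smul_self : ∀ (s t : ℝ) (x : N), (s • x) * (t • x) = (s + t) • x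
  isNilpotent : Group.IsNilpotent N

namespace NilpotentLieGroup

section Basic

variable {N : Type*} [NormedAddCommGroup N] [NormedSpace ℝ N] [NilpotentLieGroup N]

theorem zero_eq_one : (0 : N) = 1 := by
  have h := smul_mul_smul_self (0 : ℝ) 0 (0 : N)
  simpa using h

theorem nsmul_eq_pow (n : ℕ) (x : N) : (n : ℝ) • x = x ^ n := by
  induction n with
  | zero => simp [zero_eq_one]
  | succ n ih =>
    rw [pow_succ, ← ih]
    have h := smul_mul_smul_self (n : ℝ) 1 x
    rw [one_smul] at h
    rw [h]
    push_cast
    rfl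

theorem tendsto_smul_mul (x y : N) :
    Tendsto (fun n : ℕ => (n : ℝ) • (((n : ℝ)⁻¹ • x) * ((n : ℝ)⁻¹ • y))) atTop (𝓝 (x + y)) := by
  set m : N × N → N := fun p => p.1 * p.2 with hm
  have hd : HasFDerivAt m (fderiv ℝ m 0) 0 :=
    ((contDiff_group_mul (N := N)).differentiable (by simp) 0).hasFDerivAt
  have key : ∀ a b : N,
      HasDerivAt (fun t : ℝ => (t • a) * (t • b)) (fderiv ℝ m 0 (a, b)) 0 := by
    intro a b
    have hl : HasDerivAt (fun t : ℝ => t • ((a, b) : N × N)) (a, b) 0 := by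
      simpa using (hasDerivAt_id (0 : ℝ)).smul_const ((a, b) : N × N)
    have hd' : HasFDerivAt m (fderiv ℝ m 0) ((0 : ℝ) • ((a, b) : N × N)) := by simpa using hd
    exact hd'.comp_hasDerivAt (0 : ℝ) hl
  have hline : ∀ a : N, HasDerivAt (fun t : ℝ => t • a) a 0 := fun a => by
    simpa using (hasDerivAt_id (0 : ℝ)).smul_const a
  have hx : fderiv ℝ m 0 (x, 0) = x := by
    have h := key x 0
    have e : (fun t : ℝ => (t • x) * (t • (0 : N))) = fun t => t • x := by
      funext t
      rw [smul_zero, zero_eq_one, mul_one]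
    rw [e] at h
    exact h.unique (hline x)
  have hy : fderiv ℝ m 0 (0, y) = y := by
    have h := key 0 y
    have e : (fun t : ℝ => (t • (0 : N)) * (t • y)) = fun t => t • y := by
      funext t
      rw [smul_zero, zero_eq_one, one_mul]
    rw [e] at h
    exact h.unique (hline y)
  have hxy : fderiv ℝ m 0 (x, y) = x + y := by
    have : ((x, y) : N × N) = (x, 0) + (0, y) := by simp
    rw [this, map_add, hx, hy]
  have h := key x y
  rw [hxy, hasDerivAt_iff_tendsto_slope_zero] at h
  have hn : Tendsto (fun n : ℕ => ((n : ℝ))⁻¹) atTop (𝓝[≠] 0) := by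
    refine tendsto_nhdsWithin_iff.2 ⟨tendsto_inv_atTop_nhds_zero_nat, ?_⟩
    filter_upwards [eventually_gt_atTop 0] with n hn
    simp [hn.ne']
  refine (h.comp hn).congr fun n => ?_
  have h0 : (0 : N) * 0 = 0 := by simp [zero_eq_one]
  simp [h0]

/-- A continuous automorphism of `N` is linear in exponential coordinates. -/
theorem contDiff_smul {K : Type*} [Group K] [TopologicalSpace K] [MulDistribMulAction K N]
    [ContinuousSMul K N] (k : K) : ContDiff ℝ ∞ (fun x : N => k • x) := by
  have hc : Continuous (fun x : N => k • x) := continuous_const_smul k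
  have hn : ∀ (n : ℕ) (x : N), k • ((n : ℝ) • x) = (n : ℝ) • (k • x) := fun n x => by
    rw [nsmul_eq_pow, nsmul_eq_pow, smul_pow']
  have hinv : ∀ (n : ℕ) (x : N), n ≠ 0 → k • ((n : ℝ)⁻¹ • x) = (n : ℝ)⁻¹ • (k • x) := by
    intro n x h
    have h' : (n : ℝ) ≠ 0 := by exact_mod_cast h
    rw [eq_inv_smul_iff₀ h', ← hn, smul_inv_smul₀ h']
  have hadd : ∀ x y : N, k • (x + y) = k • x + k • y := by
    intro x y
    have h1 := (hc.tendsto (x + y)).comp (tendsto_smul_mul x y)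
    have h2 := tendsto_smul_mul (k • x) (k • y)
    refine tendsto_nhds_unique h1 (h2.congr' ?_)
    filter_upwards [eventually_ne_atTop 0] with n h
    simp only [Function.comp_apply]
    rw [hn, smul_mul', hinv n x h, hinv n y h]
  exact (AddMonoidHom.toRealLinearMap (AddMonoidHom.mk' _ hadd) hc).contDiff

end Basic

/-- The direct product of two groups, with the exponential coordinates of the factors. -/
instance instProd {N₁ N₂ : Type*} [NormedAddCommGroup N₁] [NormedSpace ℝ N₁]
    [NormedAddCommGroup N₂] [NormedSpace ℝ N₂] [NilpotentLieGroup N₁] [NilpotentLieGroup N₂] :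
    NilpotentLieGroup (N₁ × N₂) where
  contDiff_group_mul := by
    have h₁ := contDiff_group_mul (N := N₁)
    have h₂ := contDiff_group_mul (N := N₂)
    exact (h₁.comp (((contDiff_fst.comp contDiff_fst).prodMk (contDiff_fst.comp contDiff_snd)) :
        ContDiff ℝ ∞ fun p : (N₁ × N₂) × (N₁ × N₂) => (p.1.1, p.2.1))).prodMk
      (h₂.comp (((contDiff_snd.comp contDiff_fst).prodMk (contDiff_snd.comp contDiff_snd)) :
        ContDiff ℝ ∞ fun p : (N₁ × N₂) × (N₁ × N₂) => (p.1.2, p.2.2)))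
  smul_mul_smul_self s t x := by
    ext
    · exact smul_mul_smul_self s t x.1
    · exact smul_mul_smul_self s t x.2
  isNilpotent := by
    have := isNilpotent (N := N₁)
    have := isNilpotent (N := N₂)
    infer_instance

end NilpotentLieGroup

namespace GelfandPair

/-- The componentwise action of `K₁ × K₂` on `N₁ × N₂`. -/
instance prodAction {N₁ N₂ K₁ K₂ : Type*} [Monoid K₁] [Monoid K₂] [Monoid N₁] [Monoid N₂]
    [MulDistribMulAction K₁ N₁] [MulDistribMulAction K₂ N₂] :
    MulDistribMulAction (K₁ × K₂) (N₁ × N₂) where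
  smul k x := (k.1 • x.1, k.2 • x.2)
  one_smul x := Prod.ext (one_smul K₁ x.1) (one_smul K₂ x.2)
  mul_smul k l x := Prod.ext (mul_smul k.1 l.1 x.1) (mul_smul k.2 l.2 x.2)
  smul_mul k x y := Prod.ext (smul_mul' k.1 x.1 y.1) (smul_mul' k.2 x.2 y.2)
  smul_one k := Prod.ext (smul_one k.1) (smul_one k.2)

instance prodContinuousSMul {N₁ N₂ K₁ K₂ : Type*} [Monoid K₁] [Monoid K₂] [Monoid N₁] [Monoid N₂]
    [MulDistribMulAction K₁ N₁] [MulDistribMulAction K₂ N₂]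
    [TopologicalSpace K₁] [TopologicalSpace K₂] [TopologicalSpace N₁] [TopologicalSpace N₂]
    [ContinuousSMul K₁ N₁] [ContinuousSMul K₂ N₂] :
    ContinuousSMul (K₁ × K₂) (N₁ × N₂) where
  continuous_smul := by
    have h₁ : Continuous fun p : (K₁ × K₂) × (N₁ × N₂) => p.1.1 • p.2.1 := by fun_prop
    have h₂ : Continuous fun p : (K₁ × K₂) × (N₁ × N₂) => p.1.2 • p.2.2 := by fun_prop
    exact h₁.prodMk h₂

section Operators

variable (N : Type*) [NormedAddCommGroup N] [NormedSpace ℝ N]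

/-- The space `C^∞(N)` of smooth complex valued functions. -/
def Smooth : Submodule ℂ (N → ℂ) where
  carrier := {f | ContDiff ℝ ∞ f}
  add_mem' {f g} hf hg := by
    have hf' : ContDiff ℝ ∞ f := hf
    have hg' : ContDiff ℝ ∞ g := hg
    exact hf'.add hg'
  zero_mem' := by
    have h : ContDiff ℝ ∞ (fun _ : N => (0 : ℂ)) := contDiff_const
    exact h
  smul_mem' c f hf := by
    have hf' : ContDiff ℝ ∞ f := hf
    exact hf'.const_smul c

variable {N} [NilpotentLieGroup N]

theorem contDiff_translate (f : Smooth N) :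
    ContDiff ℝ ∞ (Function.uncurry fun x y : N => f.1 (x * y)) := by
  have hf : ContDiff ℝ ∞ f.1 := f.2
  exact hf.comp NilpotentLieGroup.contDiff_group_mul

theorem differentiableAt_translate (f : Smooth N) (x : N) :
    DifferentiableAt ℝ (fun y => f.1 (x * y)) 0 := by
  have h : ContDiff ℝ ∞ fun y => f.1 (x * y) :=
    (contDiff_translate f).comp (contDiff_const.prodMk contDiff_id)
  exact h.differentiable (by simp) 0

/-- The left-invariant vector field `X_v`, equal to `∂_v` at the neutral element:
`X_v f (x)` is the derivative at `y = 0` of `y ↦ f (x * y)` in the direction `v`. -/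
noncomputable def leftField (v : N) : Module.End ℂ (Smooth N) where
  toFun f := ⟨fun x => fderiv ℝ (fun y => f.1 (x * y)) 0 v, by
    have h : ContDiff ℝ ∞ fun x : N => fderiv ℝ (fun y => f.1 (x * y)) 0 :=
      ContDiff.fderiv (n := ∞) (contDiff_translate f) contDiff_const le_rfl
    exact h.clm_apply contDiff_const⟩
  map_add' f g := by
    ext x
    exact congrArg (fun L => L v)
      (fderiv_add (differentiableAt_translate f x) (differentiableAt_translate g x))
  map_smul' c f := by
    ext x
    exact congrArg (fun L => L v) (fderiv_const_smul (differentiableAt_translate f x) c)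

variable (N)

/-- The algebra `𝔻(N)` of left-invariant differential operators: the algebra of operators on
`C^∞(N)` generated over `ℂ` by the left-invariant vector fields. -/
noncomputable def diffOps : Subalgebra ℂ (Module.End ℂ (Smooth N)) :=
  Algebra.adjoin ℂ (Set.range (leftField (N := N)))

variable (K : Type*) [Group K] [TopologicalSpace K] [MulDistribMulAction K N] [ContinuousSMul K N]

variable {K} in
/-- The operator `f ↦ f ∘ k` on `C^∞(N)`. -/
def pullback (k : K) : Module.End ℂ (Smooth N) where
  toFun f := ⟨fun x => f.1 (k • x), by
    have hf : ContDiff ℝ ∞ f.1 := f.2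
    exact hf.comp (NilpotentLieGroup.contDiff_smul k)⟩
  map_add' _ _ := rfl
  map_smul' _ _ := rfl

/-- The algebra `𝔻(N)^K` of left-invariant and `K`-invariant differential operators, i.e. the
elements of `𝔻(N)` which commute with the action of `K` on functions. -/
noncomputable def invDiffOps : Subalgebra ℂ (Module.End ℂ (Smooth N)) :=
  diffOps N ⊓ Subalgebra.centralizer ℂ (Set.range (pullback N (K := K)))

/-- `(N, K)` is a nilpotent Gelfand pair: the algebra `𝔻(N)^K` is commutative. -/
def IsNilpotentGelfandPair : Prop :=
  ∀ D ∈ invDiffOps N K, ∀ E ∈ invDiffOps N K, D * E = E * D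

variable {N}

/-- `φ` is a bounded spherical function of `(N, K)`: a bounded `K`-invariant joint eigenfunction of
all the operators in `𝔻(N)^K`, which takes the value `1` at the neutral element. These functions
are the points of the Gelfand spectrum `Σ(N, K)`. -/
structure IsBoundedSpherical (φ : Smooth N) : Prop where
  invariant : ∀ (k : K) (x : N), φ.1 (k • x) = φ.1 x
  eigen : ∀ D ∈ invDiffOps N K, ∃ c : ℂ, D φ = c • φ
  one : φ.1 1 = 1
  bounded : ∃ C : ℝ, ∀ x, ‖φ.1 x‖ ≤ C

/-- The real tuple `ξ` is the tuple of eigenvalues of `φ` under the operators `D₁, …, D_d`. -/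
def IsEigenvalueTuple {d : ℕ} (D : Fin d → Module.End ℂ (Smooth N)) (φ : Smooth N)
    (ξ : EuclideanSpace ℝ (Fin d)) : Prop :=
  ∀ j, D j φ = (ξ j : ℂ) • φ

/-- The immersion `Σ_𝒟 ⊆ ℝ^d` of the Gelfand spectrum. -/
def spectrumSet {d : ℕ} (D : Fin d → Module.End ℂ (Smooth N)) : Set (EuclideanSpace ℝ (Fin d)) :=
  {ξ | ∃ φ : Smooth N, IsBoundedSpherical K φ ∧ IsEigenvalueTuple D φ ξ}

variable (N)

/-- The space `𝒮(N)^K` of `K`-invariant Schwartz functions, with the topology of `𝒮(N)`. The Schwartz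
space of `N` is that of the vector space underlying `N` in exponential coordinates. -/
def InvSchwartz : Submodule ℂ 𝓢(N, ℂ) where
  carrier := {F | ∀ (k : K) (x : N), F (k • x) = F x}
  add_mem' hF hG k x := by simp [hF k x, hG k x]
  zero_mem' _ _ := rfl
  smul_mem' c F hF k x := by simp [hF k x]

end Operators

/-- The Schwartz functions on `ℝ^d` which vanish on `S`. -/
def vanishingOn {d : ℕ} (S : Set (EuclideanSpace ℝ (Fin d))) :
    Submodule ℂ 𝓢(EuclideanSpace ℝ (Fin d), ℂ) where
  carrier := {f | ∀ ξ ∈ S, f ξ = 0}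
  add_mem' hf hg ξ hξ := by simp [hf ξ hξ, hg ξ hξ]
  zero_mem' _ _ := rfl
  smul_mem' c f hf ξ hξ := by simp [hf ξ hξ]

/-- The space `𝒮(S)` of restrictions to `S` of Schwartz functions on `ℝ^d`, with the quotient
topology. -/
abbrev SchwartzOn {d : ℕ} (S : Set (EuclideanSpace ℝ (Fin d))) : Type :=
  𝓢(EuclideanSpace ℝ (Fin d), ℂ) ⧸ vanishingOn S

section Transform

variable {N : Type*} [NormedAddCommGroup N] [NormedSpace ℝ N] [FiniteDimensional ℝ N]
  [MeasurableSpace N] [BorelSpace N] [NilpotentLieGroup N]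

/-- The spherical transform `𝒢F(φ) = ∫ F(x) φ(x⁻¹) dx`. In exponential coordinates, the Haar
measure of `N` is the Lebesgue measure. -/
noncomputable def sphericalTransform (F φ : N → ℂ) : ℂ :=
  ∫ x, F x * φ x⁻¹ ∂(Measure.addHaar : Measure N)

/-- `D` is formally self-adjoint: it is symmetric on the test functions in `L²(N)`. -/
def FormallySelfAdjoint (D : Module.End ℂ (Smooth N)) : Prop :=
  ∀ f g : Smooth N, HasCompactSupport f.1 → HasCompactSupport g.1 →
    ∫ x, (D f).1 x * (starRingEnd ℂ) (g.1 x) ∂(Measure.addHaar : Measure N) =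
      ∫ x, f.1 x * (starRingEnd ℂ) ((D g).1 x) ∂(Measure.addHaar : Measure N)

variable (K : Type*) [Group K] [TopologicalSpace K] [MulDistribMulAction K N] [ContinuousSMul K N]

/-- `𝒟 = (D₁, …, D_d)` is a system of formally self-adjoint generators of the algebra `𝔻(N)^K`. -/
def IsGeneratingSystem {d : ℕ} (D : Fin d → Module.End ℂ (Smooth N)) : Prop :=
  Algebra.adjoin ℂ (Set.range D) = invDiffOps N K ∧ ∀ j, FormallySelfAdjoint (D j)

/-- The spherical transform is an isomorphism of topological vector spaces from `𝒮(N)^K` onto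
`𝒮(Σ_𝒟)`, when the Gelfand spectrum is identified with `Σ_𝒟 ⊆ ℝ^d` (each bounded spherical function
`φ` with the real tuple `ξ` of its eigenvalues): the class `T F` of a Schwartz function `f` on `ℝ^d`
is the transform of `F` in the sense that `f(ξ) = 𝒢F(φ)` for every bounded spherical function `φ`. -/
def PropertySFor {d : ℕ} (D : Fin d → Module.End ℂ (Smooth N)) : Prop :=
  ∃ T : InvSchwartz N K ≃L[ℂ] SchwartzOn (spectrumSet K D),
    ∀ (F : InvSchwartz N K) (f : 𝓢(EuclideanSpace ℝ (Fin d), ℂ)),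
      T F = Submodule.Quotient.mk f →
        ∀ φ : Smooth N, IsBoundedSpherical K φ →
          ∃ ξ, IsEigenvalueTuple D φ ξ ∧ sphericalTransform F.1 φ.1 = f ξ

variable (N)

/-- Property (S) of the pair `(N, K)`, for some system of formally self-adjoint generators. -/
def PropertyS : Prop :=
  ∃ (d : ℕ) (D : Fin d → Module.End ℂ (Smooth N)), IsGeneratingSystem K D ∧ PropertySFor K D

end Transform

end GelfandPair

/-! ### Absolutely convergent series in complete polynormable spaces -/

section Seminorms

/-! The algebra, the spectrum and the Schwartz spaces of the product are all tensor products of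
those of the factors; the proof makes each of these statements explicit enough to transport property
(S).

Algebra. A left-invariant operator on `N₁ × N₂` is a finite sum of products `A ⊗ B` of operators on
the factors, and operators lifted from different factors commute. Expanding over a basis of one
factor and comparing coefficients shows that for an invariant operator the `A` and `B` can be taken
invariant (`invDiffOps_prod_le`). This gives commutativity, and it shows that the lifts of
generators of the factors generate (`adjoin_lift_eq`).

Spectrum. Products of bounded spherical functions are bounded spherical. Conversely, every slice of
a bounded spherical function `Φ` is a bounded invariant eigenfunction with eigenvalues independent
of the slice. Property (S) on `N₁` forces such eigenfunctions to be proportional, since all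
spherical transforms are read off from the eigenvalue tuple and an invariant smooth function is
determined by its pairings with invariant Schwartz functions. Hence `Φ` is the product of its two
slices at the identity (`IsTransform.eq_smoothTensor`).

Analysis. In place of the theory of nuclear spaces, a Gabor expansion writes every Schwartz function
on `V × W` as a series `∑ c i F • (e i ⊗ e' i)`, absolutely convergent against products of
continuous seminorms and with bounds that are continuous in `F` (`exists_tensor_expansion`).
Averaging over the compact groups makes the terms invariant. A jointly continuous bilinear map can
be applied term by term (`exists_clm_hasSum_bilin`), so the transforms `T₁`, `T₂` yield a continuous
map `A` from invariant Schwartz functions to functions on the spectrum, and their inverses yield a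
continuous map `B` from Schwartz functions on `ℝ^(d₁ + d₂)` to invariant ones. Evaluated at
spherical functions, `A` is the spherical transform and `B` its inverse, up to one normalization
constant of Haar measures. The transform on the product is injective, by treating one variable at a
time (`injective_prod`), so `B` factors through restriction to the spectrum and inverts `A`;
continuity of the inverse comes for free.

Change of generators. Two systems of formally self-adjoint generators are polynomials in each other,
and self-adjointness makes their eigenvalues real polynomials in each other. The two spectra are
therefore related by polynomial maps `R`, `S`, inverse to each other on the spectra. Composition
with `S` alone need not preserve Schwartz functions; multiplying by a cut-off of `η - R (S η)`,
which is `1` on the spectrum, repairs this (`exists_schwartz_pullback`). -/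

theorem Seminorm.continuous_finset_sup {E κ : Type*} [AddCommGroup E] [Module ℂ E]
    [TopologicalSpace E] (p : κ → Seminorm ℂ E)
    (hp : ∀ i, Continuous (p i)) (s : Finset κ) : Continuous ⇑(s.sup p : Seminorm ℂ E) := by
  classical
  induction s using Finset.induction_on with
  | empty => exact continuous_const (y := (0 : ℝ))
  | insert i s _ ih =>
    rw [Finset.sup_insert]
    exact (hp i).max ih

/-- An absolutely summable family in a complete polynormable space is summable. -/
theorem summable_of_summable_seminorm {Q κ : Type*} [AddCommGroup Q] [Module ℂ Q]
    [TopologicalSpace Q] [IsTopologicalAddGroup Q] [PolynormableSpace ℂ Q]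
    (hQ : @CompleteSpace Q (IsTopologicalAddGroup.rightUniformSpace Q)) (v : κ → Q)
    (hv : ∀ p : Seminorm ℂ Q, Continuous p → Summable fun i => p (v i)) : Summable v := by
  -- `Q` carries only a topology. The uniformity is installed locally so that the Cauchy criterion
  -- `summable_iff_vanishing` applies; a ball of a finite supremum of seminorms then reduces it to
  -- the scalar series.
  let : UniformSpace Q := IsTopologicalAddGroup.rightUniformSpace Q
  have : IsUniformAddGroup Q := isUniformAddGroup_of_addCommGroup
  have hw := PolynormableSpace.withSeminorms ℂ Q
  rw [summable_iff_vanishing]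
  intro e he
  obtain ⟨s, r, hr, hsub⟩ := (hw.mem_nhds_iff 0 e).1 he
  set p : Seminorm ℂ Q := s.sup (fun p => p.1) with hpdef
  have hpc : Continuous p := Seminorm.continuous_finset_sup _ (fun i => hw.continuous_seminorm i) s
  have hsum := hv p hpc
  obtain ⟨t, ht⟩ := (summable_iff_vanishing.1 hsum) (Metric.ball 0 r) (Metric.ball_mem_nhds 0 hr)
  refine ⟨t, fun u hu => hsub ?_⟩
  have h1 := ht u hu
  rw [mem_ball_zero_iff, Real.norm_eq_abs] at h1
  rw [Seminorm.mem_ball, sub_zero]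
  refine lt_of_le_of_lt ?_ (lt_of_le_of_lt (le_abs_self _) h1)
  exact Finset.le_sum_of_subadditive p (map_zero p).le (map_add_le_add p) u v

theorem Seminorm.le_of_hasSum {Q κ : Type*} [AddCommGroup Q] [Module ℂ Q]
    [TopologicalSpace Q] (p : Seminorm ℂ Q) (hp : Continuous p) {v : κ → Q} {x : Q}
    (h : HasSum v x) (hs : Summable fun i => p (v i)) : p x ≤ ∑' i, p (v i) := by
  have h1 : Tendsto (fun s : Finset κ => p (∑ i ∈ s, v i)) atTop (𝓝 (p x)) :=
    (hp.tendsto x).comp h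
  refine le_of_tendsto_of_tendsto' h1 hs.hasSum fun s => ?_
  exact Finset.le_sum_of_subadditive p (map_zero p).le (map_add_le_add p) s v

/-- A rapidly converging expansion with coefficients depending linearly on a vector defines
a continuous linear map. -/
theorem exists_clm_hasSum {E Q κ : Type*} [AddCommGroup E] [Module ℂ E] [TopologicalSpace E]
    [IsTopologicalAddGroup E] [ContinuousSMul ℂ E]
    [AddCommGroup Q] [Module ℂ Q]
    [TopologicalSpace Q] [IsTopologicalAddGroup Q] [ContinuousSMul ℂ Q] [PolynormableSpace ℂ Q]
    [T2Space Q]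
    (hQ : @CompleteSpace Q (IsTopologicalAddGroup.rightUniformSpace Q))
    (c : κ → E →ₗ[ℂ] ℂ) (u : κ → Q)
    (h : ∀ p : Seminorm ℂ Q, Continuous p → ∃ q : Seminorm ℂ E, Continuous q ∧
      ∀ F, Summable (fun i => ‖c i F‖ * p (u i)) ∧ ∑' i, ‖c i F‖ * p (u i) ≤ q F) :
    ∃ A : E →L[ℂ] Q, ∀ F, HasSum (fun i => c i F • u i) (A F) := by
  have hs : ∀ F, Summable fun i => c i F • u i := fun F => by
    refine summable_of_summable_seminorm hQ _ fun p hp => ?_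
    obtain ⟨q, -, hq⟩ := h p hp
    simpa only [map_smul_eq_mul] using (hq F).1
  let A : E →ₗ[ℂ] Q :=
    { toFun := fun F => ∑' i, c i F • u i
      map_add' := fun F G => by
        rw [← (hs F).tsum_add (hs G)]
        simp only [map_add, add_smul]
      map_smul' := fun a F => by
        simp only [map_smul, smul_eq_mul, mul_smul, RingHom.id_apply]
        exact (hs F).tsum_const_smul a }
  -- The sum of the seminorms of the terms is already bounded by a continuous seminorm of `F`, so no
  -- uniform boundedness principle is needed.
  have hA : Continuous A := by
    have hw := PolynormableSpace.withSeminorms ℂ Q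
    refine hw.continuous_of_continuous_comp A fun p => ?_
    obtain ⟨q, hqc, hq⟩ := h p.1 (hw.continuous_seminorm p)
    refine Seminorm.continuous_of_le hqc fun F => ?_
    have h1 : HasSum (fun i => c i F • u i) (A F) := (hs F).hasSum
    have h2 : (p.1 : Seminorm ℂ Q) (A F) ≤ _ :=
      Seminorm.le_of_hasSum p.1 (hw.continuous_seminorm p) h1
      (by simpa only [map_smul_eq_mul] using (hq F).1)
    refine h2.trans ?_
    simpa only [map_smul_eq_mul] using (hq F).2
  exact ⟨⟨A, hA⟩, fun F => (hs F).hasSum⟩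

end Seminorms

/-! ### Completeness of the Schwartz space -/

namespace SchwartzMap

section Complete

variable {V : Type*} [NormedAddCommGroup V] [NormedSpace ℝ V]

/-- An absolutely summable family of Schwartz functions has a sum. -/
theorem exists_hasSum {κ : Type*} (v : κ → 𝓢(V, ℂ))
    (hv : ∀ k n, Summable fun i => SchwartzMap.seminorm ℂ k n (v i)) : ∃ g, HasSum v g := by
  have hb : ∀ (n : ℕ) (i : κ) (x : V),
      ‖iteratedFDeriv ℝ n (v i) x‖ ≤ SchwartzMap.seminorm ℂ 0 n (v i) := fun n i x =>
    norm_iteratedFDeriv_le_seminorm ℂ (v i) n x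
  have hcd : ∀ i, ContDiff ℝ ((⊤ : ℕ∞) : WithTop ℕ∞) (v i) := fun i => (v i).smooth ⊤
  have hsm : ContDiff ℝ ((⊤ : ℕ∞) : WithTop ℕ∞) (fun x => ∑' i, v i x) :=
    contDiff_tsum hcd (fun k _ => hv 0 k) (fun k i x _ => hb k i x)
  have hD : ∀ (n : ℕ) (x : V), iteratedFDeriv ℝ n (fun x => ∑' i, v i x) x =
      ∑' i, iteratedFDeriv ℝ n (v i) x := fun n x =>
    iteratedFDeriv_tsum_apply hcd (fun k _ => hv 0 k) (fun k i x _ => hb k i x)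
      (by exact_mod_cast le_top) x
  have hDs : ∀ (n : ℕ) (x : V), Summable fun i => iteratedFDeriv ℝ n (v i) x := fun n x =>
    Summable.of_norm_bounded (hv 0 n) fun i => hb n i x
  have hDs' : ∀ (n : ℕ) (x : V), Summable fun i => ‖iteratedFDeriv ℝ n (v i) x‖ := fun n x =>
    Summable.of_nonneg_of_le (fun _ => norm_nonneg _) (fun i => hb n i x) (hv 0 n)
  let g : 𝓢(V, ℂ) :=
    { toFun := fun x => ∑' i, v i x
      smooth' := hsm
      decay' := fun k n => ⟨∑' i, SchwartzMap.seminorm ℂ k n (v i), fun x => by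
        rw [hD]
        calc ‖x‖ ^ k * ‖∑' i, iteratedFDeriv ℝ n (v i) x‖
            ≤ ‖x‖ ^ k * ∑' i, ‖iteratedFDeriv ℝ n (v i) x‖ := by
              gcongr
              exact norm_tsum_le_tsum_norm (hDs' n x)
          _ = ∑' i, ‖x‖ ^ k * ‖iteratedFDeriv ℝ n (v i) x‖ := by rw [tsum_mul_left]
          _ ≤ _ := Summable.tsum_le_tsum (fun i => le_seminorm ℂ k n (v i) x)
              ((hDs' n x).mul_left _) (hv k n)⟩ }
  refine ⟨g, ?_⟩
  -- So far `g` is only the pointwise sum. The remainder after `s` is, with all its derivatives, the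
  -- series over the complement of `s`, so each of its seminorms is at most the tail of a convergent
  -- scalar series.
  rw [HasSum, (schwartz_withSeminorms ℂ V ℂ).tendsto_nhds]
  rintro ⟨k, n⟩ ε hε
  have h0 := tendsto_tsum_compl_atTop_zero fun i => SchwartzMap.seminorm ℂ k n (v i)
  simp only [SummationFilter.unconditional_filter]
  filter_upwards [h0.eventually (gt_mem_nhds hε)] with s hs
  refine lt_of_le_of_lt ?_ hs
  rw [schwartzSeminormFamily_apply]
  refine seminorm_le_bound ℂ k n _ (tsum_nonneg fun _ => apply_nonneg _ _) fun x => ?_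
  have e1 : (⇑(∑ i ∈ s, v i - g) : V → ℂ) = (fun x => ∑ i ∈ s, v i x) - ⇑g := by
    ext x; simp
  have hgs : ContDiffAt ℝ n g x := (g.smooth n).contDiffAt
  have e2 : iteratedFDeriv ℝ n (⇑(∑ i ∈ s, v i - g)) x =
      -∑' i : ↥((s : Set κ)ᶜ), iteratedFDeriv ℝ n (v i) x := by
    rw [e1]
    have hss : ContDiffAt ℝ n (fun x => ∑ i ∈ s, v i x) x :=
      (ContDiff.sum fun i _ => (v i).smooth n).contDiffAt
    have e4 : iteratedFDeriv ℝ n (fun x => ∑ i ∈ s, v i x) x =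
        ∑ i ∈ s, iteratedFDeriv ℝ n (v i) x := by
      rw [iteratedFDeriv_fun_sum_apply fun i _ => ((v i).smooth n).contDiffAt]
    rw [iteratedFDeriv_sub_apply hss hgs, e4]
    have e3 : iteratedFDeriv ℝ n g x = ∑' i, iteratedFDeriv ℝ n (v i) x := hD n x
    rw [e3, ← (hDs n x).sum_add_tsum_compl (s := s)]
    abel
  rw [e2, norm_neg]
  have hs1 : Summable fun i : ↥((s : Set κ)ᶜ) => ‖iteratedFDeriv ℝ n (v i) x‖ :=
    (hDs' n x).subtype _
  calc ‖x‖ ^ k * ‖∑' i : ↥((s : Set κ)ᶜ), iteratedFDeriv ℝ n (v i) x‖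
      ≤ ‖x‖ ^ k * ∑' i : ↥((s : Set κ)ᶜ), ‖iteratedFDeriv ℝ n (v i) x‖ := by
        gcongr
        exact norm_tsum_le_tsum_norm hs1
    _ = ∑' i : ↥((s : Set κ)ᶜ), ‖x‖ ^ k * ‖iteratedFDeriv ℝ n (v i) x‖ := by rw [tsum_mul_left]
    _ ≤ _ := Summable.tsum_le_tsum (fun i => le_seminorm ℂ k n (v i) x)
        (hs1.mul_left _) ((hv k n).subtype _)

/-- The topology comes from countably many seminorms, so it is enough to treat sequences whose
differences are geometrically small in an increasing family of them; the telescoping series of such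
a sequence is absolutely summable. -/
instance instCompleteSpace : CompleteSpace 𝓢(V, ℂ) := by
  have hw := schwartz_withSeminorms ℂ V ℂ
  have : (uniformity 𝓢(V, ℂ)).IsCountablyGenerated :=
    IsUniformAddGroup.uniformity_countably_generated
  let p : ℕ → Seminorm ℂ 𝓢(V, ℂ) := fun N =>
    (Finset.Iic (N, N)).sup (schwartzSeminormFamily ℂ V ℂ)
  have hp : ∀ N, Continuous (p N) := fun N =>
    Seminorm.continuous_finset_sup _ (fun i => hw.continuous_seminorm i) _
  refine UniformSpace.complete_of_convergent_controlled_sequences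
    (fun N => {q : 𝓢(V, ℂ) × 𝓢(V, ℂ) | p N (q.2 - q.1) < (1 / 2) ^ N}) (fun N => ?_)
    (fun u hu => ?_)
  · rw [uniformity_eq_comap_nhds_zero]
    refine ⟨{f | p N f < (1 / 2) ^ N}, ?_, fun q hq => hq⟩
    refine (isOpen_lt (hp N) continuous_const).mem_nhds ?_
    simp
  · obtain ⟨g, hg⟩ := exists_hasSum (fun n => u (n + 1) - u n) fun k n => by
      -- Only from the index `max k n` on does the supremum defining the controlled sequence contain
      -- the `(k, n)` seminorm.
      rw [← summable_nat_add_iff (max k n)]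
      refine Summable.of_nonneg_of_le (fun _ => apply_nonneg _ _) (fun j => ?_)
        ((summable_nat_add_iff (max k n)).2 summable_geometric_two)
      have h1 := hu (j + max k n) (j + max k n) (j + max k n + 1) le_rfl (Nat.le_succ _)
      refine le_trans ?_ (le_of_lt h1)
      have hm : (k, n) ∈ Finset.Iic (j + max k n, j + max k n) := by
        rw [Finset.mem_Iic]
        exact ⟨by simp only; omega, by simp only; omega⟩
      exact (Finset.le_sup (f := schwartzSeminormFamily ℂ V ℂ) hm) _
    have h2 := hg.tendsto_sum_nat
    simp only [Finset.sum_range_sub] at h2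
    exact ⟨g + u 0, by simpa using h2.add_const (u 0)⟩

end Complete

end SchwartzMap

/-! ### Evaluation and tensor products of Schwartz functions -/

namespace SchwartzMap

section Evaluation

variable {V : Type*} [NormedAddCommGroup V] [NormedSpace ℝ V]

theorem continuous_eval (x : V) : Continuous fun f : 𝓢(V, ℂ) => f x :=
  (continuous_eval_const (F := BoundedContinuousFunction V ℂ) x).comp
    (toBoundedContinuousFunctionCLM ℂ V ℂ).continuous

theorem hasSum_apply {κ : Type*} {v : κ → 𝓢(V, ℂ)} {f : 𝓢(V, ℂ)} (h : HasSum v f) (x : V) :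
    HasSum (fun i => v i x) (f x) := by
  let e : 𝓢(V, ℂ) →+ ℂ := { toFun := fun f => f x, map_zero' := rfl, map_add' := fun _ _ => rfl }
  exact h.map e (continuous_eval x)

/-- A continuous seminorm on the Schwartz space is bounded by finitely many of the standard ones. -/
theorem exists_le_sup_seminorm (p : Seminorm ℂ 𝓢(V, ℂ)) (hp : Continuous p) :
    ∃ (s : Finset (ℕ × ℕ)) (C : ℝ), 0 ≤ C ∧
      ∀ f, p f ≤ C * (s.sup (schwartzSeminormFamily ℂ V ℂ) : Seminorm ℂ 𝓢(V, ℂ)) f := by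
  obtain ⟨s, C, -, h⟩ := Seminorm.bound_of_continuous (schwartz_withSeminorms ℂ V ℂ) p hp
  exact ⟨s, C, C.2, fun f => h f⟩

theorem continuous_sup_seminorm (s : Finset (ℕ × ℕ)) :
    Continuous ⇑(s.sup (schwartzSeminormFamily ℂ V ℂ) : Seminorm ℂ 𝓢(V, ℂ)) :=
  Seminorm.continuous_finset_sup _
    (fun i => (schwartz_withSeminorms ℂ V ℂ).continuous_seminorm i) s

theorem le_sup_seminorm {s : Finset (ℕ × ℕ)} {k n : ℕ} (h : (k, n) ∈ s) (f : 𝓢(V, ℂ)) (x : V) :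
    ‖x‖ ^ k * ‖iteratedFDeriv ℝ n f x‖ ≤
      (s.sup (schwartzSeminormFamily ℂ V ℂ) : Seminorm ℂ 𝓢(V, ℂ)) f :=
  (le_seminorm ℂ k n f x).trans
    ((Finset.le_sup (f := schwartzSeminormFamily ℂ V ℂ) h : _ ≤ _) f)

end Evaluation

section Tensor

variable {V W : Type*} [NormedAddCommGroup V] [NormedSpace ℝ V]
  [NormedAddCommGroup W] [NormedSpace ℝ W]

/-- Leibniz rule: the projections have norm at most `1`, and `‖z‖ ^ k ≤ ‖z.1‖ ^ k + ‖z.2‖ ^ k` puts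
the weight on one factor at a time. These two terms and the sum of the binomial coefficients give `2
^ (n + 1)`. -/
theorem norm_iteratedFDeriv_mul_fst_snd_le (f : 𝓢(V, ℂ)) (g : 𝓢(W, ℂ)) (k n : ℕ) (z : V × W) :
    ‖z‖ ^ k * ‖iteratedFDeriv ℝ n (fun z : V × W => f z.1 * g z.2) z‖ ≤
      2 ^ (n + 1) * (((Finset.Iic (k, n)).sup (schwartzSeminormFamily ℂ V ℂ) : Seminorm ℂ _) f *
        ((Finset.Iic (k, n)).sup (schwartzSeminormFamily ℂ W ℂ) : Seminorm ℂ _) g) := by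
  set P := ((Finset.Iic (k, n)).sup (schwartzSeminormFamily ℂ V ℂ) : Seminorm ℂ 𝓢(V, ℂ))
  set Q := ((Finset.Iic (k, n)).sup (schwartzSeminormFamily ℂ W ℂ) : Seminorm ℂ 𝓢(W, ℂ))
  have h1 : ∀ i, ‖iteratedFDeriv ℝ i (fun z : V × W => f z.1) z‖ ≤ ‖iteratedFDeriv ℝ i f z.1‖ := by
    intro i
    have e := (ContinuousLinearMap.fst ℝ V W).iteratedFDeriv_comp_right (f.smooth i) z le_rfl
    have e' : (fun z : V × W => f z.1) = f ∘ (ContinuousLinearMap.fst ℝ V W) := rfl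
    rw [e', e]
    refine (ContinuousMultilinearMap.norm_compContinuousLinearMap_le _ _).trans ?_
    refine mul_le_of_le_one_right (norm_nonneg _) (Finset.prod_le_one (fun _ _ => norm_nonneg _)
      fun _ _ => ContinuousLinearMap.norm_fst_le ℝ V W)
  have h2 : ∀ i, ‖iteratedFDeriv ℝ i (fun z : V × W => g z.2) z‖ ≤ ‖iteratedFDeriv ℝ i g z.2‖ := by
    intro i
    have e := (ContinuousLinearMap.snd ℝ V W).iteratedFDeriv_comp_right (g.smooth i) z le_rfl
    have e' : (fun z : V × W => g z.2) = g ∘ (ContinuousLinearMap.snd ℝ V W) := rfl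
    rw [e', e]
    refine (ContinuousMultilinearMap.norm_compContinuousLinearMap_le _ _).trans ?_
    refine mul_le_of_le_one_right (norm_nonneg _) (Finset.prod_le_one (fun _ _ => norm_nonneg _)
      fun _ _ => ContinuousLinearMap.norm_snd_le ℝ V W)
  have hz : ‖z‖ ^ k ≤ ‖z.1‖ ^ k + ‖z.2‖ ^ k := by
    rcases le_total ‖z.1‖ ‖z.2‖ with h | h
    · rw [Prod.norm_def, max_eq_right h]; exact le_add_of_nonneg_left (by positivity)
    · rw [Prod.norm_def, max_eq_left h]; exact le_add_of_nonneg_right (by positivity)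
  have hf : ContDiff ℝ n (fun z : V × W => f z.1) := (f.smooth n).comp contDiff_fst
  have hg : ContDiff ℝ n (fun z : V × W => g z.2) := (g.smooth n).comp contDiff_snd
  have key : ∀ i ∈ Finset.range (n + 1),
      ‖z‖ ^ k * ((n.choose i : ℝ) * ‖iteratedFDeriv ℝ i (fun z : V × W => f z.1) z‖ *
        ‖iteratedFDeriv ℝ (n - i) (fun z : V × W => g z.2) z‖) ≤
      (n.choose i : ℝ) * (2 * (P f * Q g)) := by
    intro i hi
    have hi' : i ≤ n := Nat.lt_succ_iff.1 (Finset.mem_range.1 hi)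
    have a1 := le_sup_seminorm (s := Finset.Iic (k, n)) (k := k) (n := i)
      (by simpa using hi') f z.1
    have a2 := le_sup_seminorm (s := Finset.Iic (k, n)) (k := 0) (n := i)
      (by simpa using hi') f z.1
    have b1 := le_sup_seminorm (s := Finset.Iic (k, n)) (k := k) (n := n - i)
      (by simp) g z.2
    have b2 := le_sup_seminorm (s := Finset.Iic (k, n)) (k := 0) (n := n - i)
      (by simp) g z.2
    rw [pow_zero, one_mul] at a2 b2
    have hP : 0 ≤ P f := apply_nonneg _ _
    calc _ ≤ (‖z.1‖ ^ k + ‖z.2‖ ^ k) * ((n.choose i : ℝ) * ‖iteratedFDeriv ℝ i f z.1‖ *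
        ‖iteratedFDeriv ℝ (n - i) g z.2‖) := by
          gcongr
          · exact h1 i
          · exact h2 (n - i)
      _ = (n.choose i : ℝ) * ((‖z.1‖ ^ k * ‖iteratedFDeriv ℝ i f z.1‖) *
            ‖iteratedFDeriv ℝ (n - i) g z.2‖ + ‖iteratedFDeriv ℝ i f z.1‖ *
            (‖z.2‖ ^ k * ‖iteratedFDeriv ℝ (n - i) g z.2‖)) := by ring
      _ ≤ (n.choose i : ℝ) * (P f * Q g + P f * Q g) := by gcongr
      _ = _ := by ring
  calc _ ≤ ‖z‖ ^ k * ∑ i ∈ Finset.range (n + 1), (n.choose i : ℝ) *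
        ‖iteratedFDeriv ℝ i (fun z : V × W => f z.1) z‖ *
        ‖iteratedFDeriv ℝ (n - i) (fun z : V × W => g z.2) z‖ := by
        gcongr
        exact norm_iteratedFDeriv_mul_le hf hg z le_rfl
    _ ≤ ∑ i ∈ Finset.range (n + 1), (n.choose i : ℝ) * (2 * (P f * Q g)) := by
        rw [Finset.mul_sum]
        exact Finset.sum_le_sum key
    _ = _ := by
        rw [← Finset.sum_mul]
        have := Nat.sum_range_choose n
        have h' : (∑ i ∈ Finset.range (n + 1), (n.choose i : ℝ)) = 2 ^ n := by exact_mod_cast this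
        rw [h']
        ring

/-- The tensor product `(x, y) ↦ f x * g y` of two Schwartz functions. -/
noncomputable def tensor (f : 𝓢(V, ℂ)) (g : 𝓢(W, ℂ)) : 𝓢(V × W, ℂ) where
  toFun z := f z.1 * g z.2
  smooth' := ((f.smooth ⊤).comp contDiff_fst).mul ((g.smooth ⊤).comp contDiff_snd)
  decay' k n := ⟨_, norm_iteratedFDeriv_mul_fst_snd_le f g k n⟩

@[simp]
theorem tensor_apply (f : 𝓢(V, ℂ)) (g : 𝓢(W, ℂ)) (z : V × W) : tensor f g z = f z.1 * g z.2 := rfl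

/-- Quantitative joint continuity of the tensor product. -/
theorem exists_seminorm_tensor_le (p : Seminorm ℂ 𝓢(V × W, ℂ)) (hp : Continuous p) :
    ∃ (p₁ : Seminorm ℂ 𝓢(V, ℂ)) (p₂ : Seminorm ℂ 𝓢(W, ℂ)), Continuous p₁ ∧ Continuous p₂ ∧
      ∀ f g, p (tensor f g) ≤ p₁ f * p₂ g := by
  obtain ⟨s, C, hC, h⟩ := exists_le_sup_seminorm p hp
  -- The Leibniz bound at index `i` uses all seminorms below `i`, so the index set is closed
  -- downwards.
  let t : Finset (ℕ × ℕ) := s.biUnion fun i => Finset.Iic i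
  let D : ℝ := C * ∑ i ∈ s, 2 ^ (i.2 + 1)
  have hD : 0 ≤ D := mul_nonneg hC (Finset.sum_nonneg fun _ _ => by positivity)
  refine ⟨D.toNNReal • t.sup (schwartzSeminormFamily ℂ V ℂ),
    t.sup (schwartzSeminormFamily ℂ W ℂ), ?_, continuous_sup_seminorm t, fun f g => ?_⟩
  · exact continuous_const.mul (continuous_sup_seminorm t)
  have e : (D.toNNReal • t.sup (schwartzSeminormFamily ℂ V ℂ) : Seminorm ℂ _) f =
    D * (t.sup (schwartzSeminormFamily ℂ V ℂ) : Seminorm ℂ _) f := by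
    rw [smul_apply, NNReal.smul_def, smul_eq_mul, Real.coe_toNNReal _ hD]
  rw [e, mul_assoc]
  refine (h _).trans ?_
  rw [mul_assoc C]
  refine mul_le_mul_of_nonneg_left ?_ hC
  refine Seminorm.finset_sup_apply_le (by positivity) fun i hi => ?_
  have hsub : Finset.Iic i ⊆ t := Finset.subset_biUnion_of_mem (fun i => Finset.Iic i) hi
  calc schwartzSeminormFamily ℂ (V × W) ℂ i (tensor f g) ≤ _ :=
        seminorm_le_bound ℂ i.1 i.2 _ (by positivity)
          (norm_iteratedFDeriv_mul_fst_snd_le f g i.1 i.2)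
    _ ≤ 2 ^ (i.2 + 1) * ((t.sup (schwartzSeminormFamily ℂ V ℂ) : Seminorm ℂ _) f *
        (t.sup (schwartzSeminormFamily ℂ W ℂ) : Seminorm ℂ _) g) := by
        have h1 := (Finset.sup_mono hsub : (Finset.Iic i).sup (schwartzSeminormFamily ℂ V ℂ) ≤ _) f
        have h2 := (Finset.sup_mono hsub : (Finset.Iic i).sup (schwartzSeminormFamily ℂ W ℂ) ≤ _) g
        exact mul_le_mul_of_nonneg_left (mul_le_mul h1 h2 (apply_nonneg _ _) (apply_nonneg _ _))
          (by positivity)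
    _ ≤ _ := by
        refine mul_le_mul_of_nonneg_right ?_
          (mul_nonneg (apply_nonneg _ _) (apply_nonneg _ _))
        exact Finset.single_le_sum (f := fun i : ℕ × ℕ => (2 : ℝ) ^ (i.2 + 1))
          (fun _ _ => by positivity) hi

end Tensor

end SchwartzMap

/-! ### A lattice partition of unity and Fourier series on a cell -/

namespace GaborExpansion

variable {ι : Type*} [Fintype ι]

/-- The point of `ℝ^ι` with integral coordinates `l`. -/
noncomputable def intVec (l : ι → ℤ) : EuclideanSpace ℝ ι := WithLp.toLp 2 fun a => (l a : ℝ)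

@[simp]
theorem intVec_apply {ι : Type*} (l : ι → ℤ) (a : ι) : intVec l a = l a := rfl

theorem summable_intVec (ι : Type*) [Fintype ι] :
    ∃ n : ℕ, Summable fun l : ι → ℤ => ((1 + ‖intVec l‖) ^ n)⁻¹ := by
  classical
  let b : Module.Basis ι ℝ (EuclideanSpace ℝ ι) := (EuclideanSpace.basisFun ι ℝ).toBasis
  let L : Submodule ℤ (EuclideanSpace ℝ ι) := Submodule.span ℤ (Set.range b)
  have hmem : ∀ l : ι → ℤ, intVec l ∈ L := fun l => by
    have : intVec l = ∑ a, l a • b a := by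
      ext j
      simp [b, Pi.single_apply]
    rw [this]
    exact Submodule.sum_mem _ fun a _ => L.smul_mem _ (Submodule.subset_span ⟨a, rfl⟩)
  let φ : (ι → ℤ) → L := fun l => ⟨intVec l, hmem l⟩
  have hφ : Function.Injective φ := fun l m h => by
    ext a
    have h1 : intVec l = intVec m := congrArg Subtype.val h
    have h2 := congrArg (fun x : EuclideanSpace ℝ ι => x a) h1
    simpa using h2
  refine ⟨Module.finrank ℤ L + 1, ?_⟩
  have h1 := (ZLattice.summable_norm_pow_inv (L := L) (Module.finrank ℤ L + 1)
    (Nat.lt_succ_self _)).comp_injective hφ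
  simp only [inv_pow] at h1
  -- The lattice sum gives the origin the value `0⁻¹ = 0`, whereas the term wanted there is `1`;
  -- this indicator supplies it.
  have h2 : Summable fun l : ι → ℤ => if l = 0 then (1 : ℝ) else 0 :=
    (hasSum_ite_eq (0 : ι → ℤ) (1 : ℝ)).summable
  refine Summable.of_nonneg_of_le (fun _ => by positivity) (fun l => ?_) (h1.add h2)
  by_cases hl : l = 0
  · have hp : 0 ≤ ((‖φ l‖ ^ (Module.finrank ℤ L + 1))⁻¹ : ℝ) := by positivity
    have hq : ((1 + ‖intVec l‖) ^ (Module.finrank ℤ L + 1))⁻¹ ≤ (1 : ℝ) :=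
      inv_le_one_of_one_le₀ (one_le_pow₀ (by linarith [norm_nonneg (intVec l)]))
    simp only [Function.comp_apply, hl, if_true] at hp hq ⊢
    linarith
  · have hpos : 0 < ‖intVec l‖ := norm_pos_iff.2 fun h => hl <| by
      ext a
      have := congrArg (fun x : EuclideanSpace ℝ ι => x a) h
      simpa using this
    simp only [hl, if_false, add_zero, Function.comp_apply]
    have e : ‖φ l‖ = ‖intVec l‖ := rfl
    rw [e]
    gcongr
    linarith

section Box

/-- The product of copies of a smooth cut-off function in each variable. -/
noncomputable def boxFun (ι : Type*) [Fintype ι] (η : ℝ → ℝ) (hη : ContDiff ℝ ∞ η)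
    (hs : ∀ t, η t ≠ 0 → |t| ≤ 1) : 𝓢(EuclideanSpace ℝ ι, ℂ) :=
  HasCompactSupport.toSchwartzMap (f := fun x : EuclideanSpace ℝ ι => ((∏ a, η (x a) : ℝ) : ℂ))
    (by
      refine HasCompactSupport.intro
        (K := (WithLp.toLp 2) '' (Set.univ.pi fun _ : ι => Set.Icc (-1 : ℝ) 1)) ?_ fun x hx => ?_
      · exact (isCompact_univ_pi fun _ => isCompact_Icc).image (PiLp.continuous_toLp 2 _)
      · by_contra h
        refine hx ⟨x.ofLp, fun a _ => ?_, rfl⟩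
        have : η (x a) ≠ 0 := fun h0 => h (by
          rw [Finset.prod_eq_zero (Finset.mem_univ a) h0, Complex.ofReal_zero])
        exact abs_le.1 (hs _ this))
    (by
      refine Complex.ofRealCLM.contDiff.comp ?_
      exact contDiff_prod fun a _ => hη.comp (EuclideanSpace.proj (𝕜 := ℝ) a).contDiff)

theorem boxFun_apply (η : ℝ → ℝ) (hη : ContDiff ℝ ∞ η)
    (hs : ∀ t, η t ≠ 0 → |t| ≤ 1) (x : EuclideanSpace ℝ ι) :
    boxFun ι η hη hs x = ((∏ a, η (x a) : ℝ) : ℂ) := rfl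

/-- A bump function on the line whose translates by `ℤ / 4` form a partition of unity. -/
noncomputable def unityBump (t : ℝ) : ℝ :=
  Real.smoothTransition (4 * t + 1) - Real.smoothTransition (4 * t)

/-- A bump function which is equal to `1` on the support of `unityBump`. -/
noncomputable def plateau (t : ℝ) : ℝ :=
  Real.smoothTransition (7 * t + 3) * Real.smoothTransition (3 - 7 * t)

theorem contDiff_unityBump : ContDiff ℝ ∞ unityBump :=
  (Real.smoothTransition.contDiff.comp (by fun_prop)).sub
    (Real.smoothTransition.contDiff.comp (by fun_prop))

theorem contDiff_plateau : ContDiff ℝ ∞ plateau :=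
  (Real.smoothTransition.contDiff.comp (by fun_prop)).mul
    (Real.smoothTransition.contDiff.comp (by fun_prop))

theorem abs_lt_of_unityBump_ne_zero {t : ℝ} (h : unityBump t ≠ 0) : |t| < 1 / 4 := by
  rw [abs_lt]
  by_contra hc
  rw [not_and_or, not_lt, not_lt] at hc
  apply h
  unfold unityBump
  rcases hc with hc | hc
  · rw [Real.smoothTransition.zero_of_nonpos (by linarith),
      Real.smoothTransition.zero_of_nonpos (by linarith), sub_zero]
  · rw [Real.smoothTransition.one_of_one_le (by linarith),
      Real.smoothTransition.one_of_one_le (by linarith), sub_self]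

/-- The coefficients `7` and `3` place the transition at `2 / 7 ≤ |t| ≤ 3 / 7`, strictly between the
edge `1 / 4` of the support of `unityBump` and the edge `1 / 2` of the period cell. -/
theorem abs_lt_of_plateau_ne_zero {t : ℝ} (h : plateau t ≠ 0) : |t| < 1 / 2 := by
  rw [abs_lt]
  by_contra hc
  rw [not_and_or, not_lt, not_lt] at hc
  apply h
  unfold plateau
  rcases hc with hc | hc
  · rw [Real.smoothTransition.zero_of_nonpos (by linarith), zero_mul]
  · rw [Real.smoothTransition.zero_of_nonpos (x := 3 - 7 * t) (by linarith), mul_zero]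

theorem plateau_eq_one {t : ℝ} (h : |t| < 1 / 4) : plateau t = 1 := by
  obtain ⟨h1, h2⟩ := abs_lt.1 h
  unfold plateau
  rw [Real.smoothTransition.one_of_one_le (by linarith),
      Real.smoothTransition.one_of_one_le (by linarith), one_mul]

/-- With `σ` the smooth transition, the `k`-th translate is `σ (4 t - k + 1) - σ (4 t - k)`, so the
sum telescopes; at the floor of `4 t` and its successor the outer terms are `1` and `0`. -/
theorem sum_unityBump (t : ℝ) : ∑ k ∈ ({⌊4 * t⌋, ⌊4 * t⌋ + 1} : Finset ℤ),
    unityBump (t - k / 4) = 1 := by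
  rw [Finset.sum_pair (by simp)]
  have h0 := Int.floor_le (4 * t)
  have h1 := Int.lt_floor_add_one (4 * t)
  unfold unityBump
  push_cast
  rw [Real.smoothTransition.one_of_one_le (x := 4 * (t - ⌊4 * t⌋ / 4) + 1) (by linarith),
    Real.smoothTransition.zero_of_nonpos (x := 4 * (t - (⌊4 * t⌋ + 1) / 4)) (by linarith),
    show 4 * (t - (⌊4 * t⌋ + 1 : ℝ) / 4) + 1 = 4 * (t - ⌊4 * t⌋ / 4) by ring]
  ring

theorem unityBump_eq_zero {t : ℝ} {k : ℤ} (hk : k ∉ ({⌊4 * t⌋, ⌊4 * t⌋ + 1} : Finset ℤ)) :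
    unityBump (t - k / 4) = 0 := by
  by_contra h
  apply hk
  have h2 := abs_lt.1 (abs_lt_of_unityBump_ne_zero h)
  have h3 : ((k : ℝ) - 1) < 4 * t := by linarith
  have h4 : 4 * t < k + 1 := by linarith
  have h5 : k - 1 ≤ ⌊4 * t⌋ := Int.le_floor.2 (by push_cast; linarith)
  have h6 : ⌊4 * t⌋ < k + 1 := Int.floor_lt.2 (by push_cast; linarith)
  simp only [Finset.mem_insert, Finset.mem_singleton]
  omega

/-- The partition of unity on `ℝ^ι` by translates of a box function. -/
noncomputable def unityBox (ι : Type*) [Fintype ι] : 𝓢(EuclideanSpace ℝ ι, ℂ) :=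
  boxFun ι unityBump contDiff_unityBump fun _ h => by
    have := abs_lt_of_unityBump_ne_zero h
    linarith

/-- A cut-off function which is equal to `1` on the support of `unityBox`. -/
noncomputable def plateauBox (ι : Type*) [Fintype ι] : 𝓢(EuclideanSpace ℝ ι, ℂ) :=
  boxFun ι plateau contDiff_plateau fun _ h => by
    have := abs_lt_of_plateau_ne_zero h
    linarith

/-- The lattice `ℤ^ι / 4`. -/
noncomputable def node (k : ι → ℤ) : EuclideanSpace ℝ ι := (1 / 4 : ℝ) • intVec k

theorem hasSum_unityBox (x : EuclideanSpace ℝ ι) :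
    HasSum (fun k : ι → ℤ => unityBox ι (x - node k)) 1 := by
  classical
  let t : ι → Finset ℤ := fun a => {⌊4 * x a⌋, ⌊4 * x a⌋ + 1}
  have e : ∀ k : ι → ℤ, unityBox ι (x - node k) =
      ((∏ a, unityBump (x a - k a / 4) : ℝ) : ℂ) := fun k => by
    unfold unityBox
    rw [boxFun_apply]
    congr 2
    refine funext fun a => congrArg unityBump ?_
    simp [node]
    ring
  have h1 : ∑ k ∈ Fintype.piFinset t, unityBox ι (x - node k) = 1 := by
    simp only [e]
    rw [← Complex.ofReal_sum, ← Finset.prod_univ_sum t fun a (j : ℤ) => unityBump (x a - j / 4)]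
    simp only [t, sum_unityBump, Finset.prod_const_one, Complex.ofReal_one]
  rw [← h1]
  refine hasSum_sum_of_ne_finset_zero fun k hk => ?_
  rw [Fintype.mem_piFinset, not_forall] at hk
  obtain ⟨a, ha⟩ := hk
  rw [e, Finset.prod_eq_zero (Finset.mem_univ a) (unityBump_eq_zero ha), Complex.ofReal_zero]

end Box

section FourierSeries

open FourierTransform

/-- The character `x ↦ exp (2 π i ⟨l, x⟩)`. -/
noncomputable def expChar (l : ι → ℤ) (x : EuclideanSpace ℝ ι) : ℂ :=
  Real.fourierChar (inner ℝ (intVec l) x)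

theorem norm_expChar (l : ι → ℤ) (x : EuclideanSpace ℝ ι) : ‖expChar l x‖ = 1 :=
  Circle.norm_coe _

theorem mFourier_coe (l : ι → ℤ) (x : EuclideanSpace ℝ ι) :
    UnitAddTorus.mFourier l (fun a => ((x a : ℝ) : UnitAddCircle)) = expChar l x := by
  simp only [UnitAddTorus.mFourier, ContinuousMap.coe_mk, expChar, Real.fourierChar_apply]
  simp only [fourier_coe_apply, ← Complex.exp_sum]
  congr 1
  simp only [PiLp.inner_apply, intVec_apply, Real.inner_apply]
  push_cast
  rw [Finset.mul_sum, Finset.sum_mul]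
  refine Finset.sum_congr rfl fun a _ => ?_
  simp
  ring

/-- The Fourier series of a function supported in a box of side less than `1`. -/
theorem hasSum_fourier_series (G : 𝓢(EuclideanSpace ℝ ι, ℂ))
    (hG : ∀ x, G x ≠ 0 → ∀ a, |x a| < 1 / 4) (x : EuclideanSpace ℝ ι)
    (hx : ∀ a, |x a| < 1 / 2)
    (hsum : Summable fun l : ι → ℤ => 𝓕 G (intVec l)) :
    HasSum (fun l : ι → ℤ => 𝓕 G (intVec l) * expChar l x) (G x) := by
  classical
  -- The representative of a point of the torus in the cell `(-1/2, 1/2]^ι`; `G ∘ rep` is the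
  -- periodization of `G`.
  let rep : UnitAddTorus ι → EuclideanSpace ℝ ι := fun t =>
    WithLp.toLp 2 fun a => ((AddCircle.equivIoc 1 (-(1 / 2)) (t a) : Set.Ioc _ _) : ℝ)
  have hrep : ∀ y : EuclideanSpace ℝ ι, (∀ a, y a ∈ Set.Ioc (-(1 / 2) : ℝ) (-(1 / 2) + 1)) →
      rep (fun a => ((y a : ℝ) : UnitAddCircle)) = y := fun y hy => by
    ext a
    have := (AddCircle.equivIoc (1 : ℝ) (-(1 / 2))).apply_symm_apply ⟨y a, hy a⟩
    exact congrArg Subtype.val this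
  -- `rep` jumps only where some coordinate is the class of `-1/2`. Near such points that coordinate
  -- of `rep` stays out of the support of `G`, so the function vanishes there.
  have hcont : Continuous fun t => G (rep t) := by
    rw [continuous_iff_continuousAt]
    intro t
    by_cases ht : ∃ a, t a = ((-(1 / 2) : ℝ) : UnitAddCircle)
    · obtain ⟨a, ha⟩ := ht
      let S : Set (UnitAddTorus ι) :=
        {s | s a ∉ (fun r : ℝ => (r : UnitAddCircle)) '' Set.Icc (-(1 / 4)) (1 / 4)}
      have hS : IsOpen S := by
        have hc : IsCompact ((fun r : ℝ => (r : UnitAddCircle)) '' Set.Icc (-(1 / 4)) (1 / 4)) :=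
          isCompact_Icc.image (AddCircle.continuous_mk' 1)
        exact hc.isClosed.isOpen_compl.preimage
          (continuous_apply a : Continuous fun s : UnitAddTorus ι => s a)
      have hz : ∀ s ∈ S, G (rep s) = 0 := fun s hs => by
        by_contra h
        have h1 := abs_lt.1 (hG _ h a)
        refine hs ⟨rep s a, ⟨h1.1.le, h1.2.le⟩, ?_⟩
        exact (AddCircle.equivIoc (1 : ℝ) (-(1 / 2))).symm_apply_apply (s a)
      have htS : t ∈ S := by
        rintro ⟨r, hr, hr'⟩
        have h2 : ((r : ℝ) : UnitAddCircle) = ((-(1 / 2) : ℝ) : UnitAddCircle) := hr'.trans ha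
        rw [AddCircle.coe_eq_coe_iff_of_mem_Ico (a := -(1 / 2)) ⟨by linarith [hr.1], by
          linarith [hr.2]⟩ ⟨le_rfl, by norm_num⟩] at h2
        linarith [hr.1]
      have hev : (fun s => G (rep s)) =ᶠ[𝓝 t] fun _ => 0 :=
        eventually_of_mem (hS.mem_nhds htS) hz
      exact continuousAt_const.congr hev.symm
    · push Not at ht
      refine G.continuous.continuousAt.comp ?_
      refine (PiLp.continuous_toLp 2 _).continuousAt.comp ?_
      rw [continuousAt_pi]
      intro a
      have h1 := AddCircle.continuousAt_equivIoc 1 (-(1 / 2)) (ht a)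
      exact continuous_subtype_val.continuousAt.comp
        (ContinuousAt.comp (f := fun s : UnitAddTorus ι => s a) h1
          (continuous_apply a).continuousAt)
  let f : C(UnitAddTorus ι, ℂ) := ⟨fun t => G (rep t), hcont⟩
  -- The coefficient is an integral over the cell, and `G` vanishes off the cell, so it is the
  -- Fourier integral over the whole space.
  have hcoef : ∀ l, UnitAddTorus.mFourierCoeff f l = 𝓕 G (intVec l) := fun l => by
    rw [UnitAddTorus.mFourierCoeff_eq_integral _ _ fun _ => -(1 / 2)]
    rw [SchwartzMap.fourier_coe, Real.fourier_eq, ← (PiLp.volume_preserving_toLp ι).integral_comp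
      (MeasurableEquiv.toLp 2 (ι → ℝ)).measurableEmbedding]
    have hset : ∀ y : ι → ℝ, y ∉ {y : ι → ℝ | ∀ i, y i ∈ Set.Ioc (-(1 / 2) : ℝ) (-(1 / 2) + 1)} →
        Real.fourierChar (-inner ℝ (WithLp.toLp 2 y) (intVec l)) • G (WithLp.toLp 2 y) = 0 := by
      intro y hy
      have : G (WithLp.toLp 2 y) = 0 := by
        by_contra h
        refine hy fun a => ?_
        have h1 := abs_lt.1 (hG _ h a)
        exact ⟨by linarith [h1.1], by linarith [h1.2]⟩
      rw [this, smul_zero]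
    rw [← setIntegral_eq_integral_of_forall_compl_eq_zero hset]
    refine setIntegral_congr_fun ?_ fun y hy => ?_
    · have : {y : ι → ℝ | ∀ i, y i ∈ Set.Ioc (-(1 / 2) : ℝ) (-(1 / 2) + 1)} =
          Set.univ.pi fun _ => Set.Ioc (-(1 / 2) : ℝ) (-(1 / 2) + 1) := by
        ext y; simp
      rw [this]
      exact MeasurableSet.univ_pi fun _ => measurableSet_Ioc
    · have h1 := hrep (WithLp.toLp 2 y) hy
      have h2 := mFourier_coe (-l) (WithLp.toLp 2 y)
      simp only at h1 h2 ⊢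
      have h3 : f (fun i => ((y i : ℝ) : UnitAddCircle)) = G (WithLp.toLp 2 y) := congrArg G h1
      rw [h3, h2, expChar, Circle.smul_def]
      congr 3
      have : intVec (-l) = -intVec l := by ext a; simp
      rw [this, inner_neg_left, real_inner_comm]
  have h := UnitAddTorus.hasSum_mFourier_series_apply_of_summable (f := f) (by
    simpa only [funext hcoef] using hsum) (fun a => ((x a : ℝ) : UnitAddCircle))
  simp only [hcoef, mFourier_coe, smul_eq_mul] at h
  have hfx : f (fun a => ((x a : ℝ) : UnitAddCircle)) = G x :=
    congrArg G (hrep x fun a => by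
      have h1 := abs_lt.1 (hx a)
      exact ⟨by linarith [h1.1], by linarith [h1.2]⟩)
  rwa [hfx] at h

end FourierSeries

end GaborExpansion

/-! ### Seminorms of translates, slices and localizations -/

namespace SchwartzMap

variable {V W : Type*} [NormedAddCommGroup V] [NormedSpace ℝ V]
  [NormedAddCommGroup W] [NormedSpace ℝ W]

/-- A bound for all the standard seminorms gives a bound for any continuous one. -/
theorem le_of_forall_seminorm_le {s : Finset (ℕ × ℕ)} {f : 𝓢(V, ℂ)} {B : ℝ} (hB : 0 ≤ B)
    (h : ∀ k n, (k, n) ∈ s → ∀ x, ‖x‖ ^ k * ‖iteratedFDeriv ℝ n f x‖ ≤ B) :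
    (s.sup (schwartzSeminormFamily ℂ V ℂ) : Seminorm ℂ 𝓢(V, ℂ)) f ≤ B :=
  Seminorm.finset_sup_apply_le hB fun i hi => seminorm_le_bound ℂ i.1 i.2 f hB (h i.1 i.2 hi)

theorem one_add_norm_pow_le {K N : ℕ} {k n : ℕ} (hk : k ≤ K) (hn : n ≤ N) (f : 𝓢(V, ℂ)) (x : V) :
    (1 + ‖x‖) ^ k * ‖iteratedFDeriv ℝ n f x‖ ≤
      2 ^ K * ((Finset.Iic (K, N)).sup (schwartzSeminormFamily ℂ V ℂ) : Seminorm ℂ _) f :=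
  one_add_le_sup_seminorm_apply (𝕜 := ℂ) (m := (K, N)) hk hn f x

/-- An upper bound of a finite set of pairs of exponents. -/
theorem exists_bound_exponents (s : Finset (ℕ × ℕ)) :
    ∃ K, ∀ k n, (k, n) ∈ s → k ≤ K ∧ n ≤ K := by
  refine ⟨s.sup fun i => i.1 + i.2, fun k n h => ?_⟩
  have := Finset.le_sup (f := fun i : ℕ × ℕ => i.1 + i.2) h
  simp only at this
  omega

/-- The seminorms of the translates of a Schwartz function grow polynomially. -/
theorem exists_seminorm_translate_le (p : Seminorm ℂ 𝓢(V, ℂ)) (hp : Continuous p) :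
    ∃ (M : ℕ) (q : Seminorm ℂ 𝓢(V, ℂ)), Continuous q ∧
      ∀ (y : V) (f : 𝓢(V, ℂ)), p (compSubConstCLM ℂ y f) ≤ (1 + ‖y‖) ^ M * q f := by
  obtain ⟨s, C, hC, h⟩ := exists_le_sup_seminorm p hp
  obtain ⟨K, hK⟩ := exists_bound_exponents s
  refine ⟨K, (C * 2 ^ K).toNNReal • (Finset.Iic (K, K)).sup (schwartzSeminormFamily ℂ V ℂ),
    continuous_const.mul (continuous_sup_seminorm _), fun y f => ?_⟩
  have hCK : 0 ≤ C * 2 ^ K := by positivity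
  rw [smul_apply, NNReal.smul_def, smul_eq_mul, Real.coe_toNNReal _ hCK]
  set P := ((Finset.Iic (K, K)).sup (schwartzSeminormFamily ℂ V ℂ) : Seminorm ℂ 𝓢(V, ℂ)) with hP
  have hP0 : 0 ≤ P f := apply_nonneg _ _
  calc p (compSubConstCLM ℂ y f) ≤ C * _ := h _
    _ ≤ C * ((1 + ‖y‖) ^ K * (2 ^ K * P f)) := by
      refine mul_le_mul_of_nonneg_left (le_of_forall_seminorm_le (by positivity)
        fun k n hkn x => ?_) hC
      have e : (⇑(compSubConstCLM ℂ y f) : V → ℂ) = fun x => f (x - y) := by ext x; simp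
      rw [e, iteratedFDeriv_comp_sub]
      -- A weight at `x` is traded for one at `x - y`, at the price of polynomial growth in `y`.
      have h1 : ‖x‖ ≤ (1 + ‖y‖) * (1 + ‖x - y‖) := by
        have h2 : ‖x‖ ≤ ‖x - y‖ + ‖y‖ := by simpa using norm_add_le (x - y) y
        nlinarith [norm_nonneg y, norm_nonneg (x - y)]
      calc ‖x‖ ^ k * ‖iteratedFDeriv ℝ n f (x - y)‖
          ≤ ((1 + ‖y‖) * (1 + ‖x - y‖)) ^ k * ‖iteratedFDeriv ℝ n f (x - y)‖ := by gcongr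
        _ = (1 + ‖y‖) ^ k * ((1 + ‖x - y‖) ^ k * ‖iteratedFDeriv ℝ n f (x - y)‖) := by
          rw [mul_pow]; ring
        _ ≤ (1 + ‖y‖) ^ K * (2 ^ K * P f) := by
          exact mul_le_mul (pow_le_pow_right₀ (by linarith [norm_nonneg y]) (hK k n hkn).1)
            (one_add_norm_pow_le (hK k n hkn).1 (hK k n hkn).2 f (x - y)) (by positivity)
            (by positivity)
    _ = _ := by ring

/-- The slices of a Schwartz function on a product decay rapidly. -/
theorem exists_seminorm_slice_le (p : Seminorm ℂ 𝓢(V, ℂ)) (hp : Continuous p) (M : ℕ) :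
    ∃ P : Seminorm ℂ 𝓢(V × W, ℂ), Continuous P ∧
      ∀ (H : 𝓢(V × W, ℂ)) (y : W) (f : 𝓢(V, ℂ)), (∀ x, f x = H (x, y)) →
        (1 + ‖y‖) ^ M * p f ≤ P H := by
  obtain ⟨s, C, hC, h⟩ := exists_le_sup_seminorm p hp
  obtain ⟨K, hK⟩ := exists_bound_exponents s
  refine ⟨(C * 2 ^ (K + M)).toNNReal •
    (Finset.Iic (K + M, K)).sup (schwartzSeminormFamily ℂ (V × W) ℂ),
    continuous_const.mul (continuous_sup_seminorm _), fun H y f hf => ?_⟩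
  have hCK : 0 ≤ C * 2 ^ (K + M) := by positivity
  rw [smul_apply, NNReal.smul_def, smul_eq_mul, Real.coe_toNNReal _ hCK]
  set P := ((Finset.Iic (K + M, K)).sup (schwartzSeminormFamily ℂ (V × W) ℂ) : Seminorm ℂ _)
  have hP0 : 0 ≤ P H := apply_nonneg _ _
  have hy : 0 < (1 + ‖y‖) ^ M := by positivity
  rw [← le_div_iff₀' hy]
  calc p f ≤ C * _ := h f
    _ ≤ C * (2 ^ (K + M) * P H / (1 + ‖y‖) ^ M) := by
      refine mul_le_mul_of_nonneg_left (le_of_forall_seminorm_le (by positivity)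
        fun k n hkn x => ?_) hC
      rw [le_div_iff₀ hy]
      have e : (⇑f : V → ℂ) = (fun z => H (z + (0, y))) ∘ (ContinuousLinearMap.inl ℝ V W) := by
        ext x; simp [hf]
      have hD : ‖iteratedFDeriv ℝ n f x‖ ≤ ‖iteratedFDeriv ℝ n H (x, y)‖ := by
        rw [e, (ContinuousLinearMap.inl ℝ V W).iteratedFDeriv_comp_right
          (f := fun z => H (z + (0, y))) ((H.smooth n).comp (contDiff_id.add contDiff_const))
          x le_rfl, iteratedFDeriv_comp_add_right]
        refine (ContinuousMultilinearMap.norm_compContinuousLinearMap_le _ _).trans ?_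
        simp only [ContinuousLinearMap.inl_apply, Prod.mk_add_mk, add_zero, zero_add]
        refine mul_le_of_le_one_right (norm_nonneg _) (Finset.prod_le_one (fun _ _ => norm_nonneg _)
          fun _ _ => ?_)
        refine ContinuousLinearMap.opNorm_le_bound _ zero_le_one fun v => ?_
        simp
      have h1 : ‖x‖ ≤ 1 + ‖((x, y) : V × W)‖ := by
        have : ‖x‖ ≤ ‖((x, y) : V × W)‖ := norm_fst_le (x, y)
        linarith
      have h2 : 1 + ‖y‖ ≤ 1 + ‖((x, y) : V × W)‖ := by
        have : ‖y‖ ≤ ‖((x, y) : V × W)‖ := norm_snd_le (x, y)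
        linarith
      calc ‖x‖ ^ k * ‖iteratedFDeriv ℝ n f x‖ * (1 + ‖y‖) ^ M
          ≤ (1 + ‖((x, y) : V × W)‖) ^ k * ‖iteratedFDeriv ℝ n H (x, y)‖ *
            (1 + ‖((x, y) : V × W)‖) ^ M := by gcongr
        _ = (1 + ‖((x, y) : V × W)‖) ^ (k + M) * ‖iteratedFDeriv ℝ n H (x, y)‖ := by ring
        _ ≤ _ := one_add_norm_pow_le (Nat.add_le_add_right (hK k n hkn).1 M) (hK k n hkn).2 H (x, y)
    _ = _ := by ring

/-- The localizations of a Schwartz function near a point decay rapidly. -/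
theorem exists_seminorm_localize_le (χ : 𝓢(V, ℂ)) (p : Seminorm ℂ 𝓢(V, ℂ)) (hp : Continuous p)
    (M : ℕ) : ∃ q : Seminorm ℂ 𝓢(V, ℂ), Continuous q ∧ ∀ (F : 𝓢(V, ℂ)) (y : V),
      (1 + ‖y‖) ^ M * p (smulLeftCLM ℂ χ (compSubConstCLM ℂ (-y) F)) ≤ q F := by
  obtain ⟨P, hP, hPle⟩ := exists_seminorm_slice_le (W := V) p hp M
  -- The shear `(x, y) ↦ (x, x + y)` turns `χ ⊗ F` into `χ x * F (x + y)`, whose slice at `y` is the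
  -- localization of `F` near `y`. Decay of localizations is thus decay of slices of one Schwartz
  -- function.
  let T : (V × V) ≃L[ℝ] (V × V) := ContinuousLinearEquiv.equivOfInverse
    ((ContinuousLinearMap.fst ℝ V V).prod
      (ContinuousLinearMap.fst ℝ V V + ContinuousLinearMap.snd ℝ V V))
    ((ContinuousLinearMap.fst ℝ V V).prod
      (ContinuousLinearMap.snd ℝ V V - ContinuousLinearMap.fst ℝ V V))
    (fun z => by ext <;> simp) (fun z => by ext <;> simp)
  let S : 𝓢(V × V, ℂ) →L[ℂ] 𝓢(V × V, ℂ) := compCLMOfContinuousLinearEquiv ℂ T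
  obtain ⟨p₁, p₂, -, h₂, hle⟩ := exists_seminorm_tensor_le (P.comp S.toLinearMap)
    (hP.comp S.continuous)
  refine ⟨(p₁ χ).toNNReal • p₂, continuous_const.mul h₂, fun F y => ?_⟩
  rw [smul_apply, NNReal.smul_def, smul_eq_mul, Real.coe_toNNReal _ (apply_nonneg _ _)]
  refine (hPle (S (tensor χ F)) y _ fun x => ?_).trans (hle χ F)
  rw [smulLeftCLM_apply_apply χ.hasTemperateGrowth]
  simp [S, T]

end SchwartzMap

/-! ### The Gabor expansion of a Schwartz function -/

namespace GaborExpansion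

open FourierTransform SchwartzMap

section Atoms

variable {ι : Type*} [Fintype ι]

/-- The time-frequency translates of the cut-off function. -/
noncomputable def atom (k l : ι → ℤ) : 𝓢(EuclideanSpace ℝ ι, ℂ) :=
  compSubConstCLM ℂ (node k) (𝓕⁻ (compSubConstCLM ℂ (intVec l) (𝓕 (plateauBox ι))))

/-- The coefficients of the expansion into time-frequency translates. -/
noncomputable def coeff (k l : ι → ℤ) : 𝓢(EuclideanSpace ℝ ι, ℂ) →ₗ[ℂ] ℂ where
  toFun F := 𝓕 (smulLeftCLM ℂ (unityBox ι) (compSubConstCLM ℂ (-node k) F)) (intVec l)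
  map_add' F G := by simp [FourierTransform.fourier_add]
  map_smul' a F := by simp [FourierTransform.fourier_smul]

/-- Translation on the Fourier side is multiplication by a character. The definition through two
translations gives the seminorm bounds, this form gives the expansion. -/
theorem atom_apply (k l : ι → ℤ) (x : EuclideanSpace ℝ ι) :
    atom k l x = plateauBox ι (x - node k) * expChar l (x - node k) := by
  have key : ∀ y, 𝓕⁻ (compSubConstCLM ℂ (intVec l) (𝓕 (plateauBox ι))) y =
      plateauBox ι y * expChar l y := fun y => by
    have h0 : 𝓕⁻ (𝓕 (plateauBox ι)) = plateauBox ι := FourierTransform.fourierInv_fourier_eq _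
    rw [SchwartzMap.fourierInv_coe, Real.fourierInv_eq]
    have h1 : (∫ v, Real.fourierChar (inner ℝ v y) •
        (compSubConstCLM ℂ (intVec l) (𝓕 (plateauBox ι))) v) =
        ∫ v, expChar l y * (Real.fourierChar (inner ℝ v y) • (𝓕 (plateauBox ι)) v) := by
      rw [← integral_add_right_eq_self _ (intVec l)]
      refine integral_congr_ae (Eventually.of_forall fun v => ?_)
      simp only [compSubConstCLM_apply, add_sub_cancel_right, inner_add_left, AddChar.map_add_eq_mul,
        Circle.smul_def, Circle.coe_mul, expChar, smul_eq_mul]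
      ring
    rw [h1, integral_const_mul, ← Real.fourierInv_eq, ← SchwartzMap.fourierInv_coe, h0, mul_comm]
  rw [atom, compSubConstCLM_apply, key]

/-- Each of the two translations costs a polynomial factor, and the inverse Fourier transform
between them is continuous. -/
theorem exists_seminorm_atom_le (p : Seminorm ℂ 𝓢(EuclideanSpace ℝ ι, ℂ)) (hp : Continuous p) :
    ∃ (M : ℕ) (C : ℝ), 0 ≤ C ∧ ∀ k l : ι → ℤ,
      p (atom k l) ≤ C * ((1 + ‖node k‖) * (1 + ‖intVec l‖)) ^ M := by
  obtain ⟨M, q, hq, h⟩ := exists_seminorm_translate_le p hp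
  obtain ⟨M', q', -, h'⟩ := exists_seminorm_translate_le
    (q.comp (fourierCLE ℂ 𝓢(EuclideanSpace ℝ ι, ℂ)).symm.toLinearMap)
    (hq.comp (fourierCLE ℂ 𝓢(EuclideanSpace ℝ ι, ℂ)).symm.continuous)
  refine ⟨M + M', q' (𝓕 (plateauBox ι)), apply_nonneg _ _, fun k l => ?_⟩
  have h1 := h (node k) (𝓕⁻ (compSubConstCLM ℂ (intVec l) (𝓕 (plateauBox ι))))
  have h2 : q (𝓕⁻ (compSubConstCLM ℂ (intVec l) (𝓕 (plateauBox ι)))) ≤ _ :=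
    h' (intVec l) (𝓕 (plateauBox ι))
  have hk : 1 ≤ 1 + ‖node k‖ := by linarith [norm_nonneg (node k)]
  have hl : 1 ≤ 1 + ‖intVec l‖ := by linarith [norm_nonneg (intVec l)]
  have hq0 : 0 ≤ q' (𝓕 (plateauBox ι)) := apply_nonneg _ _
  calc p (atom k l) ≤ (1 + ‖node k‖) ^ M * ((1 + ‖intVec l‖) ^ M' * q' (𝓕 (plateauBox ι))) :=
        h1.trans (mul_le_mul_of_nonneg_left h2 (by positivity))
    _ ≤ (1 + ‖node k‖) ^ (M + M') * ((1 + ‖intVec l‖) ^ (M + M') * q' (𝓕 (plateauBox ι))) := by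
        gcongr
        · exact Nat.le_add_right _ _
        · exact Nat.le_add_left _ _
    _ = _ := by rw [mul_pow]; ring

/-- Decay in `k` is the decay of localizations, decay in `l` that of the Fourier transform. Using a
weighted seminorm of the Fourier transform in the localization estimate gives both at once. -/
theorem exists_seminorm_coeff_le (M : ℕ) :
    ∃ q : Seminorm ℂ 𝓢(EuclideanSpace ℝ ι, ℂ), Continuous q ∧ ∀ (k l : ι → ℤ) F,
      ((1 + ‖node k‖) * (1 + ‖intVec l‖)) ^ M * ‖coeff k l F‖ ≤ q F := by
  let P : Seminorm ℂ 𝓢(EuclideanSpace ℝ ι, ℂ) :=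
    (Finset.Iic (M, 0)).sup (schwartzSeminormFamily ℂ _ ℂ)
  have hP : Continuous P := continuous_sup_seminorm _
  obtain ⟨q, hq, h⟩ := exists_seminorm_localize_le (unityBox ι)
    (P.comp (fourierCLE ℂ 𝓢(EuclideanSpace ℝ ι, ℂ)).toLinearMap)
    (hP.comp (fourierCLE ℂ 𝓢(EuclideanSpace ℝ ι, ℂ)).continuous) M
  refine ⟨((2 : ℝ) ^ M).toNNReal • q, continuous_const.mul hq, fun k l F => ?_⟩
  rw [smul_apply, NNReal.smul_def, smul_eq_mul, Real.coe_toNNReal _ (by positivity)]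
  set G := smulLeftCLM ℂ (unityBox ι) (compSubConstCLM ℂ (-node k) F) with hG
  have h1 : (1 + ‖intVec l‖) ^ M * ‖𝓕 G (intVec l)‖ ≤ 2 ^ M * P (𝓕 G) := by
    have := one_add_norm_pow_le (K := M) (N := 0) le_rfl le_rfl (𝓕 G) (intVec l)
    rwa [norm_iteratedFDeriv_zero] at this
  have h2 : (1 + ‖node k‖) ^ M * P (𝓕 G) ≤ q F := h F (node k)
  have e : coeff k l F = 𝓕 G (intVec l) := rfl
  rw [e]
  calc _ = (1 + ‖node k‖) ^ M * ((1 + ‖intVec l‖) ^ M * ‖𝓕 G (intVec l)‖) := by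
        rw [mul_pow]; ring
    _ ≤ (1 + ‖node k‖) ^ M * (2 ^ M * P (𝓕 G)) := by gcongr
    _ = 2 ^ M * ((1 + ‖node k‖) ^ M * P (𝓕 G)) := by ring
    _ ≤ _ := by gcongr

theorem summable_weight (ι : Type*) [Fintype ι] : ∃ n : ℕ, Summable fun i : (ι → ℤ) × (ι → ℤ) =>
    (((1 + ‖node i.1‖) * (1 + ‖intVec i.2‖)) ^ n)⁻¹ := by
  obtain ⟨n, hn⟩ := summable_intVec ι
  refine ⟨n, ?_⟩
  have h1 : Summable fun k : ι → ℤ => ((1 + ‖node k‖) ^ n)⁻¹ := by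
    refine Summable.of_nonneg_of_le (fun _ => by positivity) (fun k => ?_) (hn.mul_left (4 ^ n))
    have e : ‖node k‖ = 1 / 4 * ‖intVec k‖ := by
      rw [node, norm_smul]; norm_num
    have h2 : (1 + ‖intVec k‖) ≤ 4 * (1 + ‖node k‖) := by
      rw [e]; linarith
    have h3 : (1 + ‖intVec k‖) ^ n ≤ 4 ^ n * (1 + ‖node k‖) ^ n := by
      rw [← mul_pow]; gcongr
    rw [← div_eq_mul_inv, le_div_iff₀ (by positivity), ← div_eq_inv_mul,
      div_le_iff₀ (by positivity)]
    exact h3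
  have h2 := h1.mul_of_nonneg hn (fun _ => by positivity) (fun _ => by positivity)
  refine h2.congr fun i => ?_
  rw [mul_pow, mul_inv]

theorem summable_coeff (F : 𝓢(EuclideanSpace ℝ ι, ℂ)) :
    Summable fun i : (ι → ℤ) × (ι → ℤ) => ‖coeff i.1 i.2 F‖ := by
  obtain ⟨n, hn⟩ := summable_weight ι
  obtain ⟨q, -, hq⟩ := exists_seminorm_coeff_le (ι := ι) n
  refine Summable.of_nonneg_of_le (fun _ => norm_nonneg _) (fun i => ?_) (hn.mul_left (q F))
  rw [← div_eq_mul_inv, le_div_iff₀' (by positivity)]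
  exact hq i.1 i.2 F

theorem plateauBox_lt {x : EuclideanSpace ℝ ι} (h : plateauBox ι x ≠ 0) (a : ι) :
    |x a| < 1 / 2 := by
  refine abs_lt_of_plateau_ne_zero fun h0 => h ?_
  rw [plateauBox, boxFun_apply, Finset.prod_eq_zero (Finset.mem_univ a) h0, Complex.ofReal_zero]

theorem unityBox_lt {x : EuclideanSpace ℝ ι} (h : unityBox ι x ≠ 0) (a : ι) :
    |x a| < 1 / 4 := by
  refine abs_lt_of_unityBump_ne_zero fun h0 => h ?_
  rw [unityBox, boxFun_apply, Finset.prod_eq_zero (Finset.mem_univ a) h0, Complex.ofReal_zero]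

theorem plateauBox_eq_one {x : EuclideanSpace ℝ ι} (h : unityBox ι x ≠ 0) :
    plateauBox ι x = 1 := by
  rw [plateauBox, boxFun_apply, Finset.prod_eq_one fun a _ => plateau_eq_one (unityBox_lt h a),
    Complex.ofReal_one]

theorem norm_plateauBox_le (x : EuclideanSpace ℝ ι) : ‖plateauBox ι x‖ ≤ 1 := by
  rw [plateauBox, boxFun_apply, Complex.norm_real, norm_prod]
  refine Finset.prod_le_one (fun _ _ => norm_nonneg _) fun a _ => ?_
  rw [plateau, norm_mul, Real.norm_of_nonneg (Real.smoothTransition.nonneg _),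
    Real.norm_of_nonneg (Real.smoothTransition.nonneg _)]
  exact mul_le_one₀ (Real.smoothTransition.le_one _) (Real.smoothTransition.nonneg _)
    (Real.smoothTransition.le_one _)

/-- Every Schwartz function is the sum of its expansion into time-frequency translates. -/
theorem hasSum_coeff_mul_atom (F : 𝓢(EuclideanSpace ℝ ι, ℂ)) (x : EuclideanSpace ℝ ι) :
    HasSum (fun i : (ι → ℤ) × (ι → ℤ) => coeff i.1 i.2 F * atom i.1 i.2 x) (F x) := by
  have hs : Summable fun i : (ι → ℤ) × (ι → ℤ) => coeff i.1 i.2 F * atom i.1 i.2 x := by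
    refine Summable.of_norm_bounded (summable_coeff F) fun i => ?_
    rw [norm_mul, atom_apply, norm_mul, norm_expChar, mul_one]
    exact mul_le_of_le_one_right (norm_nonneg _) (norm_plateauBox_le _)
  -- For fixed `k` the sum over `l` is the Fourier series of the localized piece `G`. That series is
  -- periodic and represents `G` only on the period cell; the plateau factor removes the other
  -- periods and is `1` wherever `G` is nonzero.
  have hk : ∀ k : ι → ℤ, HasSum (fun l : ι → ℤ => coeff k l F * atom k l x)
      (unityBox ι (x - node k) * F x) := fun k => by
    let G := smulLeftCLM ℂ (unityBox ι) (compSubConstCLM ℂ (-node k) F)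
    have hG : ∀ y, G y = unityBox ι y * F (y + node k) := fun y => by
      simp [G, smulLeftCLM_apply_apply (unityBox ι).hasTemperateGrowth]
    have hGx : G (x - node k) = unityBox ι (x - node k) * F x := by rw [hG, sub_add_cancel]
    rw [← hGx]
    simp only [atom_apply]
    by_cases hp : plateauBox ι (x - node k) = 0
    · have hu : unityBox ι (x - node k) = 0 := by
        by_contra h
        rw [plateauBox_eq_one h] at hp
        exact one_ne_zero hp
      simp only [hp, zero_mul, mul_zero, hG, hu]
      exact hasSum_zero
    · have h1 := hasSum_fourier_series G
        (fun y hy => unityBox_lt fun h => hy (by rw [hG, h, zero_mul])) (x - node k)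
        (plateauBox_lt hp) (Summable.of_norm ((summable_coeff F).prod_factor k))
      have h2 := h1.mul_left (plateauBox ι (x - node k))
      have e : plateauBox ι (x - node k) * G (x - node k) = G (x - node k) := by
        by_cases hu : unityBox ι (x - node k) = 0
        · rw [hG, hu, zero_mul, mul_zero]
        · rw [plateauBox_eq_one hu, one_mul]
      rw [e] at h2
      refine h2.congr_fun fun l => ?_
      have e2 : coeff k l F = 𝓕 G (intVec l) := rfl
      rw [e2]
      ring
  -- Absolute summability allows iterated summation; over `k` the pieces add up to `F x` by the
  -- partition of unity.
  have h1 := hs.hasSum.prod_fiberwise hk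
  have h2 := (hasSum_unityBox x).mul_right (F x)
  rw [one_mul] at h2
  rw [← h1.unique h2]
  exact hs.hasSum

end Atoms

end GaborExpansion

/-! ### Tensor expansion of Schwartz functions on a product -/

namespace GaborExpansion

open SchwartzMap

section Sum

variable {ι₁ ι₂ : Type*} [Fintype ι₁] [Fintype ι₂]

theorem norm_node_comp_le {κ ι : Type*} [Fintype κ] [Fintype ι] (f : κ → ι)
    (hf : Function.Injective f) (l : ι → ℤ) : ‖intVec (l ∘ f)‖ ≤ ‖intVec l‖ := by
  rw [EuclideanSpace.norm_eq, EuclideanSpace.norm_eq]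
  refine Real.sqrt_le_sqrt ?_
  simp only [intVec_apply, Function.comp_apply]
  have := Finset.sum_map Finset.univ ⟨f, hf⟩ fun a => ‖(l a : ℝ)‖ ^ 2
  simp only [Function.Embedding.coeFn_mk] at this
  rw [← this]
  exact Finset.sum_le_sum_of_subset_of_nonneg (Finset.subset_univ _) fun _ _ _ => by positivity

/-- The cut-off is a product over coordinates and the character an exponential of a sum over
coordinates, so an atom splits along a decomposition of the index set. This is why the Gabor system
is built from boxes. -/
theorem atom_sum (k l : ι₁ ⊕ ι₂ → ℤ) (x : EuclideanSpace ℝ (ι₁ ⊕ ι₂))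
    (x₁ : EuclideanSpace ℝ ι₁) (x₂ : EuclideanSpace ℝ ι₂)
    (h₁ : ∀ a, x (Sum.inl a) = x₁ a) (h₂ : ∀ a, x (Sum.inr a) = x₂ a) :
    atom k l x = atom (k ∘ Sum.inl) (l ∘ Sum.inl) x₁ * atom (k ∘ Sum.inr) (l ∘ Sum.inr) x₂ := by
  have e1 : plateauBox (ι₁ ⊕ ι₂) (x - node k) =
      plateauBox ι₁ (x₁ - node (k ∘ Sum.inl)) * plateauBox ι₂ (x₂ - node (k ∘ Sum.inr)) := by
    simp only [plateauBox, boxFun_apply, Fintype.prod_sum_type]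
    rw [Complex.ofReal_mul]
    simp [node, h₁, h₂]
  have e2 : expChar l (x - node k) = expChar (l ∘ Sum.inl) (x₁ - node (k ∘ Sum.inl)) *
      expChar (l ∘ Sum.inr) (x₂ - node (k ∘ Sum.inr)) := by
    simp only [expChar, ← Circle.coe_mul, ← AddChar.map_add_eq_mul]
    congr 2
    simp [PiLp.inner_apply, Fintype.sum_sum_type, node, h₁, h₂]
  rw [atom_apply, atom_apply, atom_apply, e1, e2]
  ring

end Sum

end GaborExpansion

namespace SchwartzMap

open GaborExpansion

/-- Every Schwartz function on a product has a rapidly convergent expansion into products of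
Schwartz functions on the factors, with coefficients depending linearly on the function. -/
theorem exists_tensor_expansion (V W : Type*) [NormedAddCommGroup V] [NormedSpace ℝ V]
    [FiniteDimensional ℝ V] [NormedAddCommGroup W] [NormedSpace ℝ W] [FiniteDimensional ℝ W] :
    ∃ (κ : Type) (_ : Countable κ) (e : κ → 𝓢(V, ℂ)) (e' : κ → 𝓢(W, ℂ)) (c : κ → 𝓢(V × W, ℂ) →ₗ[ℂ] ℂ),
      (∀ (p : Seminorm ℂ 𝓢(V, ℂ)) (p' : Seminorm ℂ 𝓢(W, ℂ)), Continuous p → Continuous p' →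
        ∃ q : Seminorm ℂ 𝓢(V × W, ℂ), Continuous q ∧ ∀ F,
          Summable (fun i => ‖c i F‖ * (p (e i) * p' (e' i))) ∧
            ∑' i, ‖c i F‖ * (p (e i) * p' (e' i)) ≤ q F) ∧
      ∀ F x y, HasSum (fun i => c i F * (e i x * e' i y)) (F (x, y)) := by
  let ι₁ := Fin (Module.finrank ℝ V)
  let ι₂ := Fin (Module.finrank ℝ W)
  let ψ₁ : V ≃L[ℝ] EuclideanSpace ℝ ι₁ := toEuclidean
  let ψ₂ : W ≃L[ℝ] EuclideanSpace ℝ ι₂ := toEuclidean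
  let L : (EuclideanSpace ℝ ι₁ × EuclideanSpace ℝ ι₂) ≃ₗ[ℝ] EuclideanSpace ℝ (ι₁ ⊕ ι₂) :=
    { toFun := fun z => WithLp.toLp 2 (Sum.elim z.1 z.2)
      invFun := fun x => (WithLp.toLp 2 fun a => x (Sum.inl a), WithLp.toLp 2 fun a => x (Sum.inr a))
      map_add' := fun z w => by ext (a | a) <;> simp
      map_smul' := fun r z => by ext (a | a) <;> simp
      left_inv := fun z => by ext <;> simp
      right_inv := fun x => by ext (a | a) <;> simp }
  let Θ : (V × W) ≃L[ℝ] EuclideanSpace ℝ (ι₁ ⊕ ι₂) :=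
    (ψ₁.prodCongr ψ₂).trans L.toContinuousLinearEquiv
  have hΘ₁ : ∀ x y a, Θ (x, y) (Sum.inl a) = ψ₁ x a := fun _ _ _ => rfl
  have hΘ₂ : ∀ x y a, Θ (x, y) (Sum.inr a) = ψ₂ y a := fun _ _ _ => rfl
  let R₁ : 𝓢(EuclideanSpace ℝ ι₁, ℂ) →L[ℂ] 𝓢(V, ℂ) := compCLMOfContinuousLinearEquiv ℂ ψ₁
  let R₂ : 𝓢(EuclideanSpace ℝ ι₂, ℂ) →L[ℂ] 𝓢(W, ℂ) := compCLMOfContinuousLinearEquiv ℂ ψ₂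
  let R : 𝓢(V × W, ℂ) →L[ℂ] 𝓢(EuclideanSpace ℝ (ι₁ ⊕ ι₂), ℂ) :=
    compCLMOfContinuousLinearEquiv ℂ Θ.symm
  refine ⟨(ι₁ ⊕ ι₂ → ℤ) × (ι₁ ⊕ ι₂ → ℤ), inferInstance,
    fun i => R₁ (atom (i.1 ∘ Sum.inl) (i.2 ∘ Sum.inl)),
    fun i => R₂ (atom (i.1 ∘ Sum.inr) (i.2 ∘ Sum.inr)),
    fun i => (coeff i.1 i.2).comp R.toLinearMap, ?_, fun F x y => ?_⟩
  · intro p p' hp hp'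
    obtain ⟨M₁, C₁, hC₁, h₁⟩ := exists_seminorm_atom_le (p.comp R₁.toLinearMap)
      (hp.comp R₁.continuous)
    obtain ⟨M₂, C₂, hC₂, h₂⟩ := exists_seminorm_atom_le (p'.comp R₂.toLinearMap)
      (hp'.comp R₂.continuous)
    obtain ⟨n, hn⟩ := summable_weight (ι₁ ⊕ ι₂)
    -- The powers `M₁` and `M₂` absorb the growth of the two atoms; the remaining power `n` makes
    -- the weights summable.
    obtain ⟨q, hq, hcoeff⟩ := exists_seminorm_coeff_le (ι := ι₁ ⊕ ι₂) (M₁ + M₂ + n)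
    let w : (ι₁ ⊕ ι₂ → ℤ) × (ι₁ ⊕ ι₂ → ℤ) → ℝ := fun i => (1 + ‖node i.1‖) * (1 + ‖intVec i.2‖)
    let D : ℝ := C₁ * C₂ * ∑' i, (w i ^ n)⁻¹
    have hD : 0 ≤ D := mul_nonneg (mul_nonneg hC₁ hC₂) (tsum_nonneg fun _ => by positivity)
    have hw : ∀ i, 0 < w i := fun i => by positivity
    have hnode : ∀ {κ : Type} [Fintype κ] (f : κ → ι₁ ⊕ ι₂) (_ : Function.Injective f)
        (i : (ι₁ ⊕ ι₂ → ℤ) × (ι₁ ⊕ ι₂ → ℤ)),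
        (1 + ‖node (i.1 ∘ f)‖) * (1 + ‖intVec (i.2 ∘ f)‖) ≤ w i := by
      intro κ _ f hf i
      have h3 := norm_node_comp_le f hf i.1
      have h4 := norm_node_comp_le f hf i.2
      have h5 : ‖node (i.1 ∘ f)‖ ≤ ‖node i.1‖ := by
        rw [node, node, norm_smul, norm_smul]
        gcongr
      simp only [w]
      gcongr
    have key : ∀ F i, ‖coeff i.1 i.2 (R F)‖ * (p (R₁ (atom (i.1 ∘ Sum.inl) (i.2 ∘ Sum.inl))) *
        p' (R₂ (atom (i.1 ∘ Sum.inr) (i.2 ∘ Sum.inr)))) ≤ (q (R F) * (C₁ * C₂)) * (w i ^ n)⁻¹ := by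
      intro F i
      have a1 : p (R₁ (atom (i.1 ∘ Sum.inl) (i.2 ∘ Sum.inl))) ≤ C₁ * w i ^ M₁ :=
        (h₁ _ _).trans (mul_le_mul_of_nonneg_left (pow_le_pow_left₀ (by positivity)
          (hnode _ Sum.inl_injective i) _) hC₁)
      have a2 : p' (R₂ (atom (i.1 ∘ Sum.inr) (i.2 ∘ Sum.inr))) ≤ C₂ * w i ^ M₂ :=
        (h₂ _ _).trans (mul_le_mul_of_nonneg_left (pow_le_pow_left₀ (by positivity)
          (hnode _ Sum.inr_injective i) _) hC₂)
      have a3 : w i ^ (M₁ + M₂ + n) * ‖coeff i.1 i.2 (R F)‖ ≤ q (R F) := hcoeff _ _ _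
      have hwi := hw i
      rw [← div_eq_mul_inv, le_div_iff₀ (by positivity)]
      calc _ ≤ ‖coeff i.1 i.2 (R F)‖ * ((C₁ * w i ^ M₁) * (C₂ * w i ^ M₂)) * w i ^ n := by
            gcongr
        _ = (w i ^ (M₁ + M₂ + n) * ‖coeff i.1 i.2 (R F)‖) * (C₁ * C₂) := by ring
        _ ≤ _ := by gcongr
    refine ⟨D.toNNReal • q.comp R.toLinearMap, continuous_const.mul (hq.comp R.continuous),
      fun F => ?_⟩
    have hs := hn.mul_left (q (R F) * (C₁ * C₂))
    have hs' : Summable fun i : (ι₁ ⊕ ι₂ → ℤ) × (ι₁ ⊕ ι₂ → ℤ) => ‖coeff i.1 i.2 (R F)‖ *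
        (p (R₁ (atom (i.1 ∘ Sum.inl) (i.2 ∘ Sum.inl))) *
        p' (R₂ (atom (i.1 ∘ Sum.inr) (i.2 ∘ Sum.inr)))) :=
      Summable.of_nonneg_of_le (fun i => mul_nonneg (norm_nonneg _)
        (mul_nonneg (apply_nonneg _ _) (apply_nonneg _ _))) (key F) hs
    refine ⟨hs', (Summable.tsum_le_tsum (key F) hs' hs).trans ?_⟩
    rw [tsum_mul_left, smul_apply, NNReal.smul_def, smul_eq_mul, Real.coe_toNNReal _ hD]
    refine le_of_eq ?_
    simp only [D, Seminorm.comp_apply, w]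
    change q (R F) * (C₁ * C₂) * _ = C₁ * C₂ * _ * q (R F)
    ring
  · have h := hasSum_coeff_mul_atom (R F) (Θ (x, y))
    have e : R F (Θ (x, y)) = F (x, y) := by simp [R]
    rw [e] at h
    refine h.congr_fun fun i => ?_
    rw [atom_sum i.1 i.2 (Θ (x, y)) (ψ₁ x) (ψ₂ y) (hΘ₁ x y) (hΘ₂ x y)]
    rfl

end SchwartzMap

/-! ### Averages of Schwartz functions over compact families of linear maps -/

namespace SchwartzMap

section AverageLinear

variable {V K : Type*} [NormedAddCommGroup V] [NormedSpace ℝ V] [TopologicalSpace K]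

theorem iteratedFDeriv_comp_linear (L : V →L[ℝ] V) (F : 𝓢(V, ℂ)) (n : ℕ) (x : V) :
    iteratedFDeriv ℝ n (fun x => F (L x)) x =
      (iteratedFDeriv ℝ n F (L x)).compContinuousLinearMap fun _ => L :=
  L.iteratedFDeriv_comp_right (F.smooth n) x le_rfl

theorem norm_iteratedFDeriv_comp_linear_le {B : ℝ} {L : V →L[ℝ] V} (hL : ‖L‖ ≤ B) (F : 𝓢(V, ℂ))
    (n : ℕ) (x : V) : ‖iteratedFDeriv ℝ n (fun x => F (L x)) x‖ ≤
      B ^ n * ‖iteratedFDeriv ℝ n F (L x)‖ := by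
  rw [iteratedFDeriv_comp_linear, mul_comm]
  refine (ContinuousMultilinearMap.norm_compContinuousLinearMap_le _ _).trans ?_
  gcongr
  rw [Finset.prod_const, Finset.card_univ, Fintype.card_fin]
  gcongr

/-- By the chain rule the `n`-th derivative is a multilinear expression in `L k` composed with the
derivative of `F` at `L k x`, and both depend continuously on `k`. -/
theorem continuous_iteratedFDeriv_comp_linear {L : K → V →L[ℝ] V} (hL : Continuous L)
    (F : 𝓢(V, ℂ)) (n : ℕ) (x : V) :
    Continuous fun k => iteratedFDeriv ℝ n (fun x => F (L k x)) x := by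
  have e : (fun k => iteratedFDeriv ℝ n (fun x => F (L k x)) x) = fun k =>
      ContinuousMultilinearMap.compContinuousLinearMapContinuousMultilinear ℝ
        (fun _ : Fin n => V) (fun _ : Fin n => V) ℂ (fun _ => L k)
        (iteratedFDeriv ℝ n F (L k x)) := by
    funext k
    rw [iteratedFDeriv_comp_linear]
    rfl
  rw [e]
  have h1 : Continuous fun k => ContinuousMultilinearMap.compContinuousLinearMapContinuousMultilinear
      ℝ (fun _ : Fin n => V) (fun _ : Fin n => V) ℂ (fun _ => L k) :=
    (ContinuousMultilinearMap.cont _).comp (continuous_pi fun _ => hL)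
  have h2 : Continuous fun k => iteratedFDeriv ℝ n F (L k x) :=
    ((F.smooth n).continuous_iteratedFDeriv le_rfl).comp (hL.clm_apply continuous_const)
  exact h1.clm_apply h2

variable [CompactSpace K] [MeasurableSpace K] [BorelSpace K] (μ : Measure K) [IsProbabilityMeasure μ] {L : K → V →L[ℝ] V}

theorem integrable_of_continuous {E : Type*} [NormedAddCommGroup E] [NormedSpace ℝ E] {f : K → E}
    (hf : Continuous f) : Integrable f μ := by
  exact hf.integrable_of_hasCompactSupport (HasCompactSupport.of_compactSpace f)

/-- A constant dominates, because the measure is finite; integrability in `k` is continuity on a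
compact space. -/
theorem hasFDerivAt_integral_of_compactSpace {E : Type*} [NormedAddCommGroup E] [NormedSpace ℝ E]
    {f : K → V → E} {f' : K → V → V →L[ℝ] E}
    (hf : ∀ x, Continuous fun k => f k x) (hf' : ∀ x, Continuous fun k => f' k x) {C : ℝ}
    (hC : ∀ k x, ‖f' k x‖ ≤ C) (hd : ∀ k x, HasFDerivAt (f k) (f' k x) x) (x : V) :
    ∃ D : V →L[ℝ] E, HasFDerivAt (fun x => ∫ k, f k x ∂μ) D x ∧
      ∀ v, D v = ∫ k, f' k x v ∂μ := by
  have hi := integrable_of_continuous μ (hf' x)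
  refine ⟨∫ k, f' k x ∂μ, ?_, fun v => ContinuousLinearMap.integral_apply hi v⟩
  exact hasFDerivAt_integral_of_dominated_of_fderiv_le (s := Set.univ) (F := fun x k => f k x)
    (F' := fun x k => f' k x) (bound := fun _ => C) Filter.univ_mem
    (Eventually.of_forall fun y => (integrable_of_continuous μ (hf y)).aestronglyMeasurable)
    (integrable_of_continuous μ (hf x)) hi.aestronglyMeasurable
    (Eventually.of_forall fun k y _ => hC k y) (integrable_const _)
    (Eventually.of_forall fun k y _ => hd k y)

/-- Differentiation under the integral, order by order. Exhibiting the whole Taylor series yields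
smoothness and the formula for the iterated derivatives together. -/
theorem hasFTaylorSeriesUpTo_average (hL : Continuous L) {B : ℝ} (hB : ∀ k, ‖L k‖ ≤ B)
    (F : 𝓢(V, ℂ)) : HasFTaylorSeriesUpTo ∞ (fun x => ∫ k, F (L k x) ∂μ)
      fun x n => ∫ k, iteratedFDeriv ℝ n (fun x => F (L k x)) x ∂μ := by
  have hcd : ∀ k, ContDiff ℝ ∞ (fun x => F (L k x)) := fun k => (F.smooth ⊤).comp (L k).contDiff
  have hint : ∀ n x, Integrable (fun k => iteratedFDeriv ℝ n (fun x => F (L k x)) x) μ :=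
    fun n x => integrable_of_continuous μ (continuous_iteratedFDeriv_comp_linear hL F n x)
  have hderiv : ∀ (n : ℕ) (x : V), HasFDerivAt
      (fun x => ∫ k, iteratedFDeriv ℝ n (fun x => F (L k x)) x ∂μ)
      (∫ k, iteratedFDeriv ℝ (n + 1) (fun x => F (L k x)) x ∂μ).curryLeft x := by
    intro n x
    have hcont : ∀ x : V, Continuous fun k =>
        fderiv ℝ (iteratedFDeriv ℝ n (fun x => F (L k x))) x := fun x =>
      (continuousMultilinearCurryLeftEquiv ℝ (fun _ : Fin (n + 1) => V) ℂ).continuous.comp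
        (continuous_iteratedFDeriv_comp_linear hL F (n + 1) x)
    obtain ⟨D, hD, hDv⟩ := hasFDerivAt_integral_of_compactSpace μ
      (f := fun k => iteratedFDeriv ℝ n fun x => F (L k x))
      (fun x => continuous_iteratedFDeriv_comp_linear hL F n x) hcont
      (C := B ^ (n + 1) * SchwartzMap.seminorm ℂ 0 (n + 1) F)
      (fun k y => by
        rw [norm_fderiv_iteratedFDeriv]
        have hB0 : 0 ≤ B := (norm_nonneg _).trans (hB k)
        refine (norm_iteratedFDeriv_comp_linear_le (hB k) F (n + 1) y).trans ?_
        gcongr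
        exact norm_iteratedFDeriv_le_seminorm ℂ F (n + 1) _)
      (fun k y => by
        have hd : Differentiable ℝ (iteratedFDeriv ℝ n fun x => F (L k x)) :=
          (hcd k).differentiable_iteratedFDeriv (by exact_mod_cast WithTop.coe_lt_top _)
        exact (hd y).hasFDerivAt) x
    have heq : (∫ k, iteratedFDeriv ℝ (n + 1) (fun x => F (L k x)) x ∂μ).curryLeft = D := by
      ext v w
      rw [hDv, ContinuousMultilinearMap.curryLeft_apply,
        ContinuousMultilinearMap.integral_apply (hint (n + 1) x),
        ContinuousMultilinearMap.integral_apply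
          (integrable_of_continuous μ ((hcont x).clm_apply continuous_const))]
      rfl
    exact heq ▸ hD
  refine ⟨fun x => ?_, fun m _ x => hderiv m x, fun m _ => ?_⟩
  · rw [ContinuousMultilinearMap.curry0, ContinuousMultilinearMap.integral_apply (hint 0 x)]
    rfl
  · exact continuous_iff_continuousAt.2 fun x => (hderiv m x).continuousAt

/-- The average of a Schwartz function over a compact family of linear maps. -/
theorem exists_average (hL : Continuous L) {B : ℝ} (hB : ∀ k, ‖L k‖ ≤ B)
    (hB' : ∀ k x, ‖x‖ ≤ B * ‖L k x‖) :
    ∃ P : 𝓢(V, ℂ) →L[ℂ] 𝓢(V, ℂ), ∀ F x, P F x = ∫ k, F (L k x) ∂μ := by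
  have hint : ∀ (F : 𝓢(V, ℂ)) x, Integrable (fun k => F (L k x)) μ := fun F x =>
    integrable_of_continuous μ (F.continuous.comp (hL.clm_apply continuous_const))
  obtain ⟨k₀⟩ : Nonempty K := μ.nonempty_of_neZero
  have hB0 : 0 ≤ B := (norm_nonneg _).trans (hB k₀)
  refine ⟨mkCLM (fun F x => ∫ k, F (L k x) ∂μ) (fun F G x => ?_) (fun a F x => ?_)
    (fun F => ?_) ?_, fun F x => rfl⟩
  · exact integral_add (hint F x) (hint G x)
  · exact integral_const_mul a _
  · exact (hasFTaylorSeriesUpTo_average μ hL hB F).contDiff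
  · rintro ⟨k, n⟩
    refine ⟨{(k, n)}, B ^ k * B ^ n, by positivity, fun F x => ?_⟩
    simp only [Finset.sup_singleton, schwartzSeminormFamily_apply]
    rw [← (hasFTaylorSeriesUpTo_average μ hL hB F).eq_iteratedFDeriv
      (by exact_mod_cast le_top) x]
    -- The bound of `L j` from below moves the weight from `x` to `L j x`, the bound from above
    -- controls the derivatives.
    have h1 : ∀ j, ‖x‖ ^ k * ‖iteratedFDeriv ℝ n (fun x => F (L j x)) x‖ ≤
        B ^ k * B ^ n * SchwartzMap.seminorm ℂ k n F := fun j => by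
      calc ‖x‖ ^ k * ‖iteratedFDeriv ℝ n (fun x => F (L j x)) x‖
          ≤ (B * ‖L j x‖) ^ k * (B ^ n * ‖iteratedFDeriv ℝ n F (L j x)‖) := by
            gcongr
            · exact hB' j x
            · exact norm_iteratedFDeriv_comp_linear_le (hB j) F n x
        _ = B ^ k * B ^ n * (‖L j x‖ ^ k * ‖iteratedFDeriv ℝ n F (L j x)‖) := by
            rw [mul_pow]; ring
        _ ≤ _ := by
            gcongr
            exact le_seminorm ℂ k n F (L j x)
    calc ‖x‖ ^ k * ‖∫ j, iteratedFDeriv ℝ n (fun x => F (L j x)) x ∂μ‖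
        = ‖∫ j, (‖x‖ ^ k) • iteratedFDeriv ℝ n (fun x => F (L j x)) x ∂μ‖ := by
          rw [integral_smul, norm_smul, Real.norm_of_nonneg (by positivity)]
      _ ≤ B ^ k * B ^ n * SchwartzMap.seminorm ℂ k n F := by
          have h2 : ∀ j, ‖‖x‖ ^ k • iteratedFDeriv ℝ n (fun x => F (L j x)) x‖ ≤
              B ^ k * B ^ n * SchwartzMap.seminorm ℂ k n F := fun j => by
            rw [norm_smul, Real.norm_of_nonneg (by positivity)]
            exact h1 j
          have := norm_integral_le_of_norm_le_const (μ := μ) (Eventually.of_forall h2)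
          simpa using this

end AverageLinear

end SchwartzMap

/-! ### The linear action of `K` and expansions of invariant Schwartz functions -/

namespace GelfandPair

open NilpotentLieGroup SchwartzMap

section Action

variable {N K : Type*} [NormedAddCommGroup N] [NormedSpace ℝ N] [NilpotentLieGroup N]
  [Group K] [TopologicalSpace K] [MulDistribMulAction K N] [ContinuousSMul K N]

/-- The linear map by which an automorphism acts in exponential coordinates. -/
noncomputable def actCLM (k : K) : N →L[ℝ] N := fderiv ℝ (fun x : N => k • x) 0

@[simp]
-- Automorphisms commute with powers, hence with division by `n` in exponential coordinates. The
-- difference quotients of `t ↦ k • (t • x)` at `t = 1 / n` are therefore constantly `k • x`, and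
-- the derivative at `0` is the action itself.
theorem actCLM_apply (k : K) (x : N) : actCLM k x = k • x := by
  have hd : HasFDerivAt (fun x : N => k • x) (actCLM k) ((0 : ℝ) • x) := by
    rw [zero_smul]
    exact ((contDiff_smul k).differentiable (by simp) 0).hasFDerivAt
  have hl : HasDerivAt (fun t : ℝ => t • x) x 0 := by
    simpa using (hasDerivAt_id (0 : ℝ)).smul_const x
  have h := hd.comp_hasDerivAt (0 : ℝ) hl
  rw [hasDerivAt_iff_tendsto_slope_zero] at h
  have hn : Tendsto (fun n : ℕ => ((n : ℝ))⁻¹) atTop (𝓝[≠] 0) := by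
    refine tendsto_nhdsWithin_iff.2 ⟨tendsto_inv_atTop_nhds_zero_nat, ?_⟩
    filter_upwards [eventually_gt_atTop 0] with n hn
    simp [hn.ne']
  have h1 := h.comp hn
  refine tendsto_nhds_unique h1 (tendsto_const_nhds.congr' ?_)
  filter_upwards [eventually_ne_atTop 0] with n hn
  have hn' : (n : ℝ) ≠ 0 := by exact_mod_cast hn
  have h0 : k • (0 : N) = 0 := by rw [zero_eq_one, smul_one]
  have e : k • x = (n : ℝ) • (k • ((n : ℝ)⁻¹ • x)) := by
    rw [nsmul_eq_pow n (k • ((n : ℝ)⁻¹ • x)), ← smul_pow', ← nsmul_eq_pow, smul_inv_smul₀ hn']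
  simp [h0, ← e]

variable [IsTopologicalGroup K] [FiniteDimensional ℝ N]

theorem continuous_actCLM_inv : Continuous fun k : K => (actCLM k⁻¹ : N →L[ℝ] N) := by
  rw [continuous_clm_apply]
  intro x
  simp only [actCLM_apply]
  fun_prop

variable (N K) in
-- Compactness of `K` gives the upper bound; the lower bound is the upper one for `k⁻¹`.
theorem exists_norm_actCLM_le [CompactSpace K] :
    ∃ B : ℝ, (∀ k : K, ‖(actCLM k : N →L[ℝ] N)‖ ≤ B) ∧ ∀ (k : K) (x : N), ‖x‖ ≤ B * ‖k • x‖ := by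
  obtain ⟨B, hB⟩ := isCompact_univ.exists_bound_of_continuousOn
    (continuous_actCLM_inv (N := N) (K := K)).continuousOn
  have hB' : ∀ k : K, ‖(actCLM k : N →L[ℝ] N)‖ ≤ B := fun k => by
    simpa using hB k⁻¹ (Set.mem_univ _)
  refine ⟨B, hB', fun k x => ?_⟩
  have h := (actCLM k⁻¹ : N →L[ℝ] N).le_opNorm (k • x)
  rw [actCLM_apply, inv_smul_smul] at h
  exact h.trans (mul_le_mul_of_nonneg_right (hB' _) (norm_nonneg _))

end Action

section Average

variable {K : Type*} [Group K] [TopologicalSpace K] [IsTopologicalGroup K] [CompactSpace K]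
  [MeasurableSpace K] [BorelSpace K]

variable (K) in
theorem exists_isProbabilityMeasure_isMulLeftInvariant :
    ∃ μ : Measure K, IsProbabilityMeasure μ ∧ μ.IsMulLeftInvariant := by
  let μ : Measure K := Measure.haarMeasure ⊤
  refine ⟨μ, ⟨?_⟩, inferInstance⟩
  have := Measure.haarMeasure_self (K₀ := (⊤ : TopologicalSpace.PositiveCompacts K))
  simpa using this

variable (μ : Measure K) [IsProbabilityMeasure μ]

/-- Meant for expansions of an invariant function along an orbit: averaging changes the terms but
not the sum, which is the same for all `k`. -/
theorem hasSum_integral_of_bounded {κ : Type*} [Countable κ] {f : κ → K → ℂ} {b : κ → ℝ} {a : ℂ}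
    (hf : ∀ i, Continuous (f i)) (hb : ∀ i k, ‖f i k‖ ≤ b i) (hs : Summable b)
    (h : ∀ k, HasSum (fun i => f i k) a) : HasSum (fun i => ∫ k, f i k ∂μ) a := by
  have hi : ∀ i, Integrable (f i) μ := fun i => integrable_of_continuous μ (hf i)
  have h1 := hasSum_integral_of_summable_integral_norm hi (by
    refine Summable.of_nonneg_of_le (fun i => integral_nonneg fun _ => norm_nonneg _)
      (fun i => ?_) hs
    have := integral_mono (μ := μ) (hi i).norm (integrable_const (b i)) (hb i)
    simpa using this)
  have e : (∫ k, ∑' i, f i k ∂μ) = a := by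
    simp [fun k => (h k).tsum_eq]
  rwa [e] at h1

variable [μ.IsMulLeftInvariant] {N : Type*} [NormedAddCommGroup N] [NormedSpace ℝ N]
  [FiniteDimensional ℝ N] [NilpotentLieGroup N] [MulDistribMulAction K N] [ContinuousSMul K N]

/-- Averaging over `k⁻¹` rather than `k` is what makes left invariance of the measure sufficient:
`k⁻¹ • h • x = (h⁻¹ * k)⁻¹ • x`. -/
theorem exists_average_invSchwartz : ∃ P : 𝓢(N, ℂ) →L[ℂ] InvSchwartz N K,
    ∀ F x, (P F).1 x = ∫ k, F (k⁻¹ • x) ∂μ := by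
  obtain ⟨B, hB, hB'⟩ := exists_norm_actCLM_le N K
  obtain ⟨P, hP⟩ := SchwartzMap.exists_average μ (continuous_actCLM_inv (N := N) (K := K))
    (fun k => hB k⁻¹) (fun k x => by simpa using hB' k⁻¹ x)
  simp only [actCLM_apply] at hP
  refine ⟨P.codRestrict (InvSchwartz N K) fun F => ?_, hP⟩
  intro h x
  rw [hP, hP, ← integral_mul_left_eq_self (fun k => F (k⁻¹ • x)) h⁻¹]
  simp [mul_smul]

end Average

section Applications

variable {K : Type*} [Group K] [TopologicalSpace K] [IsTopologicalGroup K] [CompactSpace K]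
  {N : Type*} [NormedAddCommGroup N] [NormedSpace ℝ N]
  [FiniteDimensional ℝ N] [NilpotentLieGroup N] [MulDistribMulAction K N] [ContinuousSMul K N]

/-- There are nonnegative invariant test functions which do not vanish at a given point. -/
theorem exists_invariant_bump (K : Type*) [Group K] [TopologicalSpace K] [IsTopologicalGroup K]
    [CompactSpace K] [MulDistribMulAction K N] [ContinuousSMul K N] (x₀ : N) :
    ∃ b : InvSchwartz N K, (∀ x, ∃ r : ℝ, 0 ≤ r ∧ b.1 x = r) ∧ b.1 x₀ = 1 ∧
      HasCompactSupport b.1 := by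
  let _ : MeasurableSpace K := borel K
  have : BorelSpace K := ⟨rfl⟩
  obtain ⟨μ, _, _⟩ := exists_isProbabilityMeasure_isMulLeftInvariant K
  obtain ⟨P, hP⟩ := exists_average_invSchwartz (N := N) μ
  obtain ⟨B, hB, hB'⟩ := exists_norm_actCLM_le N K
  have hB0 : 0 ≤ B := (norm_nonneg _).trans (hB 1)
  -- The orbit of `x₀` lies in the ball of radius `B * ‖x₀‖`, so `ρ` is `1` on all of it. Since
  -- orbits do not shrink norms by more than the factor `B`, the average still has compact support.
  let ρ : ContDiffBump (0 : N) :=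
    ⟨B * ‖x₀‖ + 1, B * ‖x₀‖ + 2, by positivity, by linarith⟩
  have hcs : HasCompactSupport fun x => ((ρ x : ℝ) : ℂ) :=
    ρ.hasCompactSupport.comp_left Complex.ofReal_zero
  let f : 𝓢(N, ℂ) := hcs.toSchwartzMap (Complex.ofRealCLM.contDiff.comp ρ.contDiff)
  have hf : ∀ x, f x = ((ρ x : ℝ) : ℂ) := fun _ => rfl
  have hP' : ∀ x, (P f).1 x = ((∫ k : K, ρ (k⁻¹ • x) ∂μ : ℝ) : ℂ) := fun x => by
    rw [hP]
    simp only [hf]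
    exact integral_ofReal
  refine ⟨P f, fun x => ⟨_, integral_nonneg fun _ => ρ.nonneg, hP' x⟩, ?_, ?_⟩
  · rw [hP']
    have : ∀ k : K, ρ (k⁻¹ • x₀) = 1 := fun k => by
      refine ρ.one_of_mem_closedBall ?_
      rw [mem_closedBall_zero_iff]
      have h := (actCLM k⁻¹ : N →L[ℝ] N).le_opNorm x₀
      rw [actCLM_apply] at h
      have h2 := mul_le_mul_of_nonneg_right (hB k⁻¹) (norm_nonneg x₀)
      change ‖k⁻¹ • x₀‖ ≤ B * ‖x₀‖ + 1
      linarith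
    simp [this]
  · refine HasCompactSupport.intro (isCompact_closedBall (0 : N) (B * (B * ‖x₀‖ + 2)))
      fun x hx => ?_
    rw [hP']
    have : ∀ k : K, ρ (k⁻¹ • x) = 0 := fun k => by
      refine ρ.zero_of_le_dist ?_
      rw [mem_closedBall_zero_iff, not_le] at hx
      rw [dist_zero_right]
      change B * ‖x₀‖ + 2 ≤ ‖k⁻¹ • x‖
      by_contra h
      rw [not_le] at h
      have h1 := hB' k⁻¹ x
      have h2 := mul_le_mul_of_nonneg_left h.le hB0
      linarith
    simp [this]

/-- Invariant Schwartz functions on a product have a rapidly convergent expansion into products of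
invariant Schwartz functions on the factors. -/
theorem exists_invSchwartz_expansion (N₁ N₂ K₁ K₂ : Type*)
    [NormedAddCommGroup N₁] [NormedSpace ℝ N₁] [FiniteDimensional ℝ N₁] [NilpotentLieGroup N₁]
    [NormedAddCommGroup N₂] [NormedSpace ℝ N₂] [FiniteDimensional ℝ N₂] [NilpotentLieGroup N₂]
    [Group K₁] [TopologicalSpace K₁] [IsTopologicalGroup K₁] [CompactSpace K₁]
    [MulDistribMulAction K₁ N₁] [ContinuousSMul K₁ N₁]
    [Group K₂] [TopologicalSpace K₂] [IsTopologicalGroup K₂] [CompactSpace K₂]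
    [MulDistribMulAction K₂ N₂] [ContinuousSMul K₂ N₂] :
    ∃ (κ : Type) (a : κ → InvSchwartz N₁ K₁) (b : κ → InvSchwartz N₂ K₂)
      (c : κ → InvSchwartz (N₁ × N₂) (K₁ × K₂) →ₗ[ℂ] ℂ),
      (∀ (p : Seminorm ℂ (InvSchwartz N₁ K₁)) (p' : Seminorm ℂ (InvSchwartz N₂ K₂)),
        Continuous p → Continuous p' →
        ∃ q : Seminorm ℂ (InvSchwartz (N₁ × N₂) (K₁ × K₂)), Continuous q ∧ ∀ F,
          Summable (fun i => ‖c i F‖ * (p (a i) * p' (b i))) ∧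
            ∑' i, ‖c i F‖ * (p (a i) * p' (b i)) ≤ q F) ∧
      ∀ F x y, HasSum (fun i => c i F * ((a i).1 x * (b i).1 y)) (F.1 (x, y)) := by
  let _ : MeasurableSpace K₁ := borel K₁
  have : BorelSpace K₁ := ⟨rfl⟩
  let _ : MeasurableSpace K₂ := borel K₂
  have : BorelSpace K₂ := ⟨rfl⟩
  obtain ⟨μ₁, _, _⟩ := exists_isProbabilityMeasure_isMulLeftInvariant K₁
  obtain ⟨μ₂, _, _⟩ := exists_isProbabilityMeasure_isMulLeftInvariant K₂
  obtain ⟨P₁, hP₁⟩ := exists_average_invSchwartz (N := N₁) μ₁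
  obtain ⟨P₂, hP₂⟩ := exists_average_invSchwartz (N := N₂) μ₂
  obtain ⟨κ, _, e, e', c, hc, hsum⟩ := SchwartzMap.exists_tensor_expansion N₁ N₂
  refine ⟨κ, fun i => P₁ (e i), fun i => P₂ (e' i),
    fun i => (c i).comp (InvSchwartz (N₁ × N₂) (K₁ × K₂)).subtype, ?_, fun F x y => ?_⟩
  · intro p p' hp hp'
    obtain ⟨q, hq, h⟩ := hc (p.comp P₁.toLinearMap) (p'.comp P₂.toLinearMap)
      (hp.comp P₁.continuous) (hp'.comp P₂.continuous)
    exact ⟨q.comp (InvSchwartz (N₁ × N₂) (K₁ × K₂)).subtype, hq.comp continuous_subtype_val,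
      fun F => h F.1⟩
  · obtain ⟨q, -, hq⟩ := hc (SchwartzMap.seminorm ℂ 0 0) (SchwartzMap.seminorm ℂ 0 0)
      ((schwartz_withSeminorms ℂ N₁ ℂ).continuous_seminorm (0, 0))
      ((schwartz_withSeminorms ℂ N₂ ℂ).continuous_seminorm (0, 0))
    have hs := (hq F.1).1
    have hbound : ∀ i x y, ‖c i F.1 * (e i x * e' i y)‖ ≤ ‖c i F.1‖ *
        (SchwartzMap.seminorm ℂ 0 0 (e i) * SchwartzMap.seminorm ℂ 0 0 (e' i)) := fun i x y => by
      rw [norm_mul, norm_mul]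
      gcongr
      · exact norm_le_seminorm ℂ (e i) x
      · exact norm_le_seminorm ℂ (e' i) y
    have hcont₁ : ∀ i, Continuous fun k : K₁ => e i (k⁻¹ • x) := fun i =>
      (e i).continuous.comp (by fun_prop)
    have hcont₂ : ∀ i, Continuous fun k : K₂ => e' i (k⁻¹ • y) := fun i =>
      (e' i).continuous.comp (by fun_prop)
    have hnorm₁ : ∀ i, ‖(P₁ (e i)).1 x‖ ≤ SchwartzMap.seminorm ℂ 0 0 (e i) := fun i => by
      rw [hP₁]
      have := norm_integral_le_of_norm_le_const (μ := μ₁) (f := fun k => e i (k⁻¹ • x))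
        (Eventually.of_forall fun k => norm_le_seminorm ℂ (e i) (k⁻¹ • x))
      simpa using this
    -- The terms are averaged in the first variable with the second one frozen on its orbit, then in
    -- the second; invariance of `F` keeps the sum at `F (x, y)`.
    have step₁ : ∀ k₂ : K₂, HasSum (fun i => c i F.1 * ((P₁ (e i)).1 x * e' i (k₂⁻¹ • y)))
        (F.1 (x, y)) := fun k₂ => by
      have := hasSum_integral_of_bounded μ₁
        (f := fun i k => c i F.1 * (e i (k⁻¹ • x) * e' i (k₂⁻¹ • y))) (a := F.1 (x, y))
        (fun i => continuous_const.mul ((hcont₁ i).mul continuous_const))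
        (fun i k => hbound i _ _) hs (fun k => by
          have h1 := hsum F.1 (k⁻¹ • x) (k₂⁻¹ • y)
          have h2 : F.1 (k⁻¹ • x, k₂⁻¹ • y) = F.1 (x, y) := F.2 (k⁻¹, k₂⁻¹) (x, y)
          rwa [h2] at h1)
      refine this.congr_fun fun i => ?_
      rw [integral_const_mul, integral_mul_const, hP₁]
    have := hasSum_integral_of_bounded μ₂
        (f := fun i k => c i F.1 * ((P₁ (e i)).1 x * e' i (k⁻¹ • y))) (a := F.1 (x, y))
        (fun i => continuous_const.mul (continuous_const.mul (hcont₂ i)))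
        (fun i k => by
          rw [norm_mul, norm_mul]
          gcongr
          · exact hnorm₁ i
          · exact norm_le_seminorm ℂ (e' i) _) hs step₁
    refine this.congr_fun fun i => ?_
    rw [integral_const_mul, integral_const_mul]
    simp only [LinearMap.comp_apply, Submodule.subtype_apply, hP₂]

end Applications

end GelfandPair

/-! ### Lifting differential operators from the factors to the product -/

namespace GelfandPair

open NilpotentLieGroup

section Lift

variable {N₁ N₂ : Type*} [NormedAddCommGroup N₁] [NormedSpace ℝ N₁]
  [NormedAddCommGroup N₂] [NormedSpace ℝ N₂]

/-- The restriction of a smooth function on `N₁ × N₂` to a slice `N₁ × {y}`. -/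
def sliceL (f : Smooth (N₁ × N₂)) (y : N₂) : Smooth N₁ :=
  ⟨fun x => f.1 (x, y), by
    have hf : ContDiff ℝ ∞ f.1 := f.2
    exact hf.comp (contDiff_id.prodMk contDiff_const)⟩

/-- The restriction of a smooth function on `N₁ × N₂` to a slice `{x} × N₂`. -/
def sliceR (f : Smooth (N₁ × N₂)) (x : N₁) : Smooth N₂ :=
  ⟨fun y => f.1 (x, y), by
    have hf : ContDiff ℝ ∞ f.1 := f.2
    exact hf.comp (contDiff_const.prodMk contDiff_id)⟩

/-- The product `(x, y) ↦ f x * g y` of two smooth functions. -/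
def smoothTensor (f : Smooth N₁) (g : Smooth N₂) : Smooth (N₁ × N₂) :=
  ⟨fun z => f.1 z.1 * g.1 z.2, by
    have hf : ContDiff ℝ ∞ f.1 := f.2
    have hg : ContDiff ℝ ∞ g.1 := g.2
    exact (hf.comp contDiff_fst).mul (hg.comp contDiff_snd)⟩

@[simp]
theorem smoothTensor_coe (f : Smooth N₁) (g : Smooth N₂) (x : N₁) (y : N₂) :
    (smoothTensor f g).1 (x, y) = f.1 x * g.1 y := rfl

theorem sliceL_smoothTensor (f : Smooth N₁) (g : Smooth N₂) (y : N₂) :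
    sliceL (smoothTensor f g) y = g.1 y • f := by
  ext x
  exact mul_comm _ _

theorem sliceR_smoothTensor (f : Smooth N₁) (g : Smooth N₂) (x : N₁) :
    sliceR (smoothTensor f g) x = f.1 x • g := by
  ext y
  rfl

/-- `D'` acts on functions on `N₁ × N₂` as `D` does on the first variable. -/
def IsLiftL (D : Module.End ℂ (Smooth N₁)) (D' : Module.End ℂ (Smooth (N₁ × N₂))) : Prop :=
  ∀ f x y, (D' f).1 (x, y) = (D (sliceL f y)).1 x

/-- `D'` acts on functions on `N₁ × N₂` as `D` does on the second variable. -/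
def IsLiftR (D : Module.End ℂ (Smooth N₂)) (D' : Module.End ℂ (Smooth (N₁ × N₂))) : Prop :=
  ∀ f x y, (D' f).1 (x, y) = (D (sliceR f x)).1 y

namespace IsLiftL

variable {D E : Module.End ℂ (Smooth N₁)} {D' E' : Module.End ℂ (Smooth (N₁ × N₂))}

theorem sliceL_eq (h : IsLiftL D D') (f : Smooth (N₁ × N₂)) (y : N₂) :
    sliceL (D' f) y = D (sliceL f y) := by
  ext x
  exact h f x y

theorem unique (h : IsLiftL D D') (h' : IsLiftL D E') : D' = E' := by
  ext f z
  exact (h f z.1 z.2).trans (h' f z.1 z.2).symm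

theorem scalar (c : ℂ) : IsLiftL (algebraMap ℂ (Module.End ℂ (Smooth N₁)) c)
    (algebraMap ℂ (Module.End ℂ (Smooth (N₁ × N₂))) c) := fun _ _ _ => rfl

theorem add (h : IsLiftL D D') (h' : IsLiftL E E') : IsLiftL (D + E) (D' + E') := fun f x y =>
  congrArg₂ (· + ·) (h f x y) (h' f x y)

theorem mul (h : IsLiftL D D') (h' : IsLiftL E E') : IsLiftL (D * E) (D' * E') := fun f x y => by
  have h1 := h (E' f) x y
  rw [h'.sliceL_eq] at h1
  exact h1

theorem apply_smoothTensor (h : IsLiftL D D') (f : Smooth N₁) (g : Smooth N₂) :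
    D' (smoothTensor f g) = smoothTensor (D f) g := by
  ext ⟨x, y⟩
  have h1 := h (smoothTensor f g) x y
  rw [sliceL_smoothTensor, map_smul] at h1
  exact h1.trans (mul_comm _ _)

end IsLiftL

namespace IsLiftR

variable {D E : Module.End ℂ (Smooth N₂)} {D' E' : Module.End ℂ (Smooth (N₁ × N₂))}

theorem sliceR_eq (h : IsLiftR D D') (f : Smooth (N₁ × N₂)) (x : N₁) :
    sliceR (D' f) x = D (sliceR f x) := by
  ext y
  exact h f x y

theorem unique (h : IsLiftR D D') (h' : IsLiftR D E') : D' = E' := by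
  ext f z
  exact (h f z.1 z.2).trans (h' f z.1 z.2).symm

theorem scalar (c : ℂ) : IsLiftR (algebraMap ℂ (Module.End ℂ (Smooth N₂)) c)
    (algebraMap ℂ (Module.End ℂ (Smooth (N₁ × N₂))) c) := fun _ _ _ => rfl

theorem add (h : IsLiftR D D') (h' : IsLiftR E E') : IsLiftR (D + E) (D' + E') := fun f x y =>
  congrArg₂ (· + ·) (h f x y) (h' f x y)

theorem mul (h : IsLiftR D D') (h' : IsLiftR E E') : IsLiftR (D * E) (D' * E') := fun f x y => by
  have h1 := h (E' f) x y
  rw [h'.sliceR_eq] at h1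
  exact h1

theorem apply_smoothTensor (h : IsLiftR D D') (f : Smooth N₁) (g : Smooth N₂) :
    D' (smoothTensor f g) = smoothTensor f (D g) := by
  ext ⟨x, y⟩
  have h1 := h (smoothTensor f g) x y
  rw [sliceR_smoothTensor, map_smul] at h1
  exact h1

end IsLiftR

variable [NilpotentLieGroup N₁] [NilpotentLieGroup N₂]

theorem differentiable_translate (f : Smooth (N₁ × N₂)) (z : N₁ × N₂) :
    Differentiable ℝ fun w => f.1 (z * w) := by
  have h : ContDiff ℝ ∞ fun y => f.1 (z * y) :=
    (contDiff_translate f).comp (contDiff_const.prodMk contDiff_id)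
  exact h.differentiable (by simp)

theorem isLiftL_leftField (v : N₁) :
    IsLiftL (leftField v) (leftField ((v, 0) : N₁ × N₂)) := fun f x y => by
  change fderiv ℝ (fun w => f.1 ((x, y) * w)) 0 (v, 0) = fderiv ℝ (fun u => f.1 (x * u, y)) 0 v
  have e : (fun u : N₁ => f.1 (x * u, y)) =
      (fun w => f.1 ((x, y) * w)) ∘ (ContinuousLinearMap.inl ℝ N₁ N₂) := by
    ext u
    simp [zero_eq_one]
  have h0 : DifferentiableAt ℝ (fun w => f.1 ((x, y) * w)) (ContinuousLinearMap.inl ℝ N₁ N₂ 0) :=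
    differentiable_translate f (x, y) _
  have h1 := h0.hasFDerivAt.comp (0 : N₁) (ContinuousLinearMap.inl ℝ N₁ N₂).hasFDerivAt
  rw [e, h1.fderiv, map_zero]
  simp

theorem isLiftR_leftField (v : N₂) :
    IsLiftR (leftField v) (leftField ((0, v) : N₁ × N₂)) := fun f x y => by
  change fderiv ℝ (fun w => f.1 ((x, y) * w)) 0 (0, v) = fderiv ℝ (fun u => f.1 (x, y * u)) 0 v
  have e : (fun u : N₂ => f.1 (x, y * u)) =
      (fun w => f.1 ((x, y) * w)) ∘ (ContinuousLinearMap.inr ℝ N₁ N₂) := by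
    ext u
    simp [zero_eq_one]
  have h0 : DifferentiableAt ℝ (fun w => f.1 ((x, y) * w)) (ContinuousLinearMap.inr ℝ N₁ N₂ 0) :=
    differentiable_translate f (x, y) _
  have h1 := h0.hasFDerivAt.comp (0 : N₂) (ContinuousLinearMap.inr ℝ N₁ N₂).hasFDerivAt
  rw [e, h1.fderiv, map_zero]
  simp

theorem leftField_mem (v : N₁) : leftField v ∈ diffOps N₁ :=
  Algebra.subset_adjoin ⟨v, rfl⟩

/-- Vector fields and scalars lift, and lifts are compatible with sums and products, so everything
they generate lifts. -/
theorem exists_isLiftL {D : Module.End ℂ (Smooth N₁)} (hD : D ∈ diffOps N₁) :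
    ∃ D' ∈ diffOps (N₁ × N₂), IsLiftL D D' := by
  induction hD using Algebra.adjoin_induction with
  | mem D hD =>
    obtain ⟨v, rfl⟩ := hD
    exact ⟨_, leftField_mem _, isLiftL_leftField v⟩
  | algebraMap c => exact ⟨_, Subalgebra.algebraMap_mem _ c, IsLiftL.scalar c⟩
  | add D E _ _ h₁ h₂ =>
    obtain ⟨D', hD', hD⟩ := h₁
    obtain ⟨E', hE', hE⟩ := h₂
    exact ⟨_, add_mem hD' hE', hD.add hE⟩
  | mul D E _ _ h₁ h₂ =>
    obtain ⟨D', hD', hD⟩ := h₁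
    obtain ⟨E', hE', hE⟩ := h₂
    exact ⟨_, mul_mem hD' hE', hD.mul hE⟩

theorem exists_isLiftR {D : Module.End ℂ (Smooth N₂)} (hD : D ∈ diffOps N₂) :
    ∃ D' ∈ diffOps (N₁ × N₂), IsLiftR D D' := by
  induction hD using Algebra.adjoin_induction with
  | mem D hD =>
    obtain ⟨v, rfl⟩ := hD
    exact ⟨_, leftField_mem _, isLiftR_leftField v⟩
  | algebraMap c => exact ⟨_, Subalgebra.algebraMap_mem _ c, IsLiftR.scalar c⟩
  | add D E _ _ h₁ h₂ =>
    obtain ⟨D', hD', hD⟩ := h₁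
    obtain ⟨E', hE', hE⟩ := h₂
    exact ⟨_, add_mem hD' hE', hD.add hE⟩
  | mul D E _ _ h₁ h₂ =>
    obtain ⟨D', hD', hD⟩ := h₁
    obtain ⟨E', hE', hE⟩ := h₂
    exact ⟨_, mul_mem hD' hE', hD.mul hE⟩

variable (N₂) in
/-- The operator on `N₁ × N₂` which acts as a given operator on the first variable. -/
noncomputable def liftL : diffOps N₁ →ₐ[ℂ] Module.End ℂ (Smooth (N₁ × N₂)) :=
  -- The lift is chosen, but lifts are unique, and the axioms of an algebra homomorphism follow from
  -- that.
  have h : ∀ D : diffOps N₁, IsLiftL D.1 (exists_isLiftL (N₂ := N₂) D.2).choose := fun D =>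
    (exists_isLiftL (N₂ := N₂) D.2).choose_spec.2
  { toFun := fun D => (exists_isLiftL (N₂ := N₂) D.2).choose
    map_one' := (h 1).unique fun _ _ _ => rfl
    map_zero' := (h 0).unique fun _ _ _ => rfl
    map_add' := fun D E => (h (D + E)).unique ((h D).add (h E))
    map_mul' := fun D E => (h (D * E)).unique ((h D).mul (h E))
    commutes' := fun c => (h _).unique (IsLiftL.scalar c) }

variable (N₁) in
/-- The operator on `N₁ × N₂` which acts as a given operator on the second variable. -/
noncomputable def liftR : diffOps N₂ →ₐ[ℂ] Module.End ℂ (Smooth (N₁ × N₂)) :=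
  have h : ∀ D : diffOps N₂, IsLiftR D.1 (exists_isLiftR (N₁ := N₁) D.2).choose := fun D =>
    (exists_isLiftR (N₁ := N₁) D.2).choose_spec.2
  { toFun := fun D => (exists_isLiftR (N₁ := N₁) D.2).choose
    map_one' := (h 1).unique fun _ _ _ => rfl
    map_zero' := (h 0).unique fun _ _ _ => rfl
    map_add' := fun D E => (h (D + E)).unique ((h D).add (h E))
    map_mul' := fun D E => (h (D * E)).unique ((h D).mul (h E))
    commutes' := fun c => (h _).unique (IsLiftR.scalar c) }

theorem isLiftL_liftL (D : diffOps N₁) : IsLiftL D.1 (liftL N₂ D) :=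
  (exists_isLiftL (N₂ := N₂) D.2).choose_spec.2

theorem isLiftR_liftR (D : diffOps N₂) : IsLiftR D.1 (liftR N₁ D) :=
  (exists_isLiftR (N₁ := N₁) D.2).choose_spec.2

theorem liftL_mem (D : diffOps N₁) : liftL N₂ D ∈ diffOps (N₁ × N₂) :=
  (exists_isLiftL (N₂ := N₂) D.2).choose_spec.1

theorem liftR_mem (D : diffOps N₂) : liftR N₁ D ∈ diffOps (N₁ × N₂) :=
  (exists_isLiftR (N₁ := N₁) D.2).choose_spec.1

/-- Since `(x * s, y * t) = (x, y) * (s, t)`, both compositions are mixed second derivatives at `0`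
of the single function `g z = f ((x, y) * z)`, in the directions `(v, 0)` and `(0, w)`; the claim is
the symmetry of the second derivative. -/
theorem commute_leftField (v : N₁) (w : N₂) :
    Commute (leftField ((v, 0) : N₁ × N₂)) (leftField ((0, w) : N₁ × N₂)) := by
  have hL := isLiftL_leftField (N₂ := N₂) v
  have hR := isLiftR_leftField (N₁ := N₁) w
  refine LinearMap.ext fun f => ?_
  ext ⟨x, y⟩
  let g : N₁ × N₂ → ℂ := fun z => f.1 ((x, y) * z)
  have hg : ContDiff ℝ ∞ g := (contDiff_translate f).comp (contDiff_const.prodMk contDiff_id)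
  have hgd : Differentiable ℝ g := hg.differentiable (by simp)
  have hg' : ContDiff ℝ ∞ (fderiv ℝ g) := hg.fderiv_right (by simp)
  have hg'd : Differentiable ℝ (fderiv ℝ g) := hg'.differentiable (by simp)
  have e1 : ∀ s : N₁, (leftField ((0, w) : N₁ × N₂) f).1 (x * s, y) =
      fderiv ℝ g (s, 0) (0, w) := fun s => by
    rw [hR f (x * s) y]
    change fderiv ℝ (fun u => f.1 (x * s, y * u)) 0 w = _
    have e : (fun u => f.1 (x * s, y * u)) = fun u => g (s, u) := rfl
    rw [e]
    have h1 : HasFDerivAt (fun u : N₂ => g (s, u))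
        ((fderiv ℝ g (s, 0)).comp (ContinuousLinearMap.inr ℝ N₁ N₂)) 0 :=
      (hgd (s, 0)).hasFDerivAt.comp (0 : N₂) (hasFDerivAt_prodMk_right s 0)
    rw [h1.fderiv]
    simp
  have e2 : ∀ t : N₂, (leftField ((v, 0) : N₁ × N₂) f).1 (x, y * t) =
      fderiv ℝ g (0, t) (v, 0) := fun t => by
    rw [hL f x (y * t)]
    change fderiv ℝ (fun u => f.1 (x * u, y * t)) 0 v = _
    have e : (fun u => f.1 (x * u, y * t)) = fun u => g (u, t) := rfl
    rw [e]
    have h1 : HasFDerivAt (fun u : N₁ => g (u, t))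
        ((fderiv ℝ g (0, t)).comp (ContinuousLinearMap.inl ℝ N₁ N₂)) 0 :=
      HasFDerivAt.comp (g := g) (0 : N₁) (hgd (0, t)).hasFDerivAt (hasFDerivAt_prodMk_left (0 : N₁) t)
    rw [h1.fderiv]
    simp
  have e3 : (leftField ((v, 0) : N₁ × N₂) (leftField ((0, w) : N₁ × N₂) f)).1 (x, y) =
      fderiv ℝ (fderiv ℝ g) 0 (v, 0) (0, w) := by
    rw [hL _ x y]
    change fderiv ℝ (fun u => (leftField ((0, w) : N₁ × N₂) f).1 (x * u, y)) 0 v = _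
    simp only [e1]
    have h1 : HasFDerivAt (fun u : N₁ => fderiv ℝ g (u, 0))
        ((fderiv ℝ (fderiv ℝ g) 0).comp (ContinuousLinearMap.inl ℝ N₁ N₂)) 0 :=
      (hg'd 0).hasFDerivAt.comp (0 : N₁) (hasFDerivAt_prodMk_left 0 0)
    rw [(h1.clm_apply (hasFDerivAt_const _ _)).fderiv]
    simp
  have e4 : (leftField ((0, w) : N₁ × N₂) (leftField ((v, 0) : N₁ × N₂) f)).1 (x, y) =
      fderiv ℝ (fderiv ℝ g) 0 (0, w) (v, 0) := by
    rw [hR _ x y]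
    change fderiv ℝ (fun u => (leftField ((v, 0) : N₁ × N₂) f).1 (x, y * u)) 0 w = _
    simp only [e2]
    have h1 : HasFDerivAt (fun u : N₂ => fderiv ℝ g (0, u))
        ((fderiv ℝ (fderiv ℝ g) 0).comp (ContinuousLinearMap.inr ℝ N₁ N₂)) 0 :=
      (hg'd 0).hasFDerivAt.comp (0 : N₂) (hasFDerivAt_prodMk_right 0 0)
    rw [(h1.clm_apply (hasFDerivAt_const _ _)).fderiv]
    simp
  have hsymm : IsSymmSndFDerivAt ℝ g 0 :=
    hg.contDiffAt.isSymmSndFDerivAt (by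
      rw [minSmoothness_of_isRCLikeNormedField]
      exact WithTop.coe_le_coe.2 le_top)
  exact e3.trans ((hsymm (v, 0) (0, w)).trans e4.symm)

/-- Induction over both algebras from the case of vector fields. The lifts are kept general because
the lift of a sum or product is identified, by uniqueness, with that of lifts of its parts. -/
theorem IsLiftL.commute {A : Module.End ℂ (Smooth N₁)} {B : Module.End ℂ (Smooth N₂)}
    {A' B' : Module.End ℂ (Smooth (N₁ × N₂))} (hA : A ∈ diffOps N₁) (hB : B ∈ diffOps N₂)
    (hA' : IsLiftL A A') (hB' : IsLiftR B B') : Commute A' B' := by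
  induction hA using Algebra.adjoin_induction generalizing A' with
  | mem A hA =>
    obtain ⟨v, rfl⟩ := hA
    obtain rfl := hA'.unique (isLiftL_leftField v)
    induction hB using Algebra.adjoin_induction generalizing B' with
    | mem B hB =>
      obtain ⟨w, rfl⟩ := hB
      obtain rfl := hB'.unique (isLiftR_leftField w)
      exact commute_leftField v w
    | algebraMap c =>
      obtain rfl := hB'.unique (IsLiftR.scalar c)
      exact (Algebra.commutes c _).symm
    | add D E hD hE h₁ h₂ =>
      obtain ⟨D', -, hD'⟩ := exists_isLiftR (N₁ := N₁) hD
      obtain ⟨E', -, hE'⟩ := exists_isLiftR (N₁ := N₁) hE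
      obtain rfl := hB'.unique (hD'.add hE')
      exact (h₁ hD').add_right (h₂ hE')
    | mul D E hD hE h₁ h₂ =>
      obtain ⟨D', -, hD'⟩ := exists_isLiftR (N₁ := N₁) hD
      obtain ⟨E', -, hE'⟩ := exists_isLiftR (N₁ := N₁) hE
      obtain rfl := hB'.unique (hD'.mul hE')
      exact (h₁ hD').mul_right (h₂ hE')
  | algebraMap c =>
    obtain rfl := hA'.unique (IsLiftL.scalar c)
    exact Algebra.commutes c _
  | add D E hD hE h₁ h₂ =>
    obtain ⟨D', -, hD'⟩ := exists_isLiftL (N₂ := N₂) hD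
    obtain ⟨E', -, hE'⟩ := exists_isLiftL (N₂ := N₂) hE
    obtain rfl := hA'.unique (hD'.add hE')
    exact (h₁ hD').add_left (h₂ hE')
  | mul D E hD hE h₁ h₂ =>
    obtain ⟨D', -, hD'⟩ := exists_isLiftL (N₂ := N₂) hD
    obtain ⟨E', -, hE'⟩ := exists_isLiftL (N₂ := N₂) hE
    obtain rfl := hA'.unique (hD'.mul hE')
    exact (h₁ hD').mul_left (h₂ hE')

theorem commute_liftL_liftR (A : diffOps N₁) (B : diffOps N₂) :
    Commute (liftL N₂ A) (liftR N₁ B) :=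
  (isLiftL_liftL A).commute A.2 B.2 (isLiftR_liftR B)

end Lift

end GelfandPair

/-- The elements of the image of a bilinear map are finite sums over a basis of the second factor. -/
theorem LinearMap.exists_finsupp_of_mem_span {𝕜 X Y Z I : Type*} [Field 𝕜] [AddCommMonoid X]
    [Module 𝕜 X] [AddCommMonoid Y] [Module 𝕜 Y] [AddCommMonoid Z] [Module 𝕜 Z]
    (m : X →ₗ[𝕜] Y →ₗ[𝕜] Z) (β : Module.Basis I 𝕜 Y) {z : Z}
    (hz : z ∈ Submodule.span 𝕜 {z | ∃ x y, z = m x y}) :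
    ∃ c : I →₀ X, z = c.sum fun i x => m x (β i) := by
  classical
  induction hz using Submodule.span_induction with
  | mem z hz =>
    obtain ⟨x, y, rfl⟩ := hz
    refine ⟨(β.repr y).mapRange (fun a => a • x) (zero_smul _ _), ?_⟩
    rw [Finsupp.sum_mapRange_index (by simp)]
    conv_lhs => rw [← β.linearCombination_repr y, Finsupp.linearCombination_apply]
    simp [Finsupp.sum]
  | zero => exact ⟨0, by simp⟩
  | add z w _ _ hz hw =>
    obtain ⟨c, rfl⟩ := hz
    obtain ⟨d, rfl⟩ := hw
    exact ⟨c + d, (Finsupp.sum_add_index' (by simp) (by simp)).symm⟩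
  | smul a z _ hz =>
    obtain ⟨c, rfl⟩ := hz
    refine ⟨a • c, ?_⟩
    rw [Finsupp.sum_smul_index' (by simp), Finsupp.smul_sum]
    simp

/-! ### The invariant operators on the product -/

namespace GelfandPair

open NilpotentLieGroup

section Invariant

variable {N₁ N₂ : Type*} [NormedAddCommGroup N₁] [NormedSpace ℝ N₁]
  [NormedAddCommGroup N₂] [NormedSpace ℝ N₂] [NilpotentLieGroup N₁] [NilpotentLieGroup N₂]

theorem leftField_add {N : Type*} [NormedAddCommGroup N] [NormedSpace ℝ N] [NilpotentLieGroup N]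
    (v w : N) : leftField (v + w) = leftField v + leftField w := by
  refine LinearMap.ext fun f => ?_
  ext x
  exact map_add (fderiv ℝ (fun y => f.1 (x * y)) 0) v w

variable (N₁ N₂) in
/-- The bilinear map `(A, B) ↦ A ⊗ B` into the operators on `N₁ × N₂`. -/
noncomputable def liftMul : diffOps N₁ →ₗ[ℂ] diffOps N₂ →ₗ[ℂ] Module.End ℂ (Smooth (N₁ × N₂)) :=
  (LinearMap.mul ℂ _).compl₁₂ (liftL N₂ (N₁ := N₁)).toLinearMap (liftR N₁ (N₂ := N₂)).toLinearMap

theorem liftMul_apply (A : diffOps N₁) (B : diffOps N₂) :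
    liftMul N₁ N₂ A B = liftL N₂ A * liftR N₁ B := rfl

theorem liftMul_smoothTensor (A : diffOps N₁) (B : diffOps N₂) (f : Smooth N₁) (g : Smooth N₂) :
    liftMul N₁ N₂ A B (smoothTensor f g) = smoothTensor (A.1 f) (B.1 g) := by
  rw [liftMul_apply, Module.End.mul_apply, (isLiftR_liftR B).apply_smoothTensor,
    (isLiftL_liftL A).apply_smoothTensor]

/-- A vector field on the product is a sum of lifted ones, and the span of the products `A ⊗ B` is
closed under multiplication because lifts from different factors commute. -/
theorem diffOps_prod_le {D : Module.End ℂ (Smooth (N₁ × N₂))} (hD : D ∈ diffOps (N₁ × N₂)) :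
    D ∈ Submodule.span ℂ {T | ∃ A B, T = liftMul N₁ N₂ A B} := by
  induction hD using Algebra.adjoin_induction with
  | mem D hD =>
    obtain ⟨v, rfl⟩ := hD
    have e : v = (v.1, 0) + (0, v.2) := by simp
    rw [e, leftField_add]
    refine add_mem (Submodule.subset_span ⟨⟨_, leftField_mem v.1⟩, 1, ?_⟩)
      (Submodule.subset_span ⟨1, ⟨_, leftField_mem v.2⟩, ?_⟩)
    · rw [liftMul_apply, map_one, mul_one]
      exact (isLiftL_leftField v.1).unique (isLiftL_liftL _)
    · rw [liftMul_apply, map_one, one_mul]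
      exact (isLiftR_leftField v.2).unique (isLiftR_liftR _)
  | algebraMap c =>
    refine Submodule.subset_span ⟨algebraMap ℂ _ c, 1, ?_⟩
    rw [liftMul_apply, map_one, mul_one, AlgHom.commutes]
  | add D E _ _ h₁ h₂ => exact add_mem h₁ h₂
  | mul D E hD hE h₁ h₂ =>
    clear hD hE
    induction h₁, h₂ using Submodule.span_induction₂ with
    | mem_mem D E hD hE =>
      obtain ⟨A, B, rfl⟩ := hD
      obtain ⟨A', B', rfl⟩ := hE
      refine Submodule.subset_span ⟨A * A', B * B', ?_⟩
      simp only [liftMul_apply, map_mul]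
      rw [mul_assoc, mul_assoc, ← mul_assoc (liftR N₁ B), ← (commute_liftL_liftR A' B).eq,
        mul_assoc]
    | zero_left => simp
    | zero_right => simp
    | add_left D D' E _ _ _ h h' => rw [add_mul]; exact add_mem h h'
    | add_right D E E' _ _ _ h h' => rw [mul_add]; exact add_mem h h'
    | smul_left a D E _ _ h => rw [smul_mul_assoc]; exact Submodule.smul_mem _ _ h
    | smul_right a D E _ _ h => rw [mul_smul_comm]; exact Submodule.smul_mem _ _ h

variable {K₁ K₂ : Type*}
  [Group K₁] [TopologicalSpace K₁] [MulDistribMulAction K₁ N₁] [ContinuousSMul K₁ N₁]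
  [Group K₂] [TopologicalSpace K₂] [MulDistribMulAction K₂ N₂] [ContinuousSMul K₂ N₂]

theorem mem_invDiffOps {N K : Type*} [NormedAddCommGroup N] [NormedSpace ℝ N]
    [NilpotentLieGroup N] [Group K] [TopologicalSpace K] [MulDistribMulAction K N]
    [ContinuousSMul K N] {D : Module.End ℂ (Smooth N)} :
    D ∈ invDiffOps N K ↔ D ∈ diffOps N ∧ ∀ (k : K) f, D (pullback N k f) = pullback N k (D f) := by
  refine and_congr_right fun _ => ?_
  change _ ∈ Subalgebra.centralizer _ _ ↔ _
  rw [Subalgebra.mem_centralizer_iff, Set.forall_mem_range]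
  exact forall_congr' fun k => ⟨fun h f => (LinearMap.congr_fun h f).symm,
    fun h => LinearMap.ext fun f => (h f).symm⟩

theorem IsLiftL.mem_diffOps {A : Module.End ℂ (Smooth N₁)} {A' : Module.End ℂ (Smooth (N₁ × N₂))}
    (h : IsLiftL A A') (hA : A ∈ diffOps N₁) : A' ∈ diffOps (N₁ × N₂) := by
  rw [h.unique (isLiftL_liftL ⟨A, hA⟩)]
  exact liftL_mem _

theorem IsLiftR.mem_diffOps {A : Module.End ℂ (Smooth N₂)} {A' : Module.End ℂ (Smooth (N₁ × N₂))}
    (h : IsLiftR A A') (hA : A ∈ diffOps N₂) : A' ∈ diffOps (N₁ × N₂) := by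
  rw [h.unique (isLiftR_liftR ⟨A, hA⟩)]
  exact liftR_mem _

theorem IsLiftL.mem_invDiffOps {A : Module.End ℂ (Smooth N₁)}
    {A' : Module.End ℂ (Smooth (N₁ × N₂))} (h : IsLiftL A A') (hA : A ∈ invDiffOps N₁ K₁) :
    A' ∈ invDiffOps (N₁ × N₂) (K₁ × K₂) := by
  obtain ⟨hA, hk⟩ := GelfandPair.mem_invDiffOps.1 hA
  refine GelfandPair.mem_invDiffOps.2 ⟨h.mem_diffOps hA, fun k f => ?_⟩
  ext ⟨x, y⟩
  have h1 := h (pullback _ k f) x y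
  have e : sliceL (pullback (N₁ × N₂) k f) y = pullback N₁ k.1 (sliceL f (k.2 • y)) := rfl
  rw [e, hk] at h1
  exact h1.trans (h f (k.1 • x) (k.2 • y)).symm

theorem IsLiftR.mem_invDiffOps {A : Module.End ℂ (Smooth N₂)}
    {A' : Module.End ℂ (Smooth (N₁ × N₂))} (h : IsLiftR A A') (hA : A ∈ invDiffOps N₂ K₂) :
    A' ∈ invDiffOps (N₁ × N₂) (K₁ × K₂) := by
  obtain ⟨hA, hk⟩ := GelfandPair.mem_invDiffOps.1 hA
  refine GelfandPair.mem_invDiffOps.2 ⟨h.mem_diffOps hA, fun k f => ?_⟩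
  ext ⟨x, y⟩
  have h1 := h (pullback _ k f) x y
  have e : sliceR (pullback (N₁ × N₂) k f) x = pullback N₂ k.2 (sliceR f (k.1 • x)) := rfl
  rw [e, hk] at h1
  exact h1.trans (h f (k.1 • x) (k.2 • y)).symm

theorem pullback_smoothTensor (k : K₁ × K₂) (f : Smooth N₁) (g : Smooth N₂) :
    pullback (N₁ × N₂) k (smoothTensor f g) =
      smoothTensor (pullback N₁ k.1 f) (pullback N₂ k.2 g) := rfl

/-- Invariance under `(k, 1)`, tested on `f ⊗ g` at a fixed `x`, is a linear relation between the
operators `β i` applied to the arbitrary function `g`; linear independence identifies the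
coefficients. -/
theorem invariant_left_of_sum {I : Type*} {β : I → diffOps N₂} (hβ : LinearIndependent ℂ β)
    (c : I →₀ diffOps N₁)
    (hD : (c.sum fun i x => liftMul N₁ N₂ x (β i)) ∈ invDiffOps (N₁ × N₂) (K₁ × K₂)) (i : I) :
    (c i).1 ∈ invDiffOps N₁ K₁ := by
  refine mem_invDiffOps.2 ⟨(c i).2, fun k f => ?_⟩
  ext x
  have hβ' : LinearIndependent ℂ fun i => (β i).1 :=
    hβ.map_injOn (Subalgebra.val (diffOps N₂)).toLinearMap Subtype.val_injective.injOn
  have key : ∑ i ∈ c.support, ((c i).1 (pullback N₁ k f)).1 x • (β i).1 =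
      ∑ i ∈ c.support, (pullback N₁ k ((c i).1 f)).1 x • (β i).1 := by
    refine LinearMap.ext fun g => ?_
    ext y
    have h1 := (mem_invDiffOps.1 hD).2 (k, 1) (smoothTensor f g)
    have e : pullback N₂ (1 : K₂) g = g := by
      ext y
      exact congrArg g.1 (one_smul K₂ y)
    rw [pullback_smoothTensor, e] at h1
    simp only [Finsupp.sum, LinearMap.sum_apply, liftMul_smoothTensor, map_sum] at h1
    have h2 := congrArg (fun F : Smooth (N₁ × N₂) => F.1 (x, y)) h1
    have e2 : ∀ F, (pullback N₂ (1 : K₂) F).1 y = F.1 y := fun F =>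
      congrArg F.1 (one_smul K₂ y)
    simp only [pullback_smoothTensor, AddSubmonoidClass.coe_finsetSum, Finset.sum_apply,
      smoothTensor_coe, e2] at h2
    simp only [LinearMap.sum_apply, LinearMap.smul_apply, AddSubmonoidClass.coe_finsetSum,
      Finset.sum_apply, Submodule.coe_smul, Pi.smul_apply, smul_eq_mul, h2]
  by_cases hi : i ∈ c.support
  · exact linearIndependent_iff'ₛ.1 hβ' _ _ _ key i hi
  · rw [Finsupp.notMem_support_iff.1 hi]
    rfl

theorem invariant_right_of_sum {I : Type*} {β : I → diffOps N₁} (hβ : LinearIndependent ℂ β)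
    (c : I →₀ diffOps N₂)
    (hD : (c.sum fun i y => liftMul N₁ N₂ (β i) y) ∈ invDiffOps (N₁ × N₂) (K₁ × K₂)) (i : I) :
    (c i).1 ∈ invDiffOps N₂ K₂ := by
  refine mem_invDiffOps.2 ⟨(c i).2, fun k g => ?_⟩
  ext y
  have hβ' : LinearIndependent ℂ fun i => (β i).1 :=
    hβ.map_injOn (Subalgebra.val (diffOps N₁)).toLinearMap Subtype.val_injective.injOn
  have key : ∑ i ∈ c.support, ((c i).1 (pullback N₂ k g)).1 y • (β i).1 =
      ∑ i ∈ c.support, (pullback N₂ k ((c i).1 g)).1 y • (β i).1 := by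
    refine LinearMap.ext fun f => ?_
    ext x
    have h1 := (mem_invDiffOps.1 hD).2 (1, k) (smoothTensor f g)
    have e : pullback N₁ (1 : K₁) f = f := by
      ext x
      exact congrArg f.1 (one_smul K₁ x)
    rw [pullback_smoothTensor, e] at h1
    simp only [Finsupp.sum, LinearMap.sum_apply, liftMul_smoothTensor, map_sum] at h1
    have h2 := congrArg (fun F : Smooth (N₁ × N₂) => F.1 (x, y)) h1
    have e2 : ∀ F, (pullback N₁ (1 : K₁) F).1 x = F.1 x := fun F =>
      congrArg F.1 (one_smul K₁ x)
    simp only [pullback_smoothTensor, AddSubmonoidClass.coe_finsetSum, Finset.sum_apply,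
      smoothTensor_coe, e2] at h2
    simp only [LinearMap.sum_apply, LinearMap.smul_apply, AddSubmonoidClass.coe_finsetSum,
      Finset.sum_apply, Submodule.coe_smul, Pi.smul_apply, smul_eq_mul,
      mul_comm _ (((β _).1 f).1 x), h2]
  by_cases hi : i ∈ c.support
  · exact linearIndependent_iff'ₛ.1 hβ' _ _ _ key i hi
  · rw [Finsupp.notMem_support_iff.1 hi]
    rfl

/-- `𝔻(N₁ × N₂)^(K₁ × K₂)` is spanned by the products of lifts of invariant operators. -/
theorem invDiffOps_prod_le {D : Module.End ℂ (Smooth (N₁ × N₂))}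
    (hD : D ∈ invDiffOps (N₁ × N₂) (K₁ × K₂)) :
    D ∈ Submodule.span ℂ {T | ∃ A B, A.1 ∈ invDiffOps N₁ K₁ ∧ B.1 ∈ invDiffOps N₂ K₂ ∧
      T = liftMul N₁ N₂ A B} := by
  let _ : AddCommGroup (diffOps N₂) := Module.addCommMonoidToAddCommGroup ℂ
  -- A basis on the right makes the coefficients on the left invariant under `K₁`. The sum is then
  -- re-expanded over a basis of the invariant operators on the left, which makes the new
  -- coefficients on the right invariant under `K₂` without losing what was gained.
  let β := Module.Basis.ofVectorSpace ℂ (diffOps N₂)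
  obtain ⟨c, rfl⟩ := LinearMap.exists_finsupp_of_mem_span (liftMul N₁ N₂) β
    (diffOps_prod_le hD.1)
  have hc := invariant_left_of_sum β.linearIndependent c hD
  let V : Submodule ℂ (diffOps N₁) :=
    (Subalgebra.toSubmodule (invDiffOps N₁ K₁)).comap (Subalgebra.val (diffOps N₁)).toLinearMap
  let m := ((liftMul N₁ N₂).comp V.subtype).flip
  have hm : (c.sum fun i x => liftMul N₁ N₂ x (β i)) ∈ Submodule.span ℂ {z | ∃ x y, z = m x y} :=
    Submodule.sum_mem _ fun i _ => Submodule.subset_span ⟨β i, ⟨c i, hc i⟩, rfl⟩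
  let _ : AddCommGroup V := Module.addCommMonoidToAddCommGroup ℂ
  let γ := Module.Basis.ofVectorSpace ℂ V
  obtain ⟨d, hd⟩ := LinearMap.exists_finsupp_of_mem_span m γ hm
  rw [hd] at hD ⊢
  have hd' := invariant_right_of_sum (β := fun i => (γ i).1)
    (γ.linearIndependent.map_injOn V.subtype Subtype.val_injective.injOn) d hD
  exact Submodule.sum_mem _ fun i _ => Submodule.subset_span ⟨(γ i).1, d i, (γ i).2, hd' i, rfl⟩

/-- By bilinearity only products `A ⊗ B` matter; their factors commute within each side by
hypothesis and across sides always. -/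
theorem isNilpotentGelfandPair_prod (h₁ : IsNilpotentGelfandPair N₁ K₁)
    (h₂ : IsNilpotentGelfandPair N₂ K₂) : IsNilpotentGelfandPair (N₁ × N₂) (K₁ × K₂) := by
  intro D hD E hE
  have hD' := invDiffOps_prod_le hD
  have hE' := invDiffOps_prod_le hE
  clear hD hE
  induction hD', hE' using Submodule.span_induction₂ with
  | mem_mem D E hD hE =>
    obtain ⟨A, B, hA, hB, rfl⟩ := hD
    obtain ⟨A', B', hA', hB', rfl⟩ := hE
    have c1 : Commute A A' := Subtype.ext (h₁ _ hA _ hA')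
    have c2 : Commute B B' := Subtype.ext (h₂ _ hB _ hB')
    have := ((c1.map (liftL N₂)).mul_left (commute_liftL_liftR A' B).symm).mul_right
      ((commute_liftL_liftR A B').mul_left (c2.map (liftR N₁)))
    exact this
  | zero_left => simp
  | zero_right => simp
  | add_left D D' E _ _ _ h h' => rw [add_mul, mul_add, h, h']
  | add_right D E E' _ _ _ h h' => rw [add_mul, mul_add, h, h']
  | smul_left a D E _ _ h => rw [smul_mul_assoc, mul_smul_comm, h]
  | smul_right a D E _ _ h => rw [smul_mul_assoc, mul_smul_comm, h]

/-- By uniqueness, the lift of a polynomial in operators is the same polynomial in their lifts. -/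
theorem liftL_mem_adjoin {S : Set (Module.End ℂ (Smooth N₁))}
    {T : Set (Module.End ℂ (Smooth (N₁ × N₂)))} (hS : S ⊆ diffOps N₁)
    (hT : ∀ A ∈ S, ∃ A' ∈ T, IsLiftL A A') {A : Module.End ℂ (Smooth N₁)}
    {A' : Module.End ℂ (Smooth (N₁ × N₂))}
    (hA : A ∈ Algebra.adjoin ℂ S) (h : IsLiftL A A') : A' ∈ Algebra.adjoin ℂ T := by
  have hle : Algebra.adjoin ℂ S ≤ diffOps N₁ := Algebra.adjoin_le hS
  induction hA using Algebra.adjoin_induction generalizing A' with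
  | mem A hA =>
    obtain ⟨B, hB, hl⟩ := hT A hA
    rw [h.unique hl]
    exact Algebra.subset_adjoin hB
  | algebraMap c =>
    rw [h.unique (IsLiftL.scalar c)]
    exact Subalgebra.algebraMap_mem _ c
  | add D E hD hE h₁ h₂ =>
    have hD' := isLiftL_liftL (N₂ := N₂) ⟨D, hle hD⟩
    have hE' := isLiftL_liftL (N₂ := N₂) ⟨E, hle hE⟩
    rw [h.unique (hD'.add hE')]
    exact add_mem (h₁ hD') (h₂ hE')
  | mul D E hD hE h₁ h₂ =>
    have hD' := isLiftL_liftL (N₂ := N₂) ⟨D, hle hD⟩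
    have hE' := isLiftL_liftL (N₂ := N₂) ⟨E, hle hE⟩
    rw [h.unique (hD'.mul hE')]
    exact mul_mem (h₁ hD') (h₂ hE')

theorem liftR_mem_adjoin {S : Set (Module.End ℂ (Smooth N₂))}
    {T : Set (Module.End ℂ (Smooth (N₁ × N₂)))} (hS : S ⊆ diffOps N₂)
    (hT : ∀ A ∈ S, ∃ A' ∈ T, IsLiftR A A') {A : Module.End ℂ (Smooth N₂)}
    {A' : Module.End ℂ (Smooth (N₁ × N₂))}
    (hA : A ∈ Algebra.adjoin ℂ S) (h : IsLiftR A A') : A' ∈ Algebra.adjoin ℂ T := by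
  have hle : Algebra.adjoin ℂ S ≤ diffOps N₂ := Algebra.adjoin_le hS
  induction hA using Algebra.adjoin_induction generalizing A' with
  | mem A hA =>
    obtain ⟨B, hB, hl⟩ := hT A hA
    rw [h.unique hl]
    exact Algebra.subset_adjoin hB
  | algebraMap c =>
    rw [h.unique (IsLiftR.scalar c)]
    exact Subalgebra.algebraMap_mem _ c
  | add D E hD hE h₁ h₂ =>
    have hD' := isLiftR_liftR (N₁ := N₁) ⟨D, hle hD⟩
    have hE' := isLiftR_liftR (N₁ := N₁) ⟨E, hle hE⟩
    rw [h.unique (hD'.add hE')]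
    exact add_mem (h₁ hD') (h₂ hE')
  | mul D E hD hE h₁ h₂ =>
    have hD' := isLiftR_liftR (N₁ := N₁) ⟨D, hle hD⟩
    have hE' := isLiftR_liftR (N₁ := N₁) ⟨E, hle hE⟩
    rw [h.unique (hD'.mul hE')]
    exact mul_mem (h₁ hD') (h₂ hE')

/-- Lifts of generators of the factors generate the invariant operators on the product. -/
theorem adjoin_lift_eq {d₁ d₂ : ℕ} {D₁ : Fin d₁ → Module.End ℂ (Smooth N₁)}
    {D₂ : Fin d₂ → Module.End ℂ (Smooth N₂)}
    (h₁ : Algebra.adjoin ℂ (Set.range D₁) = invDiffOps N₁ K₁)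
    (h₂ : Algebra.adjoin ℂ (Set.range D₂) = invDiffOps N₂ K₂)
    {D : Fin (d₁ + d₂) → Module.End ℂ (Smooth (N₁ × N₂))}
    (hL : ∀ j, IsLiftL (D₁ j) (D (Fin.castAdd d₂ j)))
    (hR : ∀ j, IsLiftR (D₂ j) (D (Fin.natAdd d₁ j))) :
    Algebra.adjoin ℂ (Set.range D) = invDiffOps (N₁ × N₂) (K₁ × K₂) := by
  have m₁ : ∀ j, D₁ j ∈ invDiffOps N₁ K₁ := fun j => h₁ ▸ Algebra.subset_adjoin ⟨j, rfl⟩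
  have m₂ : ∀ j, D₂ j ∈ invDiffOps N₂ K₂ := fun j => h₂ ▸ Algebra.subset_adjoin ⟨j, rfl⟩
  refine le_antisymm (Algebra.adjoin_le ?_) fun T hT => ?_
  · rintro _ ⟨j, rfl⟩
    induction j using Fin.addCases with
    | left j => exact (hL j).mem_invDiffOps (m₁ j)
    | right j => exact (hR j).mem_invDiffOps (m₂ j)
  · refine (Submodule.span_le (p := Subalgebra.toSubmodule (Algebra.adjoin ℂ (Set.range D)))).2
      ?_ (invDiffOps_prod_le hT)
    rintro _ ⟨A, B, hA, hB, rfl⟩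
    refine mul_mem (S := Subalgebra ℂ (Module.End ℂ (Smooth (N₁ × N₂)))) (liftL_mem_adjoin (S := Set.range D₁) ?_ ?_ (h₁ ▸ hA) (isLiftL_liftL A))
      (liftR_mem_adjoin (S := Set.range D₂) ?_ ?_ (h₂ ▸ hB) (isLiftR_liftR B))
    · rintro _ ⟨j, rfl⟩
      exact (m₁ j).1
    · rintro _ ⟨j, rfl⟩
      exact ⟨_, ⟨_, rfl⟩, hL j⟩
    · rintro _ ⟨j, rfl⟩
      exact (m₂ j).1
    · rintro _ ⟨j, rfl⟩
      exact ⟨_, ⟨_, rfl⟩, hR j⟩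

end Invariant

end GelfandPair

/-! ### Integration on the product: self-adjointness and spherical transforms -/

namespace GelfandPair

open NilpotentLieGroup

theorem inv_eq_neg {N : Type*} [NormedAddCommGroup N] [NormedSpace ℝ N] [NilpotentLieGroup N]
    (x : N) : x⁻¹ = -x := by
  have h := smul_mul_smul_self (1 : ℝ) (-1) x
  rw [one_smul, neg_one_smul, add_neg_cancel, zero_smul, zero_eq_one] at h
  exact inv_eq_of_mul_eq_one_right h

theorem continuous_smooth {N : Type*} [NormedAddCommGroup N] [NormedSpace ℝ N] (f : Smooth N) :
    Continuous f.1 := ContDiff.continuous (𝕜 := ℝ) (n := ∞) f.2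

section Slice

variable {N₁ N₂ : Type*} [NormedAddCommGroup N₁] [NormedSpace ℝ N₁]
  [NormedAddCommGroup N₂] [NormedSpace ℝ N₂]

theorem hasCompactSupport_sliceL {f : Smooth (N₁ × N₂)} (hf : HasCompactSupport f.1) (y : N₂) :
    HasCompactSupport (sliceL f y).1 := by
  refine HasCompactSupport.of_support_subset_isCompact (hf.image continuous_fst) fun x hx => ?_
  exact ⟨(x, y), subset_tsupport _ hx, rfl⟩

theorem hasCompactSupport_sliceR {f : Smooth (N₁ × N₂)} (hf : HasCompactSupport f.1) (x : N₁) :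
    HasCompactSupport (sliceR f x).1 := by
  refine HasCompactSupport.of_support_subset_isCompact (hf.image continuous_snd) fun y hy => ?_
  exact ⟨(x, y), subset_tsupport _ hy, rfl⟩

end Slice

section Transform

variable {N : Type*} [NormedAddCommGroup N] [NormedSpace ℝ N] [FiniteDimensional ℝ N]
  [MeasurableSpace N] [BorelSpace N] [NilpotentLieGroup N]

theorem integrable_sphericalTransform (F : 𝓢(N, ℂ)) {φ : N → ℂ} (hφ : Continuous φ)
    (hb : ∃ C : ℝ, ∀ x, ‖φ x‖ ≤ C) :
    Integrable (fun x => F x * φ x⁻¹) (Measure.addHaar : Measure N) := by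
  obtain ⟨C, hC⟩ := hb
  have hm : AEStronglyMeasurable (fun x : N => φ x⁻¹) (Measure.addHaar : Measure N) := by
    simp only [inv_eq_neg]
    exact (hφ.comp continuous_neg).aestronglyMeasurable
  exact F.integrable.mul_bdd hm (Eventually.of_forall fun x => hC x⁻¹)

/-- Boundedness of `φ` reduces continuity to that of the embedding of the Schwartz space into `L¹`.
-/
theorem exists_transformCLM {φ : N → ℂ} (hφ : Continuous φ) (hb : ∃ C : ℝ, ∀ x, ‖φ x‖ ≤ C) :
    ∃ L : 𝓢(N, ℂ) →L[ℂ] ℂ, ∀ F : 𝓢(N, ℂ), L F = sphericalTransform F φ := by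
  let μ : Measure N := Measure.addHaar
  have hint : ∀ F : 𝓢(N, ℂ), Integrable (fun x => F x * φ x⁻¹) μ := fun F =>
    integrable_sphericalTransform F hφ hb
  obtain ⟨C, hC⟩ := hb
  let L : 𝓢(N, ℂ) →ₗ[ℂ] ℂ :=
    { toFun := fun F => sphericalTransform F φ
      map_add' := fun F G => by
        simp only [sphericalTransform, add_apply, add_mul]
        exact integral_add (hint F) (hint G)
      map_smul' := fun c F => by
        simp only [sphericalTransform, smul_apply, smul_eq_mul, mul_assoc]
        exact integral_const_mul _ _ }
  refine ⟨⟨L, continuous_of_continuousAt_zero L ?_⟩, fun F => rfl⟩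
  have hle : ∀ F : 𝓢(N, ℂ), ‖L F‖ ≤ ‖SchwartzMap.toLpCLM ℂ ℂ 1 μ F‖ * C := fun F => by
    rw [SchwartzMap.toLpCLM_apply, SchwartzMap.norm_toLp_one, ← integral_mul_const]
    refine norm_integral_le_of_norm_le (F.integrable.norm.mul_const C)
      (Eventually.of_forall fun x => ?_)
    rw [norm_mul]
    exact mul_le_mul_of_nonneg_left (hC _) (norm_nonneg _)
  have h0 : Tendsto (fun F : 𝓢(N, ℂ) => ‖SchwartzMap.toLpCLM ℂ ℂ 1 μ F‖ * C) (𝓝 0) (𝓝 0) := by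
    have : Continuous fun F : 𝓢(N, ℂ) => ‖SchwartzMap.toLpCLM ℂ ℂ 1 μ F‖ * C := by fun_prop
    have h := this.tendsto 0
    rwa [map_zero, norm_zero, zero_mul] at h
  have := squeeze_zero_norm hle h0
  simpa [ContinuousAt] using this

end Transform

section Product

variable {N₁ N₂ : Type*}
    [NormedAddCommGroup N₁] [NormedSpace ℝ N₁] [FiniteDimensional ℝ N₁]
    [MeasurableSpace N₁] [BorelSpace N₁]
    [NormedAddCommGroup N₂] [NormedSpace ℝ N₂] [FiniteDimensional ℝ N₂]
    [MeasurableSpace N₂] [BorelSpace N₂]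

variable (N₁ N₂) in
-- The chosen Haar measure of the product need not be the product of the chosen ones. The constant
-- enters every formula for the transform and is finally absorbed into the isomorphism.
theorem exists_addHaar_prod : ∃ c : ℝ, 0 < c ∧ ∀ f : N₁ × N₂ → ℂ,
    ∫ z, f z ∂(Measure.addHaar : Measure (N₁ × N₂)) =
      c * ∫ z, f z ∂((Measure.addHaar : Measure N₁).prod (Measure.addHaar : Measure N₂)) := by
  let μ : Measure (N₁ × N₂) := Measure.addHaar
  let ν : Measure (N₁ × N₂) := (Measure.addHaar : Measure N₁).prod (Measure.addHaar : Measure N₂)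
  refine ⟨(μ.addHaarScalarFactor ν : ℝ), ?_, fun f => ?_⟩
  · exact_mod_cast Measure.addHaarScalarFactor_pos_of_isAddHaarMeasure μ ν
  · have h : μ = μ.addHaarScalarFactor ν • ν := Measure.isAddLeftInvariant_eq_smul μ ν
    have h2 : ∫ z, f z ∂μ = ∫ z, f z ∂(μ.addHaarScalarFactor ν • ν) := congrArg (fun m => ∫ z, f z ∂m) h
    exact h2.trans (integral_smul_nnreal_measure f _)

/-- Fubini: the symmetry of `A` is applied on each slice, where the functions are again compactly
supported. -/
theorem IsLiftL.formallySelfAdjoint {A : Module.End ℂ (Smooth N₁)}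
    {A' : Module.End ℂ (Smooth (N₁ × N₂))} (h : IsLiftL A A') (hA : FormallySelfAdjoint A) :
    FormallySelfAdjoint A' := by
  obtain ⟨c, -, hc⟩ := exists_addHaar_prod N₁ N₂
  intro f g hf hg
  have i1 : Continuous fun z => (A' f).1 z * (starRingEnd ℂ) (g.1 z) :=
    (continuous_smooth (A' f)).mul (Complex.continuous_conj.comp (continuous_smooth g))
  have i2 : Continuous fun z => f.1 z * (starRingEnd ℂ) ((A' g).1 z) :=
    (continuous_smooth f).mul (Complex.continuous_conj.comp (continuous_smooth (A' g)))
  have s1 : HasCompactSupport fun z => (A' f).1 z * (starRingEnd ℂ) (g.1 z) :=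
    HasCompactSupport.mul_left (hg.comp_left (map_zero _))
  have s2 : HasCompactSupport fun z => f.1 z * (starRingEnd ℂ) ((A' g).1 z) := hf.mul_right
  rw [hc, hc, integral_prod_symm _ (i1.integrable_of_hasCompactSupport s1),
    integral_prod_symm _ (i2.integrable_of_hasCompactSupport s2)]
  congr 2
  ext y
  simp only [h f, h g]
  exact hA _ _ (hasCompactSupport_sliceL hf y) (hasCompactSupport_sliceL hg y)

theorem IsLiftR.formallySelfAdjoint {A : Module.End ℂ (Smooth N₂)}
    {A' : Module.End ℂ (Smooth (N₁ × N₂))} (h : IsLiftR A A') (hA : FormallySelfAdjoint A) :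
    FormallySelfAdjoint A' := by
  obtain ⟨c, -, hc⟩ := exists_addHaar_prod N₁ N₂
  intro f g hf hg
  have i1 : Continuous fun z => (A' f).1 z * (starRingEnd ℂ) (g.1 z) :=
    (continuous_smooth (A' f)).mul (Complex.continuous_conj.comp (continuous_smooth g))
  have i2 : Continuous fun z => f.1 z * (starRingEnd ℂ) ((A' g).1 z) :=
    (continuous_smooth f).mul (Complex.continuous_conj.comp (continuous_smooth (A' g)))
  have s1 : HasCompactSupport fun z => (A' f).1 z * (starRingEnd ℂ) (g.1 z) :=
    HasCompactSupport.mul_left (hg.comp_left (map_zero _))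
  have s2 : HasCompactSupport fun z => f.1 z * (starRingEnd ℂ) ((A' g).1 z) := hf.mul_right
  rw [hc, hc, integral_prod _ (i1.integrable_of_hasCompactSupport s1),
    integral_prod _ (i2.integrable_of_hasCompactSupport s2)]
  congr 2
  ext x
  simp only [h f, h g]
  exact hA _ _ (hasCompactSupport_sliceR hf x) (hasCompactSupport_sliceR hg x)

variable [NilpotentLieGroup N₁] [NilpotentLieGroup N₂]

variable (N₁ N₂) in
theorem exists_sphericalTransform_tensor : ∃ c : ℝ, 0 < c ∧
    ∀ (F₁ φ₁ : N₁ → ℂ) (F₂ φ₂ : N₂ → ℂ),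
      sphericalTransform (fun z : N₁ × N₂ => F₁ z.1 * F₂ z.2) (fun z => φ₁ z.1 * φ₂ z.2) =
        c * (sphericalTransform F₁ φ₁ * sphericalTransform F₂ φ₂) := by
  obtain ⟨c, hc, h⟩ := exists_addHaar_prod N₁ N₂
  refine ⟨c, hc, fun F₁ φ₁ F₂ φ₂ => ?_⟩
  rw [sphericalTransform, h, sphericalTransform, sphericalTransform, ← integral_prod_mul]
  congr 2
  ext z
  simp only [Prod.fst_inv, Prod.snd_inv]
  ring

end Product

end GelfandPair

/-! ### Bounded spherical functions under property (S) -/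

namespace GelfandPair

open NilpotentLieGroup

section Spherical

variable {N K : Type*} [NormedAddCommGroup N] [NormedSpace ℝ N] [NilpotentLieGroup N]
  [Group K] [TopologicalSpace K] [MulDistribMulAction K N] [ContinuousSMul K N]

theorem eigenvalue_eq {φ ψ : Smooth N} (h1 : φ.1 1 = 1) {a b : ℂ} (ha : ψ = a • φ)
    (hb : ψ = b • φ) : a = b := by
  have h := congrArg (fun f : Smooth N => f.1 1) (ha.symm.trans hb)
  simpa [h1] using h

theorem IsEigenvalueTuple.unique {d : ℕ} {D : Fin d → Module.End ℂ (Smooth N)} {φ : Smooth N}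
    (h1 : φ.1 1 = 1) {ξ ξ' : EuclideanSpace ℝ (Fin d)} (h : IsEigenvalueTuple D φ ξ)
    (h' : IsEigenvalueTuple D φ ξ') : ξ = ξ' := by
  ext j
  exact_mod_cast eigenvalue_eq h1 (h j) (h' j)

/-- A function with the eigenvalue tuple of `φ` is an eigenfunction of every operator generated by
the given ones, with the eigenvalue of `φ`. -/
theorem IsEigenvalueTuple.exists_eigenvalue {d : ℕ} {D : Fin d → Module.End ℂ (Smooth N)}
    {φ ψ : Smooth N} {ξ : EuclideanSpace ℝ (Fin d)} (h : IsEigenvalueTuple D φ ξ)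
    (h' : IsEigenvalueTuple D ψ ξ) {X : Module.End ℂ (Smooth N)}
    (hX : X ∈ Algebra.adjoin ℂ (Set.range D)) : ∃ c : ℂ, X φ = c • φ ∧ X ψ = c • ψ := by
  induction hX using Algebra.adjoin_induction with
  | mem X hX =>
    obtain ⟨j, rfl⟩ := hX
    exact ⟨_, h j, h' j⟩
  | algebraMap c => exact ⟨c, rfl, rfl⟩
  | add X Y _ _ hX hY =>
    obtain ⟨a, ha, ha'⟩ := hX
    obtain ⟨b, hb, hb'⟩ := hY
    exact ⟨a + b, by rw [LinearMap.add_apply, ha, hb, add_smul],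
      by rw [LinearMap.add_apply, ha', hb', add_smul]⟩
  | mul X Y _ _ hX hY =>
    obtain ⟨a, ha, ha'⟩ := hX
    obtain ⟨b, hb, hb'⟩ := hY
    exact ⟨b * a, by rw [Module.End.mul_apply, hb, map_smul, ha, smul_smul],
      by rw [Module.End.mul_apply, hb', map_smul, ha', smul_smul]⟩

theorem contDiff_conj_inv (u : Smooth N) :
    ContDiff ℝ ∞ fun x : N => (starRingEnd ℂ) (u.1 x⁻¹) := by
  have hu : ContDiff ℝ ∞ u.1 := u.2
  simp only [inv_eq_neg]
  exact Complex.conjCLE.contDiff.comp (hu.comp contDiff_neg)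

variable [FiniteDimensional ℝ N] [MeasurableSpace N] [BorelSpace N]

/-- The spherical transforms of the invariant Schwartz functions are given by `T`. -/
def IsTransform {d : ℕ} {D : Fin d → Module.End ℂ (Smooth N)}
    (T : InvSchwartz N K ≃L[ℂ] SchwartzOn (spectrumSet K D)) : Prop :=
  ∀ (F : InvSchwartz N K) (f : 𝓢(EuclideanSpace ℝ (Fin d), ℂ)),
    T F = Submodule.Quotient.mk f →
      ∀ φ : Smooth N, IsBoundedSpherical K φ →
        ∃ ξ, IsEigenvalueTuple D φ ξ ∧ sphericalTransform F.1 φ.1 = f ξ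

variable {d : ℕ} {D : Fin d → Module.End ℂ (Smooth N)}
  {T : InvSchwartz N K ≃L[ℂ] SchwartzOn (spectrumSet K D)}

/-- That the eigenvalues are real is part of the notion of transform, and already its instance for
the zero function provides the tuple. -/
theorem IsTransform.exists_tuple (hT : IsTransform T) {φ : Smooth N}
    (hφ : IsBoundedSpherical K φ) : ∃ ξ, IsEigenvalueTuple D φ ξ := by
  obtain ⟨ξ, hξ, -⟩ := hT 0 0 (by rw [map_zero]; rfl) φ hφ
  exact ⟨ξ, hξ⟩

theorem IsTransform.eq (hT : IsTransform T) {F : InvSchwartz N K}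
    {f : 𝓢(EuclideanSpace ℝ (Fin d), ℂ)} (hF : T F = Submodule.Quotient.mk f) {φ : Smooth N}
    (hφ : IsBoundedSpherical K φ) {ξ : EuclideanSpace ℝ (Fin d)} (hξ : IsEigenvalueTuple D φ ξ) :
    sphericalTransform F.1 φ.1 = f ξ := by
  obtain ⟨ξ', hξ', h⟩ := hT F f hF φ hφ
  rw [h, hξ.unique hφ.one hξ']

theorem IsTransform.injective (hT : IsTransform T) {F : InvSchwartz N K}
    (h : ∀ φ : Smooth N, IsBoundedSpherical K φ → sphericalTransform F.1 φ.1 = 0) : F = 0 := by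
  obtain ⟨f, hf⟩ := Submodule.Quotient.mk_surjective _ (T F)
  rw [← T.map_eq_zero_iff, ← hf, Submodule.Quotient.mk_eq_zero]
  rintro ξ ⟨φ, hφ, hξ⟩
  rw [← hT.eq hf.symm hφ hξ, h φ hφ]

/-- A smooth invariant function all of whose pairings with invariant Schwartz functions vanish is
zero. -/
theorem eq_zero_of_sphericalTransform_eq_zero [IsTopologicalGroup K] [CompactSpace K]
    {u : Smooth N} (hu : ∀ (k : K) (x : N), u.1 (k • x) = u.1 x)
    (h : ∀ F : InvSchwartz N K, sphericalTransform F.1 u.1 = 0) : u = 0 := by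
  ext x₀
  -- The bump sits at `x₀⁻¹` because the transform pairs with `u` at `x⁻¹`.
  obtain ⟨b, hb, hb1, hbc⟩ := exists_invariant_bump K x₀⁻¹
  choose r hr hr' using hb
  have hw := contDiff_conj_inv u
  have hcs : HasCompactSupport fun x => b.1 x * (starRingEnd ℂ) (u.1 x⁻¹) := hbc.mul_right
  have hcd : ContDiff ℝ ∞ fun x => b.1 x * (starRingEnd ℂ) (u.1 x⁻¹) := b.1.smooth'.mul hw
  -- Against this `F` the pairing is the integral of the nonnegative function `b x * ‖u x⁻¹‖ ^ 2`.
  -- Invariance of `F` uses that automorphisms commute with inversion.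
  let F : InvSchwartz N K := ⟨hcs.toSchwartzMap hcd, fun k x => by
    change b.1 (k • x) * (starRingEnd ℂ) (u.1 (k • x)⁻¹) = b.1 x * (starRingEnd ℂ) (u.1 x⁻¹)
    rw [b.2, ← smul_inv', hu]⟩
  have hF := h F
  let g : N → ℝ := fun x => r x * ‖u.1 x⁻¹‖ ^ 2
  have hg : ∀ x, F.1 x * u.1 x⁻¹ = (g x : ℂ) := fun x => by
    change b.1 x * (starRingEnd ℂ) (u.1 x⁻¹) * u.1 x⁻¹ = _
    rw [mul_assoc, Complex.conj_mul', hr']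
    simp [g]
  have hrc : Continuous r := by
    have : r = fun x => (b.1 x).re := by
      ext x
      rw [hr', Complex.ofReal_re]
    rw [this]
    exact Complex.continuous_re.comp b.1.continuous
  have huc : Continuous fun x : N => u.1 x⁻¹ := by
    simp only [inv_eq_neg]
    exact (continuous_smooth u).comp continuous_neg
  have hgc : Continuous g := hrc.mul (huc.norm.pow 2)
  have hrs : HasCompactSupport r := hbc.mono' fun x hx => subset_tsupport _ (by
    rw [Function.mem_support, hr']
    exact_mod_cast hx)
  have hgs : HasCompactSupport g := hrs.mul_right
  rw [sphericalTransform] at hF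
  simp only [hg] at hF
  rw [integral_complex_ofReal, Complex.ofReal_eq_zero] at hF
  have hzero : g x₀⁻¹ = 0 := by
    by_contra hne
    exact (hgc.integral_pos_of_hasCompactSupport_nonneg_nonzero hgs
      (fun x => mul_nonneg (hr x) (sq_nonneg _)) hne).ne' hF
  have hr1 : r x₀⁻¹ = 1 := by
    have := hr' x₀⁻¹
    rw [hb1] at this
    exact_mod_cast this.symm
  simpa [g, hr1] using hzero

/-- Bounded spherical functions are determined by their eigenvalues. -/
theorem IsTransform.spherical_ext [IsTopologicalGroup K] [CompactSpace K] (hT : IsTransform T)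
    {φ ψ : Smooth N} (hφ : IsBoundedSpherical K φ) (hψ : IsBoundedSpherical K ψ)
    {ξ : EuclideanSpace ℝ (Fin d)} (hξ : IsEigenvalueTuple D φ ξ) (hξ' : IsEigenvalueTuple D ψ ξ) :
    φ = ψ := by
  refine sub_eq_zero.1 (eq_zero_of_sphericalTransform_eq_zero (K := K) (fun k x => ?_) fun F => ?_)
  · change φ.1 _ - ψ.1 _ = φ.1 x - ψ.1 x
    rw [hφ.invariant, hψ.invariant]
  · obtain ⟨f, hf⟩ := Submodule.Quotient.mk_surjective _ (T F)
    have h1 := (hT.eq hf.symm hφ hξ).trans (hT.eq hf.symm hψ hξ').symm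
    have e : (fun x : N => F.1 x * (φ - ψ).1 x⁻¹) =
        fun x => F.1 x * φ.1 x⁻¹ - F.1 x * ψ.1 x⁻¹ := by
      ext x
      exact mul_sub _ _ _
    rw [sphericalTransform, e, integral_sub
      (integrable_sphericalTransform _ (continuous_smooth φ) hφ.bounded)
      (integrable_sphericalTransform _ (continuous_smooth ψ) hψ.bounded)]
    exact sub_eq_zero.2 h1

/-- A bounded invariant eigenfunction is a multiple of the bounded spherical function with the same
eigenvalues. -/
theorem IsTransform.eq_smul [IsTopologicalGroup K] [CompactSpace K] (hT : IsTransform T)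
    (hD : Algebra.adjoin ℂ (Set.range D) = invDiffOps N K)
    {φ ψ : Smooth N} (hφ : IsBoundedSpherical K φ)
    (hinv : ∀ (k : K) (x : N), ψ.1 (k • x) = ψ.1 x) (hb : ∃ C : ℝ, ∀ x, ‖ψ.1 x‖ ≤ C)
    {ξ : EuclideanSpace ℝ (Fin d)} (hξ : IsEigenvalueTuple D φ ξ) (hξ' : IsEigenvalueTuple D ψ ξ) :
    ψ = ψ.1 1 • φ := by
  -- Adding `φ` normalizes the value at the identity to `1`, so `χ` is spherical even if `ψ`
  -- vanishes there and no division is needed. Uniqueness then gives `χ = φ`.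
  let χ : Smooth N := φ + ψ - ψ.1 1 • φ
  have hχ : ∀ x, χ.1 x = φ.1 x + ψ.1 x - ψ.1 1 * φ.1 x := fun x => rfl
  have hX : ∀ (X : Module.End ℂ (Smooth N)) (c : ℂ), X φ = c • φ → X ψ = c • ψ →
      X χ = c • χ := fun X c h1 h2 => by
    simp only [χ, map_sub, map_add, map_smul, h1, h2, smul_sub, smul_add, smul_comm c]
  have hs : IsBoundedSpherical K χ :=
    { invariant := fun k x => by rw [hχ, hχ, hφ.invariant, hinv]
      eigen := fun X hX' => by
        obtain ⟨c, h1, h2⟩ := hξ.exists_eigenvalue hξ' (hD ▸ hX')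
        exact ⟨c, hX X c h1 h2⟩
      one := by rw [hχ, hφ.one]; ring
      bounded := by
        obtain ⟨A, hA⟩ := hφ.bounded
        obtain ⟨B, hB⟩ := hb
        refine ⟨A + B + ‖ψ.1 1‖ * A, fun x => ?_⟩
        rw [hχ]
        refine (norm_sub_le _ _).trans (add_le_add ((norm_add_le _ _).trans
          (add_le_add (hA x) (hB x))) ?_)
        rw [norm_mul]
        exact mul_le_mul_of_nonneg_left (hA x) (norm_nonneg _) }
  have h := hT.spherical_ext hφ hs hξ fun j => hX _ _ (hξ j) (hξ' j)
  have h' : φ + (ψ - ψ.1 1 • φ) = φ + 0 := by rw [add_zero, ← add_sub_assoc]; exact h.symm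
  exact sub_eq_zero.1 (add_left_cancel h')

end Spherical

section Product

variable {N₁ N₂ K₁ K₂ : Type*}
  [NormedAddCommGroup N₁] [NormedSpace ℝ N₁] [NilpotentLieGroup N₁]
  [NormedAddCommGroup N₂] [NormedSpace ℝ N₂] [NilpotentLieGroup N₂]
  [Group K₁] [TopologicalSpace K₁] [MulDistribMulAction K₁ N₁] [ContinuousSMul K₁ N₁]
  [Group K₂] [TopologicalSpace K₂] [MulDistribMulAction K₂ N₂] [ContinuousSMul K₂ N₂]

theorem isBoundedSpherical_smoothTensor {φ₁ : Smooth N₁} {φ₂ : Smooth N₂}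
    (h₁ : IsBoundedSpherical K₁ φ₁) (h₂ : IsBoundedSpherical K₂ φ₂) :
    IsBoundedSpherical (K₁ × K₂) (smoothTensor φ₁ φ₂) where
  invariant k z := congrArg₂ (· * ·) (h₁.invariant k.1 z.1) (h₂.invariant k.2 z.2)
  eigen D hD := by
    have hD' := invDiffOps_prod_le hD
    clear hD
    induction hD' using Submodule.span_induction with
    | mem D hD =>
      obtain ⟨A, B, hA, hB, rfl⟩ := hD
      obtain ⟨a, ha⟩ := h₁.eigen _ hA
      obtain ⟨b, hb⟩ := h₂.eigen _ hB
      refine ⟨a * b, ?_⟩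
      rw [liftMul_smoothTensor, ha, hb]
      ext ⟨x, y⟩
      exact mul_mul_mul_comm _ _ _ _
    | zero => exact ⟨0, by simp⟩
    | add D E _ _ hD hE =>
      obtain ⟨a, ha⟩ := hD
      obtain ⟨b, hb⟩ := hE
      exact ⟨a + b, by rw [LinearMap.add_apply, ha, hb, add_smul]⟩
    | smul c D _ hD =>
      obtain ⟨a, ha⟩ := hD
      exact ⟨c * a, by rw [LinearMap.smul_apply, ha, smul_smul]⟩
  one := by
    change φ₁.1 1 * φ₂.1 1 = 1
    rw [h₁.one, h₂.one, one_mul]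
  bounded := by
    obtain ⟨A, hA⟩ := h₁.bounded
    obtain ⟨B, hB⟩ := h₂.bounded
    refine ⟨A * B, fun z => ?_⟩
    change ‖φ₁.1 z.1 * φ₂.1 z.2‖ ≤ _
    rw [norm_mul]
    exact mul_le_mul (hA _) (hB _) (norm_nonneg _) ((norm_nonneg _).trans (hA 1))

/-- The eigenvalue is that of the lift of `X` on `Φ`, hence the same for all slices. -/
theorem sliceL_eigen {Φ : Smooth (N₁ × N₂)} (hΦ : IsBoundedSpherical (K₁ × K₂) Φ)
    {X : Module.End ℂ (Smooth N₁)} (hX : X ∈ invDiffOps N₁ K₁) :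
    ∃ c : ℂ, ∀ y, X (sliceL Φ y) = c • sliceL Φ y := by
  have hl := isLiftL_liftL (N₂ := N₂) ⟨X, hX.1⟩
  obtain ⟨c, hc⟩ := hΦ.eigen _ (hl.mem_invDiffOps (K₂ := K₂) hX)
  refine ⟨c, fun y => ?_⟩
  rw [← hl.sliceL_eq, hc]
  rfl

theorem sliceR_eigen {Φ : Smooth (N₁ × N₂)} (hΦ : IsBoundedSpherical (K₁ × K₂) Φ)
    {X : Module.End ℂ (Smooth N₂)} (hX : X ∈ invDiffOps N₂ K₂) :
    ∃ c : ℂ, ∀ x, X (sliceR Φ x) = c • sliceR Φ x := by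
  have hl := isLiftR_liftR (N₁ := N₁) ⟨X, hX.1⟩
  obtain ⟨c, hc⟩ := hΦ.eigen _ (hl.mem_invDiffOps (K₁ := K₁) hX)
  refine ⟨c, fun x => ?_⟩
  rw [← hl.sliceR_eq, hc]
  rfl

theorem sliceL_invariant {Φ : Smooth (N₁ × N₂)} (hΦ : IsBoundedSpherical (K₁ × K₂) Φ) (y : N₂)
    (k : K₁) (x : N₁) : (sliceL Φ y).1 (k • x) = (sliceL Φ y).1 x := by
  have h := hΦ.invariant (k, 1) (x, y)
  have e : (k, (1 : K₂)) • (x, y) = (k • x, y) := Prod.ext rfl (one_smul K₂ y)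
  rwa [e] at h

theorem sliceR_invariant {Φ : Smooth (N₁ × N₂)} (hΦ : IsBoundedSpherical (K₁ × K₂) Φ) (x : N₁)
    (k : K₂) (y : N₂) : (sliceR Φ x).1 (k • y) = (sliceR Φ x).1 y := by
  have h := hΦ.invariant (1, k) (x, y)
  have e : ((1 : K₁), k) • (x, y) = (x, k • y) := Prod.ext (one_smul K₁ x) rfl
  rwa [e] at h

theorem isBoundedSpherical_sliceL {Φ : Smooth (N₁ × N₂)}
    (hΦ : IsBoundedSpherical (K₁ × K₂) Φ) : IsBoundedSpherical K₁ (sliceL Φ 1) where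
  invariant := sliceL_invariant hΦ 1
  eigen X hX := by
    obtain ⟨c, hc⟩ := sliceL_eigen hΦ hX
    exact ⟨c, hc 1⟩
  one := hΦ.one
  bounded := by
    obtain ⟨C, hC⟩ := hΦ.bounded
    exact ⟨C, fun x => hC _⟩

theorem isBoundedSpherical_sliceR {Φ : Smooth (N₁ × N₂)}
    (hΦ : IsBoundedSpherical (K₁ × K₂) Φ) : IsBoundedSpherical K₂ (sliceR Φ 1) where
  invariant := sliceR_invariant hΦ 1
  eigen X hX := by
    obtain ⟨c, hc⟩ := sliceR_eigen hΦ hX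
    exact ⟨c, hc 1⟩
  one := hΦ.one
  bounded := by
    obtain ⟨C, hC⟩ := hΦ.bounded
    exact ⟨C, fun x => hC _⟩

variable [FiniteDimensional ℝ N₁] [MeasurableSpace N₁] [BorelSpace N₁]
  [IsTopologicalGroup K₁] [CompactSpace K₁]

/-- The bounded spherical functions of a product are the products of such functions. -/
theorem IsTransform.eq_smoothTensor {d : ℕ} {D : Fin d → Module.End ℂ (Smooth N₁)}
    {T : InvSchwartz N₁ K₁ ≃L[ℂ] SchwartzOn (spectrumSet K₁ D)} (hT : IsTransform T)
    (hD : Algebra.adjoin ℂ (Set.range D) = invDiffOps N₁ K₁) {Φ : Smooth (N₁ × N₂)}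
    (hΦ : IsBoundedSpherical (K₁ × K₂) Φ) :
    Φ = smoothTensor (sliceL Φ 1) (sliceR Φ 1) := by
  obtain ⟨ξ, hξ⟩ := hT.exists_tuple (isBoundedSpherical_sliceL hΦ)
  obtain ⟨C, hC⟩ := hΦ.bounded
  ext ⟨x, y⟩
  -- The slice at `y` has the eigenvalues of the slice at the identity, so it is a multiple of it,
  -- with factor `Φ (1, y)`.
  have h := hT.eq_smul hD (isBoundedSpherical_sliceL hΦ) (sliceL_invariant hΦ y)
    ⟨C, fun x => hC (x, y)⟩ hξ fun j => by
      have hj : D j ∈ invDiffOps N₁ K₁ := hD ▸ Algebra.subset_adjoin ⟨j, rfl⟩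
      obtain ⟨c, hc⟩ := sliceL_eigen hΦ hj
      rw [hc y, eigenvalue_eq (isBoundedSpherical_sliceL hΦ).one (hξ j) (hc 1)]
  have h' := congrArg (fun f : Smooth N₁ => f.1 x) h
  exact h'.trans (mul_comm _ _)

end Product

end GelfandPair

/-! ### Quotients of polynormable spaces and continuous bilinear maps -/

namespace SchwartzMap

instance instPolynormableSpace {V : Type*} [NormedAddCommGroup V] [NormedSpace ℝ V] :
    PolynormableSpace ℂ 𝓢(V, ℂ) :=
  (schwartz_withSeminorms ℂ V ℂ).toPolynormableSpace

end SchwartzMap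

section Quotient

open scoped ComplexOrder in
/-- A quotient of a polynormable space is polynormable. -/
instance Submodule.Quotient.instPolynormableSpace {E : Type*} [AddCommGroup E] [Module ℂ E]
    [TopologicalSpace E] [IsTopologicalAddGroup E] [ContinuousSMul ℂ E] [PolynormableSpace ℂ E]
    (S : Submodule ℂ E) : PolynormableSpace ℂ (E ⧸ S) := by
  let _ : Module ℝ E := Module.complexToReal E
  -- The quotient map is open, so the images of the seminorm balls form a basis at zero; they are
  -- convex, and local convexity gives the seminorms.
  have hb := (PolynormableSpace.withSeminorms ℂ E).hasBasis_zero_ball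
  have hb' := hb.map S.mkQ
  have hm : Filter.map S.mkQ (𝓝 (0 : E)) = 𝓝 0 := by
    have := S.isOpenQuotientMap_mkQL.isOpenMap.map_nhds_eq
      (S.isOpenQuotientMap_mkQL.continuous.continuousAt (x := 0))
    simpa using this
  rw [hm] at hb'
  have : LocallyConvexSpace ℂ (E ⧸ S) := LocallyConvexSpace.ofBasisZero ℂ _ _ _ hb' fun i _ =>
    (convex_of_nonneg_surjective_algebraMap ℂ
      (fun _ => RCLike.nonneg_iff_exists_ofReal.mp)
      (Seminorm.convex_ball _ _ _)).linear_image S.mkQ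
  have : ContinuousSMul ℝ (E ⧸ S) := IsScalarTower.continuousSMul ℂ
  exact LocallyConvexSpace.toPolynormableSpace

theorem Submodule.Quotient.completeSpace_rightUniformSpace {E : Type*} [AddCommGroup E]
    [Module ℂ E] [UniformSpace E] [IsUniformAddGroup E] [FirstCountableTopology E]
    [CompleteSpace E] (S : Submodule ℂ E) :
    @CompleteSpace (E ⧸ S) (IsTopologicalAddGroup.rightUniformSpace _) :=
  QuotientAddGroup.completeSpace_right E S.toAddSubgroup

/-- A jointly continuous bilinear map is bounded by products of continuous seminorms. -/
theorem exists_seminorm_le_mul {X Y Z : Type*} [AddCommGroup X] [Module ℂ X] [TopologicalSpace X]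
    [PolynormableSpace ℂ X] [AddCommGroup Y] [Module ℂ Y] [TopologicalSpace Y]
    [PolynormableSpace ℂ Y] [AddCommGroup Z] [Module ℂ Z] [TopologicalSpace Z]
    (B : X →ₗ[ℂ] Y →ₗ[ℂ] Z) (hB : Continuous fun z : X × Y => B z.1 z.2)
    (p : Seminorm ℂ Z) (hp : Continuous p) :
    ∃ (p₁ : Seminorm ℂ X) (p₂ : Seminorm ℂ Y), Continuous p₁ ∧ Continuous p₂ ∧
      ∀ x y, p (B x y) ≤ p₁ x * p₂ y := by
  have hw₁ := PolynormableSpace.withSeminorms ℂ X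
  have hw₂ := PolynormableSpace.withSeminorms ℂ Y
  have h0 : {z : X × Y | p (B z.1 z.2) < 1} ∈ 𝓝 ((0 : X), (0 : Y)) :=
    (isOpen_lt (hp.comp hB) continuous_const).mem_nhds (by simp)
  rw [nhds_prod_eq, (hw₁.hasBasis_zero_ball.prod hw₂.hasBasis_zero_ball).mem_iff] at h0
  obtain ⟨⟨⟨s, r⟩, ⟨t, r'⟩⟩, ⟨hr, hr'⟩, hsub⟩ := h0
  simp only at hr hr' hsub
  set p₁ : Seminorm ℂ X := s.sup (fun p => p.1) with hp₁
  set p₂ : Seminorm ℂ Y := t.sup (fun p => p.1) with hp₂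
  have hc₁ : Continuous p₁ := Seminorm.continuous_finset_sup _ hw₁.continuous_seminorm s
  have hc₂ : Continuous p₂ := Seminorm.continuous_finset_sup _ hw₂.continuous_seminorm t
  refine ⟨(Real.toNNReal r⁻¹) • p₁, (Real.toNNReal r'⁻¹) • p₂, ?_, ?_, fun x y => ?_⟩
  · exact hc₁.const_smul (Real.toNNReal r⁻¹)
  · exact hc₂.const_smul (Real.toNNReal r'⁻¹)
  -- Scaling by strict upper bounds instead of by the seminorms avoids dividing by zero; the bounds
  -- are then let tend to the seminorms.
  have hle : ∀ a b : ℝ, p₁ x < a → p₂ y < b → p (B x y) ≤ (r⁻¹ * a) * (r'⁻¹ * b) := by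
    intro a b ha hb
    have ha0 : 0 < a := (apply_nonneg p₁ x).trans_lt ha
    have hb0 : 0 < b := (apply_nonneg p₂ y).trans_lt hb
    have hx : ((r / a : ℝ) : ℂ) • x ∈ p₁.ball 0 r := by
      rw [Seminorm.mem_ball_zero, map_smul_eq_mul, Complex.norm_real, Real.norm_eq_abs,
        abs_of_pos (div_pos hr ha0), div_mul_eq_mul_div, div_lt_iff₀ ha0]
      exact mul_lt_mul_of_pos_left ha hr
    have hy : ((r' / b : ℝ) : ℂ) • y ∈ p₂.ball 0 r' := by
      rw [Seminorm.mem_ball_zero, map_smul_eq_mul, Complex.norm_real, Real.norm_eq_abs,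
        abs_of_pos (div_pos hr' hb0), div_mul_eq_mul_div, div_lt_iff₀ hb0]
      exact mul_lt_mul_of_pos_left hb hr'
    have h1 : p (B (((r / a : ℝ) : ℂ) • x) (((r' / b : ℝ) : ℂ) • y)) < 1 :=
      hsub (Set.mk_mem_prod hx hy)
    rw [LinearMap.map_smul, LinearMap.map_smul, LinearMap.smul_apply, map_smul_eq_mul, map_smul_eq_mul,
      Complex.norm_real, Complex.norm_real, Real.norm_eq_abs, Real.norm_eq_abs,
      abs_of_pos (div_pos hr ha0), abs_of_pos (div_pos hr' hb0)] at h1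
    have h2 : (r⁻¹ * a) * (r'⁻¹ * b) * (r' / b * (r / a * p (B x y))) = p (B x y) := by
      field_simp
    rw [← h2]
    exact mul_le_of_le_one_right (by positivity) h1.le
  have e : ((Real.toNNReal r⁻¹) • p₁) x * ((Real.toNNReal r'⁻¹) • p₂) y =
      (r⁻¹ * p₁ x) * (r'⁻¹ * p₂ y) := by
    rw [smul_apply, smul_apply, NNReal.smul_def, NNReal.smul_def,
      Real.coe_toNNReal _ (inv_nonneg.2 hr.le), Real.coe_toNNReal _ (inv_nonneg.2 hr'.le)]
    rfl
  rw [e]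
  have ht : Tendsto (fun ε : ℝ => (r⁻¹ * (p₁ x + ε)) * (r'⁻¹ * (p₂ y + ε))) (𝓝[>] 0)
      (𝓝 ((r⁻¹ * p₁ x) * (r'⁻¹ * p₂ y))) := by
    have hc : Continuous fun ε : ℝ => (r⁻¹ * (p₁ x + ε)) * (r'⁻¹ * (p₂ y + ε)) := by fun_prop
    have := hc.tendsto 0
    simp only [add_zero] at this
    exact this.mono_left nhdsWithin_le_nhds
  refine ge_of_tendsto ht ?_
  filter_upwards [self_mem_nhdsWithin] with ε hε
  exact hle _ _ (lt_add_of_pos_right _ hε) (lt_add_of_pos_right _ hε)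

end Quotient

/-! ### The spaces of functions on the spectrum and of invariant functions -/

namespace GelfandPair

section SchwartzOn

variable {d : ℕ} {S : Set (EuclideanSpace ℝ (Fin d))}

/-- Closedness makes the quotient Hausdorff, so that sums of series in it are unique. -/
theorem isClosed_vanishingOn : IsClosed (vanishingOn S : Set 𝓢(EuclideanSpace ℝ (Fin d), ℂ)) := by
  have : (vanishingOn S : Set 𝓢(EuclideanSpace ℝ (Fin d), ℂ)) = ⋂ ξ ∈ S, {f | f ξ = 0} := by
    ext f
    simp [vanishingOn]
  rw [this]
  exact isClosed_biInter fun ξ _ => isClosed_eq (SchwartzMap.continuous_eval ξ) continuous_const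

instance instT2SpaceSchwartzOn : T2Space (SchwartzOn S) :=
  have : IsClosed (vanishingOn S : Set 𝓢(EuclideanSpace ℝ (Fin d), ℂ)) := isClosed_vanishingOn
  have : T3Space (SchwartzOn S) := inferInstance
  inferInstance

theorem completeSpace_schwartzOn :
    @CompleteSpace (SchwartzOn S) (IsTopologicalAddGroup.rightUniformSpace _) :=
  Submodule.Quotient.completeSpace_rightUniformSpace _

/-- The value at a point of `S`. -/
noncomputable def evalOn {ξ : EuclideanSpace ℝ (Fin d)} (hξ : ξ ∈ S) : SchwartzOn S →L[ℂ] ℂ :=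
  (vanishingOn S).liftQL
    ⟨{ toFun := fun f => f ξ, map_add' := fun _ _ => rfl, map_smul' := fun _ _ => rfl },
      SchwartzMap.continuous_eval ξ⟩ fun _ hf => hf ξ hξ

theorem evalOn_mk {ξ : EuclideanSpace ℝ (Fin d)} (hξ : ξ ∈ S)
    (f : 𝓢(EuclideanSpace ℝ (Fin d), ℂ)) :
    evalOn hξ (Submodule.Quotient.mk f : SchwartzOn S) = f ξ := rfl

theorem SchwartzOn.ext {u v : SchwartzOn S}
    (h : ∀ (ξ : EuclideanSpace ℝ (Fin d)) (hξ : ξ ∈ S), evalOn hξ u = evalOn hξ v) : u = v := by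
  obtain ⟨f, rfl⟩ := Submodule.Quotient.mk_surjective _ u
  obtain ⟨g, rfl⟩ := Submodule.Quotient.mk_surjective _ v
  rw [Submodule.Quotient.eq]
  intro ξ hξ
  have := h ξ hξ
  rw [evalOn_mk, evalOn_mk] at this
  change f ξ - g ξ = 0
  rw [this, sub_self]

end SchwartzOn

section InvSchwartz

variable {N K : Type*} [NormedAddCommGroup N] [NormedSpace ℝ N] [NilpotentLieGroup N]
  [Group K] [MulDistribMulAction K N]

theorem isClosed_invSchwartz : IsClosed (InvSchwartz N K : Set 𝓢(N, ℂ)) := by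
  have : (InvSchwartz N K : Set 𝓢(N, ℂ)) = ⋂ (k : K) (x : N), {F | F (k • x) = F x} := by
    ext f
    simp [InvSchwartz]
  rw [this]
  exact isClosed_iInter fun k => isClosed_iInter fun x =>
    isClosed_eq (SchwartzMap.continuous_eval _) (SchwartzMap.continuous_eval _)

theorem completeSpace_invSchwartz :
    @CompleteSpace (InvSchwartz N K) (IsTopologicalAddGroup.rightUniformSpace _) := by
  have h : CompleteSpace (InvSchwartz N K) := isClosed_invSchwartz.completeSpace_coe
  have : IsUniformAddGroup (InvSchwartz N K) := (InvSchwartz N K).toAddSubgroup.isUniformAddGroup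
  have e : IsTopologicalAddGroup.rightUniformSpace (InvSchwartz N K) =
      (instUniformSpaceSubtype : UniformSpace (InvSchwartz N K)) :=
    IsUniformAddGroup.rightUniformSpace_eq
  rwa [e]

end InvSchwartz

end GelfandPair

/-- A bilinear map bounded by products of continuous seminorms is jointly continuous. -/
theorem continuous_bilin_of_seminorm_le {X Y Z : Type*} [AddCommGroup X] [Module ℂ X]
    [TopologicalSpace X] [IsTopologicalAddGroup X] [AddCommGroup Y] [Module ℂ Y]
    [TopologicalSpace Y] [IsTopologicalAddGroup Y] [AddCommGroup Z] [Module ℂ Z]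
    [TopologicalSpace Z] [IsTopologicalAddGroup Z] [PolynormableSpace ℂ Z]
    (B : X →ₗ[ℂ] Y →ₗ[ℂ] Z)
    (h : ∀ p : Seminorm ℂ Z, Continuous p → ∃ (p₁ : Seminorm ℂ X) (p₂ : Seminorm ℂ Y),
      Continuous p₁ ∧ Continuous p₂ ∧ ∀ x y, p (B x y) ≤ p₁ x * p₂ y) :
    Continuous fun z : X × Y => B z.1 z.2 := by
  have hw := PolynormableSpace.withSeminorms ℂ Z
  refine continuous_iff_continuousAt.2 fun ⟨x₀, y₀⟩ => ?_
  refine (hw.tendsto_nhds _ _).2 fun p ε hε => ?_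
  obtain ⟨p₁, p₂, h₁, h₂, hle⟩ := h p.1 (hw.continuous_seminorm p)
  let m : X × Y → ℝ := fun z => p₁ (z.1 - x₀) * p₂ (z.2 - y₀) + p₁ x₀ * p₂ (z.2 - y₀) +
    p₁ (z.1 - x₀) * p₂ y₀
  have hm : Continuous m := by
    have c1 : Continuous fun z : X × Y => p₁ (z.1 - x₀) := h₁.comp (by fun_prop)
    have c2 : Continuous fun z : X × Y => p₂ (z.2 - y₀) := h₂.comp (by fun_prop)
    exact ((c1.mul c2).add (continuous_const.mul c2)).add (c1.mul continuous_const)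
  have hm0 := hm.tendsto (x₀, y₀)
  have e0 : m (x₀, y₀) = 0 := by simp [m]
  rw [e0] at hm0
  filter_upwards [hm0.eventually (gt_mem_nhds hε)] with z hz
  refine lt_of_le_of_lt ?_ hz
  have e : B z.1 z.2 - B x₀ y₀ = B (z.1 - x₀) (z.2 - y₀) + B x₀ (z.2 - y₀) + B (z.1 - x₀) y₀ := by
    simp only [map_sub, LinearMap.sub_apply]
    abel
  change p.1 (B z.1 z.2 - B x₀ y₀) ≤ _
  rw [e]
  exact (map_add_le_add p.1 _ _).trans (add_le_add ((map_add_le_add p.1 _ _).trans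
    (add_le_add (hle _ _) (hle _ _))) (hle _ _))

namespace SchwartzMap

variable {V W : Type*} [NormedAddCommGroup V] [NormedSpace ℝ V]
  [NormedAddCommGroup W] [NormedSpace ℝ W]

/-- The tensor product of Schwartz functions, as a bilinear map. -/
noncomputable def tensorBilin : 𝓢(V, ℂ) →ₗ[ℂ] 𝓢(W, ℂ) →ₗ[ℂ] 𝓢(V × W, ℂ) :=
  LinearMap.mk₂ ℂ tensor
    (fun f f' g => by ext z; simp [add_mul]) (fun c f g => by ext z; simp [mul_assoc])
    (fun f g g' => by ext z; simp [mul_add]) (fun c f g => by ext z; simp [mul_left_comm])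

theorem continuous_tensor : Continuous fun z : 𝓢(V, ℂ) × 𝓢(W, ℂ) => tensor z.1 z.2 :=
  continuous_bilin_of_seminorm_le tensorBilin fun p hp => exists_seminorm_tensor_le p hp

end SchwartzMap

/-! ### Tensor products on both sides of the transform -/

namespace GelfandPair

section TensorOn

variable {d₁ d₂ : ℕ} {S₁ : Set (EuclideanSpace ℝ (Fin d₁))} {S₂ : Set (EuclideanSpace ℝ (Fin d₂))}
  {S : Set (EuclideanSpace ℝ (Fin (d₁ + d₂)))}

/-- The tensor product `(ξ₁, ξ₂) ↦ f ξ₁ * g ξ₂` on `ℝ^(d₁ + d₂)`. -/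
noncomputable def tensorFin (f : 𝓢(EuclideanSpace ℝ (Fin d₁), ℂ))
    (g : 𝓢(EuclideanSpace ℝ (Fin d₂), ℂ)) : 𝓢(EuclideanSpace ℝ (Fin (d₁ + d₂)), ℂ) :=
  SchwartzMap.compCLMOfContinuousLinearEquiv ℂ EuclideanSpace.finAddEquivProd
    (SchwartzMap.tensor f g)

theorem tensorFin_apply (f : 𝓢(EuclideanSpace ℝ (Fin d₁), ℂ))
    (g : 𝓢(EuclideanSpace ℝ (Fin d₂), ℂ)) (ξ : EuclideanSpace ℝ (Fin (d₁ + d₂))) :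
    tensorFin f g ξ = f (EuclideanSpace.finAddEquivProd ξ).1 *
      g (EuclideanSpace.finAddEquivProd ξ).2 := rfl

/-- The tensor product of functions on `S₁` and on `S₂`, as a function on a subset of
`S₁ × S₂`. -/
noncomputable def tensorOn (hS : ∀ ξ ∈ S, (EuclideanSpace.finAddEquivProd ξ).1 ∈ S₁ ∧
    (EuclideanSpace.finAddEquivProd ξ).2 ∈ S₂) :
    SchwartzOn S₁ →ₗ[ℂ] SchwartzOn S₂ →ₗ[ℂ] SchwartzOn S :=
  let M : 𝓢(EuclideanSpace ℝ (Fin d₁), ℂ) →ₗ[ℂ] 𝓢(EuclideanSpace ℝ (Fin d₂), ℂ) →ₗ[ℂ]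
      SchwartzOn S := SchwartzMap.tensorBilin.compr₂ ((vanishingOn S).mkQ.comp
        (SchwartzMap.compCLMOfContinuousLinearEquiv ℂ
          EuclideanSpace.finAddEquivProd).toLinearMap)
  (vanishingOn S₁).liftQ ((vanishingOn S₂).liftQ M.flip fun g hg => by
      refine LinearMap.ext fun f => (Submodule.Quotient.mk_eq_zero _).2 fun ξ hξ => ?_
      change tensorFin f g ξ = 0
      rw [tensorFin_apply, hg _ (hS ξ hξ).2, mul_zero]).flip fun f hf => by
    refine LinearMap.ext fun u => ?_
    obtain ⟨g, rfl⟩ := Submodule.Quotient.mk_surjective _ u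
    refine (Submodule.Quotient.mk_eq_zero _).2 fun ξ hξ => ?_
    change tensorFin f g ξ = 0
    rw [tensorFin_apply, hf _ (hS ξ hξ).1, zero_mul]

variable (hS : ∀ ξ ∈ S, (EuclideanSpace.finAddEquivProd ξ).1 ∈ S₁ ∧
    (EuclideanSpace.finAddEquivProd ξ).2 ∈ S₂)

theorem evalOn_tensorOn (u : SchwartzOn S₁) (v : SchwartzOn S₂)
    {ξ : EuclideanSpace ℝ (Fin (d₁ + d₂))} (hξ : ξ ∈ S) :
    evalOn hξ (tensorOn hS u v) = evalOn (hS ξ hξ).1 u * evalOn (hS ξ hξ).2 v := by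
  obtain ⟨f, rfl⟩ := Submodule.Quotient.mk_surjective _ u
  obtain ⟨g, rfl⟩ := Submodule.Quotient.mk_surjective _ v
  rfl

/-- A product of open quotient maps is a quotient map, so joint continuity can be checked on
Schwartz functions before restriction. -/
theorem continuous_tensorOn :
    Continuous fun z : SchwartzOn S₁ × SchwartzOn S₂ => tensorOn hS z.1 z.2 := by
  have hq := (vanishingOn S₁).isOpenQuotientMap_mkQL.prodMap
    (vanishingOn S₂).isOpenQuotientMap_mkQL
  rw [hq.isQuotientMap.continuous_iff]
  exact (vanishingOn S).mkQL.continuous.comp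
    ((SchwartzMap.compCLMOfContinuousLinearEquiv ℂ
      EuclideanSpace.finAddEquivProd).continuous.comp SchwartzMap.continuous_tensor)

end TensorOn

section InvTensor

variable {N₁ N₂ K₁ K₂ : Type*}
  [NormedAddCommGroup N₁] [NormedSpace ℝ N₁] [NilpotentLieGroup N₁]
  [NormedAddCommGroup N₂] [NormedSpace ℝ N₂] [NilpotentLieGroup N₂]
  [Group K₁] [MulDistribMulAction K₁ N₁] [Group K₂] [MulDistribMulAction K₂ N₂]

/-- The tensor product of invariant Schwartz functions. -/
noncomputable def invTensor :
    InvSchwartz N₁ K₁ →ₗ[ℂ] InvSchwartz N₂ K₂ →ₗ[ℂ] InvSchwartz (N₁ × N₂) (K₁ × K₂) :=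
  LinearMap.mk₂ ℂ (fun F G => ⟨SchwartzMap.tensor F.1 G.1, fun k z =>
      congrArg₂ (· * ·) (F.2 k.1 z.1) (G.2 k.2 z.2)⟩)
    (fun f f' g => by ext z; simp [add_mul]) (fun c f g => by ext z; simp [mul_assoc])
    (fun f g g' => by ext z; simp [mul_add]) (fun c f g => by ext z; simp [mul_left_comm])

theorem continuous_invTensor :
    Continuous fun z : InvSchwartz N₁ K₁ × InvSchwartz N₂ K₂ => invTensor z.1 z.2 :=
  (SchwartzMap.continuous_tensor.comp
    (continuous_subtype_val.prodMap continuous_subtype_val)).subtype_mk _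

end InvTensor

theorem exists_transform_functional {N K : Type*} [NormedAddCommGroup N] [NormedSpace ℝ N]
    [FiniteDimensional ℝ N] [MeasurableSpace N] [BorelSpace N] [NilpotentLieGroup N]
    [Group K] [TopologicalSpace K] [MulDistribMulAction K N] [ContinuousSMul K N]
    {φ : Smooth N} (hφ : IsBoundedSpherical K φ) :
    ∃ L : InvSchwartz N K →L[ℂ] ℂ, ∀ F : InvSchwartz N K, L F = sphericalTransform F.1 φ.1 := by
  obtain ⟨L, hL⟩ := exists_transformCLM (continuous_smooth φ) hφ.bounded
  exact ⟨L.comp (InvSchwartz N K).subtypeL, fun F => hL F.1⟩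

section Product

/-- A rapidly convergent expansion into products, applied to a continuous bilinear map. -/
theorem exists_clm_hasSum_bilin {E X Y Q κ : Type*} [AddCommGroup E] [Module ℂ E]
    [TopologicalSpace E] [IsTopologicalAddGroup E] [ContinuousSMul ℂ E]
    [AddCommGroup X] [Module ℂ X] [TopologicalSpace X] [PolynormableSpace ℂ X]
    [AddCommGroup Y] [Module ℂ Y] [TopologicalSpace Y] [PolynormableSpace ℂ Y]
    [AddCommGroup Q] [Module ℂ Q] [TopologicalSpace Q] [IsTopologicalAddGroup Q]
    [ContinuousSMul ℂ Q] [PolynormableSpace ℂ Q] [T2Space Q]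
    (hQ : @CompleteSpace Q (IsTopologicalAddGroup.rightUniformSpace Q))
    (a : κ → X) (b : κ → Y) (c : κ → E →ₗ[ℂ] ℂ)
    (hc : ∀ (p : Seminorm ℂ X) (p' : Seminorm ℂ Y), Continuous p → Continuous p' →
      ∃ q : Seminorm ℂ E, Continuous q ∧ ∀ F, Summable (fun i => ‖c i F‖ * (p (a i) * p' (b i))) ∧
        ∑' i, ‖c i F‖ * (p (a i) * p' (b i)) ≤ q F)
    (B : X →ₗ[ℂ] Y →ₗ[ℂ] Q) (hB : Continuous fun z : X × Y => B z.1 z.2) :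
    ∃ A : E →L[ℂ] Q, ∀ F, HasSum (fun i => c i F • B (a i) (b i)) (A F) := by
  refine exists_clm_hasSum hQ c (fun i => B (a i) (b i)) fun p hp => ?_
  obtain ⟨p₁, p₂, h₁, h₂, hle⟩ := exists_seminorm_le_mul B hB p hp
  obtain ⟨q, hq, h⟩ := hc p₁ p₂ h₁ h₂
  have hle' : ∀ F i, ‖c i F‖ * p (B (a i) (b i)) ≤ ‖c i F‖ * (p₁ (a i) * p₂ (b i)) :=
    fun F i => mul_le_mul_of_nonneg_left (hle _ _) (norm_nonneg _)
  refine ⟨q, hq, fun F => ?_⟩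
  have hs := Summable.of_nonneg_of_le (fun i => mul_nonneg (norm_nonneg _) (apply_nonneg p _))
    (hle' F) (h F).1
  exact ⟨hs, (hs.tsum_le_tsum (hle' F) (h F).1).trans (h F).2⟩

/-- Invariant Schwartz functions on a product have a rapidly convergent expansion into tensor
products of invariant Schwartz functions on the factors. -/
theorem exists_hasSum_invTensor (N₁ N₂ K₁ K₂ : Type*)
    [NormedAddCommGroup N₁] [NormedSpace ℝ N₁] [FiniteDimensional ℝ N₁] [NilpotentLieGroup N₁]
    [NormedAddCommGroup N₂] [NormedSpace ℝ N₂] [FiniteDimensional ℝ N₂] [NilpotentLieGroup N₂]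
    [Group K₁] [TopologicalSpace K₁] [IsTopologicalGroup K₁] [CompactSpace K₁]
    [MulDistribMulAction K₁ N₁] [ContinuousSMul K₁ N₁]
    [Group K₂] [TopologicalSpace K₂] [IsTopologicalGroup K₂] [CompactSpace K₂]
    [MulDistribMulAction K₂ N₂] [ContinuousSMul K₂ N₂] :
    ∃ (κ : Type) (a : κ → InvSchwartz N₁ K₁) (b : κ → InvSchwartz N₂ K₂)
      (c : κ → InvSchwartz (N₁ × N₂) (K₁ × K₂) →ₗ[ℂ] ℂ),
      (∀ (p : Seminorm ℂ (InvSchwartz N₁ K₁)) (p' : Seminorm ℂ (InvSchwartz N₂ K₂)),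
        Continuous p → Continuous p' →
        ∃ q : Seminorm ℂ (InvSchwartz (N₁ × N₂) (K₁ × K₂)), Continuous q ∧ ∀ F,
          Summable (fun i => ‖c i F‖ * (p (a i) * p' (b i))) ∧
            ∑' i, ‖c i F‖ * (p (a i) * p' (b i)) ≤ q F) ∧
      ∀ F, HasSum (fun i => c i F • invTensor (a i) (b i)) F := by
  obtain ⟨κ, a, b, c, hc, hsum⟩ := exists_invSchwartz_expansion N₁ N₂ K₁ K₂
  refine ⟨κ, a, b, c, hc, fun F => ?_⟩
  -- The expansion is known to converge to `F` only pointwise. The tensor product, as a continuous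
  -- bilinear map, makes it converge in the topology, and evaluation identifies the limit as `F`.
  obtain ⟨A, hA⟩ := exists_clm_hasSum_bilin completeSpace_invSchwartz a b c hc invTensor
    continuous_invTensor
  have e : A F = F := by
    ext ⟨x, y⟩
    have h1 : HasSum (fun i => (c i F • invTensor (a i) (b i)).1 (x, y)) ((A F).1 (x, y)) :=
      SchwartzMap.hasSum_apply ((hA F).map (InvSchwartz (N₁ × N₂) (K₁ × K₂)).subtypeL
        (InvSchwartz (N₁ × N₂) (K₁ × K₂)).subtypeL.continuous) (x, y)
    exact h1.unique (hsum F x y)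
  have h := hA F
  rwa [e] at h

end Product

end GelfandPair

/-! ### Property (S) for the system of lifted generators -/

namespace GelfandPair

section Tuple

variable {N₁ N₂ K₁ K₂ : Type*} [NormedAddCommGroup N₁] [NormedSpace ℝ N₁]
  [NormedAddCommGroup N₂] [NormedSpace ℝ N₂]
  {d₁ d₂ : ℕ} {D₁ : Fin d₁ → Module.End ℂ (Smooth N₁)} {D₂ : Fin d₂ → Module.End ℂ (Smooth N₂)}
  {D : Fin (d₁ + d₂) → Module.End ℂ (Smooth (N₁ × N₂))}

theorem IsEigenvalueTuple.sliceL (hL : ∀ j, IsLiftL (D₁ j) (D (Fin.castAdd d₂ j)))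
    {Φ : Smooth (N₁ × N₂)} {ζ : EuclideanSpace ℝ (Fin (d₁ + d₂))} (h : IsEigenvalueTuple D Φ ζ)
    (y : N₂) : IsEigenvalueTuple D₁ (sliceL Φ y) (EuclideanSpace.finAddEquivProd ζ).1 := fun j => by
  rw [← (hL j).sliceL_eq, h]
  rfl

theorem IsEigenvalueTuple.sliceR (hR : ∀ j, IsLiftR (D₂ j) (D (Fin.natAdd d₁ j)))
    {Φ : Smooth (N₁ × N₂)} {ζ : EuclideanSpace ℝ (Fin (d₁ + d₂))} (h : IsEigenvalueTuple D Φ ζ)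
    (x : N₁) : IsEigenvalueTuple D₂ (sliceR Φ x) (EuclideanSpace.finAddEquivProd ζ).2 := fun j => by
  rw [← (hR j).sliceR_eq, h]
  rfl

theorem IsEigenvalueTuple.smoothTensor (hL : ∀ j, IsLiftL (D₁ j) (D (Fin.castAdd d₂ j)))
    (hR : ∀ j, IsLiftR (D₂ j) (D (Fin.natAdd d₁ j))) {φ₁ : Smooth N₁} {φ₂ : Smooth N₂}
    {ζ : EuclideanSpace ℝ (Fin (d₁ + d₂))}
    (h₁ : IsEigenvalueTuple D₁ φ₁ (EuclideanSpace.finAddEquivProd ζ).1)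
    (h₂ : IsEigenvalueTuple D₂ φ₂ (EuclideanSpace.finAddEquivProd ζ).2) :
    IsEigenvalueTuple D (smoothTensor φ₁ φ₂) ζ := fun j => by
  induction j using Fin.addCases with
  | left j =>
    rw [(hL j).apply_smoothTensor, h₁ j]
    ext ⟨x, y⟩
    exact mul_assoc _ _ _
  | right j =>
    rw [(hR j).apply_smoothTensor, h₂ j]
    ext ⟨x, y⟩
    exact mul_left_comm _ _ _

end Tuple

section Product

variable {N₁ N₂ K₁ K₂ : Type*}
  [NormedAddCommGroup N₁] [NormedSpace ℝ N₁] [FiniteDimensional ℝ N₁]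
  [MeasurableSpace N₁] [BorelSpace N₁] [NilpotentLieGroup N₁]
  [NormedAddCommGroup N₂] [NormedSpace ℝ N₂] [FiniteDimensional ℝ N₂]
  [MeasurableSpace N₂] [BorelSpace N₂] [NilpotentLieGroup N₂]
  [Group K₁] [TopologicalSpace K₁] [IsTopologicalGroup K₁] [CompactSpace K₁]
  [MulDistribMulAction K₁ N₁] [ContinuousSMul K₁ N₁]
  [Group K₂] [TopologicalSpace K₂] [IsTopologicalGroup K₂] [CompactSpace K₂]
  [MulDistribMulAction K₂ N₂] [ContinuousSMul K₂ N₂]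
  {d₁ d₂ : ℕ} {D₁ : Fin d₁ → Module.End ℂ (Smooth N₁)} {D₂ : Fin d₂ → Module.End ℂ (Smooth N₂)}
  {D : Fin (d₁ + d₂) → Module.End ℂ (Smooth (N₁ × N₂))}
  {T₁ : InvSchwartz N₁ K₁ ≃L[ℂ] SchwartzOn (spectrumSet K₁ D₁)}
  {T₂ : InvSchwartz N₂ K₂ ≃L[ℂ] SchwartzOn (spectrumSet K₂ D₂)}

theorem IsTransform.eq_evalOn {N K : Type*} [NormedAddCommGroup N] [NormedSpace ℝ N]
    [FiniteDimensional ℝ N] [MeasurableSpace N] [BorelSpace N] [NilpotentLieGroup N]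
    [Group K] [TopologicalSpace K] [MulDistribMulAction K N] [ContinuousSMul K N]
    {d : ℕ} {D : Fin d → Module.End ℂ (Smooth N)}
    {T : InvSchwartz N K ≃L[ℂ] SchwartzOn (spectrumSet K D)} (hT : IsTransform T)
    (F : InvSchwartz N K) {φ : Smooth N} (hφ : IsBoundedSpherical K φ)
    {ξ : EuclideanSpace ℝ (Fin d)} (hξ : IsEigenvalueTuple D φ ξ) (h : ξ ∈ spectrumSet K D) :
    sphericalTransform F.1 φ.1 = evalOn h (T F) := by
  obtain ⟨f, hf⟩ := Submodule.Quotient.mk_surjective _ (T F)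
  rw [hT.eq hf.symm hφ hξ, ← hf, evalOn_mk]

/-- The spherical transform of a product is injective, when those of the factors are. -/
theorem injective_prod (hT₁ : IsTransform T₁) (hT₂ : IsTransform T₂)
    {F : InvSchwartz (N₁ × N₂) (K₁ × K₂)}
    (h : ∀ (φ₁ : Smooth N₁) (φ₂ : Smooth N₂), IsBoundedSpherical K₁ φ₁ →
      IsBoundedSpherical K₂ φ₂ → sphericalTransform F.1 (smoothTensor φ₁ φ₂).1 = 0) : F = 0 := by
  obtain ⟨κ, a, b, c, hc, hsum⟩ := exists_hasSum_invTensor N₁ N₂ K₁ K₂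
  obtain ⟨cc, hcc, hG⟩ := exists_sphericalTransform_tensor N₁ N₂
  -- Applying a functional to the second factors gives a series in the invariant Schwartz functions
  -- on `N₁`. With the transform at `φ₂` as `L`, its sum plays the role of a partial transform of
  -- `F`.
  have hs₁ : ∀ L : InvSchwartz N₂ K₂ →L[ℂ] ℂ, Summable fun i => (c i F * L (b i)) • a i :=
    fun L => summable_of_summable_seminorm completeSpace_invSchwartz _ fun p hpc => by
      obtain ⟨p', hp', e⟩ : ∃ p : Seminorm ℂ (InvSchwartz N₂ K₂), Continuous p ∧
        ∀ x, p x = ‖L x‖ := ⟨(normSeminorm ℂ ℂ).comp L.toLinearMap,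
          continuous_norm.comp L.continuous, fun _ => rfl⟩
      obtain ⟨q, -, hq⟩ := hc p p' hpc hp'
      refine (hq F).1.congr fun i => ?_
      rw [map_smul_eq_mul, norm_mul, e]
      ring
  have hs₂ : ∀ L : InvSchwartz N₁ K₁ →L[ℂ] ℂ, Summable fun i => (c i F * L (a i)) • b i :=
    fun L => summable_of_summable_seminorm completeSpace_invSchwartz _ fun p hpc => by
      obtain ⟨p', hp', e⟩ : ∃ p : Seminorm ℂ (InvSchwartz N₁ K₁), Continuous p ∧
        ∀ x, p x = ‖L x‖ := ⟨(normSeminorm ℂ ℂ).comp L.toLinearMap,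
          continuous_norm.comp L.continuous, fun _ => rfl⟩
      obtain ⟨q, -, hq⟩ := hc p' p hp' hpc
      refine (hq F).1.congr fun i => ?_
      rw [map_smul_eq_mul, norm_mul, e]
      ring
  -- The transform of the partial transform at `φ₁` is, up to the nonzero constant, that of `F` at
  -- `φ₁ ⊗ φ₂`, which is zero; injectivity on `N₁` applies.
  have step₁ : ∀ (L₂ : InvSchwartz N₂ K₂ →L[ℂ] ℂ) (φ₂ : Smooth N₂), IsBoundedSpherical K₂ φ₂ →
      (∀ G : InvSchwartz N₂ K₂, L₂ G = sphericalTransform G.1 φ₂.1) →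
      HasSum (fun i => (c i F * L₂ (b i)) • a i) 0 := by
    intro L₂ φ₂ hφ₂ hL₂
    have hH := (hs₁ L₂).hasSum
    have h0 : ∑' i, (c i F * L₂ (b i)) • a i = 0 := hT₁.injective fun φ₁ hφ₁ => by
      obtain ⟨L₁, hL₁⟩ := exists_transform_functional hφ₁
      obtain ⟨L, hL⟩ := exists_transform_functional (isBoundedSpherical_smoothTensor hφ₁ hφ₂)
      have e1 := hH.mapL L₁
      have e2 := (hsum F).mapL L
      rw [hL, h φ₁ φ₂ hφ₁ hφ₂] at e2
      have e3 : HasSum (fun i => (cc : ℂ) * L₁ ((c i F * L₂ (b i)) • a i)) 0 := by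
        refine e2.congr_fun fun i => ?_
        have e4 : L (invTensor (a i) (b i)) = cc * (L₁ (a i) * L₂ (b i)) := by
          rw [hL, hL₁, hL₂]
          exact hG _ _ _ _
        rw [map_smul, map_smul, e4, smul_eq_mul, smul_eq_mul]
        ring
      have e4 := e3.unique (e1.mul_left (cc : ℂ))
      rw [← hL₁]
      exact (mul_eq_zero.1 e4.symm).resolve_left (by exact_mod_cast hcc.ne')
    rwa [h0] at hH
  ext ⟨x, y⟩
  let ev : InvSchwartz N₁ K₁ →L[ℂ] ℂ := ContinuousLinearMap.comp
    ⟨{ toFun := fun f => f x, map_add' := fun _ _ => rfl, map_smul' := fun _ _ => rfl },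
      SchwartzMap.continuous_eval x⟩ (InvSchwartz N₁ K₁).subtypeL
  have hH := (hs₂ ev).hasSum
  -- This is the slice of `F` at `x`. Its transform at `φ₂` is the partial transform evaluated at
  -- `x`, which vanishes by the previous step.
  have h0 : ∑' i, (c i F * ev (a i)) • b i = 0 := hT₂.injective fun φ₂ hφ₂ => by
    obtain ⟨L₂, hL₂⟩ := exists_transform_functional hφ₂
    have e1 := hH.mapL L₂
    have e2 := (step₁ L₂ φ₂ hφ₂ hL₂).mapL ev
    rw [← hL₂, ← map_zero ev]
    refine e1.unique (e2.congr_fun fun i => ?_)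
    rw [map_smul, map_smul, smul_eq_mul, smul_eq_mul]
    ring
  rw [h0] at hH
  have e1 := SchwartzMap.hasSum_apply (hH.mapL (InvSchwartz N₂ K₂).subtypeL) y
  have e2 := SchwartzMap.hasSum_apply
    ((hsum F).mapL (InvSchwartz (N₁ × N₂) (K₁ × K₂)).subtypeL) (x, y)
  refine e2.unique (e1.congr_fun fun i => ?_)
  change c i F * ((a i).1 x * (b i).1 y) = c i F * (a i).1 x * (b i).1 y
  ring

/-- The system of the lifts of systems for which property (S) holds has property (S). -/
theorem propertySFor_prod (hT₁ : IsTransform T₁) (hT₂ : IsTransform T₂)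
    (hD₁ : Algebra.adjoin ℂ (Set.range D₁) = invDiffOps N₁ K₁)
    (hL : ∀ j, IsLiftL (D₁ j) (D (Fin.castAdd d₂ j)))
    (hR : ∀ j, IsLiftR (D₂ j) (D (Fin.natAdd d₁ j))) :
    PropertySFor (K₁ × K₂) D := by
  obtain ⟨cc, hcc, hG⟩ := exists_sphericalTransform_tensor N₁ N₂
  have hcc0 : (cc : ℂ) ≠ 0 := by exact_mod_cast hcc.ne'
  have hS : ∀ ζ ∈ spectrumSet (K₁ × K₂) D,
      (EuclideanSpace.finAddEquivProd ζ).1 ∈ spectrumSet K₁ D₁ ∧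
      (EuclideanSpace.finAddEquivProd ζ).2 ∈ spectrumSet K₂ D₂ := by
    rintro ζ ⟨Φ, hΦ, hζ⟩
    exact ⟨⟨_, isBoundedSpherical_sliceL hΦ, hζ.sliceL hL 1⟩,
      ⟨_, isBoundedSpherical_sliceR hΦ, hζ.sliceR hR 1⟩⟩
  obtain ⟨κ, a, b, c, hc, hsum⟩ := exists_hasSum_invTensor N₁ N₂ K₁ K₂
  -- `A` is `T₁ ⊗ T₂` applied term by term to the expansion of an invariant function.
  obtain ⟨A, hA⟩ := exists_clm_hasSum_bilin completeSpace_schwartzOn a b c hc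
    ((tensorOn hS).compl₁₂ T₁.toLinearEquiv.toLinearMap T₂.toLinearEquiv.toLinearMap)
    ((continuous_tensorOn hS).comp (T₁.continuous.prodMap T₂.continuous))
  obtain ⟨κ', -, e, e', c', hc', hsum'⟩ := SchwartzMap.exists_tensor_expansion
    (EuclideanSpace ℝ (Fin d₁)) (EuclideanSpace ℝ (Fin d₂))
  -- `B` is `T₁⁻¹ ⊗ T₂⁻¹` applied term by term to the expansion of a Schwartz function on the
  -- product of Euclidean spaces, each factor being first restricted to its spectrum.
  obtain ⟨B, hB⟩ := exists_clm_hasSum_bilin completeSpace_invSchwartz e e' c' hc'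
    ((invTensor (K₁ := K₁) (K₂ := K₂)).compl₁₂
      (T₁.symm.toLinearEquiv.toLinearMap.comp (vanishingOn (spectrumSet K₁ D₁)).mkQ)
      (T₂.symm.toLinearEquiv.toLinearMap.comp (vanishingOn (spectrumSet K₂ D₂)).mkQ))
    (continuous_invTensor.comp ((T₁.symm.continuous.comp (vanishingOn _).mkQL.continuous).prodMap
      (T₂.symm.continuous.comp (vanishingOn _).mkQL.continuous)))
  have hGtensor : ∀ {Φ : Smooth (N₁ × N₂)}, IsBoundedSpherical (K₁ × K₂) Φ →
      ∀ {ζ : EuclideanSpace ℝ (Fin (d₁ + d₂))}, IsEigenvalueTuple D Φ ζ →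
      ∀ (hζ : ζ ∈ spectrumSet (K₁ × K₂) D) (F₁ : InvSchwartz N₁ K₁) (F₂ : InvSchwartz N₂ K₂),
        sphericalTransform (invTensor F₁ F₂).1 Φ.1 =
          cc * (evalOn (hS ζ hζ).1 (T₁ F₁) * evalOn (hS ζ hζ).2 (T₂ F₂)) := by
    intro Φ hΦ ζ hζ' hζ F₁ F₂
    rw [← hT₁.eq_evalOn F₁ (isBoundedSpherical_sliceL hΦ) (hζ'.sliceL hL 1),
      ← hT₂.eq_evalOn F₂ (isBoundedSpherical_sliceR hΦ) (hζ'.sliceR hR 1), ← hG]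
    exact congrArg (fun φ : Smooth (N₁ × N₂) => sphericalTransform (invTensor F₁ F₂).1 φ.1)
      (hT₁.eq_smoothTensor hD₁ hΦ)
  have hGA : ∀ {Φ : Smooth (N₁ × N₂)}, IsBoundedSpherical (K₁ × K₂) Φ →
      ∀ {ζ : EuclideanSpace ℝ (Fin (d₁ + d₂))}, IsEigenvalueTuple D Φ ζ →
      ∀ (hζ : ζ ∈ spectrumSet (K₁ × K₂) D) (F : InvSchwartz (N₁ × N₂) (K₁ × K₂)),
        sphericalTransform F.1 Φ.1 = cc * evalOn hζ (A F) := by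
    intro Φ hΦ ζ hζ' hζ F
    obtain ⟨L, hL'⟩ := exists_transform_functional hΦ
    have e1 := (hsum F).mapL L
    have e2 := ((hA F).mapL (evalOn hζ)).mul_left (cc : ℂ)
    rw [← hL']
    refine e1.unique (e2.congr_fun fun i => ?_)
    rw [map_smul, map_smul, hL', hGtensor hΦ hζ' hζ, LinearMap.compl₁₂_apply, evalOn_tensorOn]
    simp only [smul_eq_mul]
    exact mul_left_comm _ _ _
  have hGB : ∀ {Φ : Smooth (N₁ × N₂)}, IsBoundedSpherical (K₁ × K₂) Φ →
      ∀ {ζ : EuclideanSpace ℝ (Fin (d₁ + d₂))}, IsEigenvalueTuple D Φ ζ →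
      ∀ (hζ : ζ ∈ spectrumSet (K₁ × K₂) D)
        (f : 𝓢(EuclideanSpace ℝ (Fin d₁) × EuclideanSpace ℝ (Fin d₂), ℂ)),
        sphericalTransform (B f).1 Φ.1 = cc * f (EuclideanSpace.finAddEquivProd ζ) := by
    intro Φ hΦ ζ hζ' hζ f
    obtain ⟨L, hL'⟩ := exists_transform_functional hΦ
    have e1 := (hB f).mapL L
    have e2 := (hsum' f (EuclideanSpace.finAddEquivProd ζ).1
      (EuclideanSpace.finAddEquivProd ζ).2).mul_left (cc : ℂ)
    rw [← hL']
    refine e1.unique (e2.congr_fun fun i => ?_)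
    rw [map_smul, LinearMap.compl₁₂_apply, hL', hGtensor hΦ hζ' hζ]
    have h1 : T₁ (T₁.symm ((vanishingOn (spectrumSet K₁ D₁)).mkQ (e i))) =
      Submodule.Quotient.mk (e i) := T₁.apply_symm_apply _
    have h2 : T₂ (T₂.symm ((vanishingOn (spectrumSet K₂ D₂)).mkQ (e' i))) =
      Submodule.Quotient.mk (e' i) := T₂.apply_symm_apply _
    have h3 : evalOn (hS ζ hζ).1 (T₁ (T₁.symm ((vanishingOn (spectrumSet K₁ D₁)).mkQ (e i)))) =
        e i (EuclideanSpace.finAddEquivProd ζ).1 := by rw [h1, evalOn_mk]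
    have h4 : evalOn (hS ζ hζ).2 (T₂ (T₂.symm ((vanishingOn (spectrumSet K₂ D₂)).mkQ (e' i)))) =
        e' i (EuclideanSpace.finAddEquivProd ζ).2 := by rw [h2, evalOn_mk]
    simp only [smul_eq_mul]
    exact (congrArg₂ (fun u v => c' i f * (cc * (u * v))) h3 h4).trans (mul_left_comm _ _ _)
  -- Here pairs of points of the two spectra are seen to give points of the spectrum of the product.
  have hinj : ∀ F : InvSchwartz (N₁ × N₂) (K₁ × K₂), (∀ (Φ : Smooth (N₁ × N₂)) (ζ : _),
      IsBoundedSpherical (K₁ × K₂) Φ → IsEigenvalueTuple D Φ ζ →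
      sphericalTransform F.1 Φ.1 = 0) → F = 0 := fun F hF =>
    injective_prod hT₁ hT₂ fun φ₁ φ₂ h₁ h₂ => by
      obtain ⟨ξ₁, hξ₁⟩ := hT₁.exists_tuple h₁
      obtain ⟨ξ₂, hξ₂⟩ := hT₂.exists_tuple h₂
      refine hF _ (EuclideanSpace.finAddEquivProd.symm (ξ₁, ξ₂))
        (isBoundedSpherical_smoothTensor h₁ h₂) (IsEigenvalueTuple.smoothTensor hL hR ?_ ?_)
      · rwa [ContinuousLinearEquiv.apply_symm_apply]
      · rwa [ContinuousLinearEquiv.apply_symm_apply]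
  let R := SchwartzMap.compCLMOfContinuousLinearEquiv ℂ (F := ℂ)
    (EuclideanSpace.finAddEquivProd (𝕜 := ℝ) (n := d₁) (m := d₂)).symm
  have hR' : ∀ (f : 𝓢(EuclideanSpace ℝ (Fin (d₁ + d₂)), ℂ)) ζ,
      R f (EuclideanSpace.finAddEquivProd ζ) = f ζ := fun f ζ =>
    congrArg f (EuclideanSpace.finAddEquivProd.symm_apply_apply ζ)
  -- The expansion of `f` knows all of `f`, not only its restriction. But the transform of the image
  -- is a multiple of that restriction, so injectivity makes `B` descend to the quotient.
  have hker : vanishingOn (spectrumSet (K₁ × K₂) D) ≤ (B.comp R).ker := fun f hf => by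
    refine hinj _ fun Φ ζ hΦ hζ => ?_
    have hζ' : ζ ∈ spectrumSet (K₁ × K₂) D := ⟨Φ, hΦ, hζ⟩
    have := hGB hΦ hζ hζ' (R f)
    rw [hR', hf ζ hζ', mul_zero] at this
    exact this
  let B' : SchwartzOn (spectrumSet (K₁ × K₂) D) →L[ℂ] InvSchwartz (N₁ × N₂) (K₁ × K₂) :=
    (vanishingOn (spectrumSet (K₁ × K₂) D)).liftQL (B.comp R) hker
  have hGB' : ∀ {Φ : Smooth (N₁ × N₂)}, IsBoundedSpherical (K₁ × K₂) Φ →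
      ∀ {ζ : EuclideanSpace ℝ (Fin (d₁ + d₂))}, IsEigenvalueTuple D Φ ζ →
      ∀ (hζ : ζ ∈ spectrumSet (K₁ × K₂) D) (u : SchwartzOn (spectrumSet (K₁ × K₂) D)),
        sphericalTransform (B' u).1 Φ.1 = cc * evalOn hζ u := by
    intro Φ hΦ ζ hζ' hζ u
    obtain ⟨f, rfl⟩ := Submodule.Quotient.mk_surjective _ u
    exact (hGB hΦ hζ' hζ (R f)).trans (by rw [hR', evalOn_mk])
  have hAB : ∀ u, A (B' u) = u := fun u => SchwartzOn.ext fun ζ hζ => by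
    obtain ⟨Φ, hΦ, hζ'⟩ := id hζ
    exact mul_left_cancel₀ hcc0 ((hGA hΦ hζ' hζ (B' u)).symm.trans (hGB' hΦ hζ' hζ u))
  have hBA : ∀ F, B' (A F) = F := fun F => by
    refine sub_eq_zero.1 (hinj _ fun Φ ζ hΦ hζ => ?_)
    have hζ' : ζ ∈ spectrumSet (K₁ × K₂) D := ⟨Φ, hΦ, hζ⟩
    obtain ⟨L, hL'⟩ := exists_transform_functional hΦ
    rw [← hL', map_sub, hL', hL', hGB' hΦ hζ hζ', hGA hΦ hζ hζ', sub_self]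
  -- `A` and `B'` are mutually inverse, but the transform is `cc` times `A`.
  let T : InvSchwartz (N₁ × N₂) (K₁ × K₂) ≃L[ℂ] SchwartzOn (spectrumSet (K₁ × K₂) D) :=
    ContinuousLinearEquiv.equivOfInverse ((cc : ℂ) • A) ((cc : ℂ)⁻¹ • B')
      (fun F => by
        change (cc : ℂ)⁻¹ • B' ((cc : ℂ) • A F) = F
        rw [map_smul, hBA, inv_smul_smul₀ hcc0])
      (fun u => by
        change (cc : ℂ) • A ((cc : ℂ)⁻¹ • B' u) = u
        rw [map_smul, hAB, smul_inv_smul₀ hcc0])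
  refine ⟨T, fun F f hF Φ hΦ => ?_⟩
  have hΦ' := hT₁.eq_smoothTensor hD₁ hΦ
  obtain ⟨ξ₁, hξ₁⟩ := hT₁.exists_tuple (isBoundedSpherical_sliceL hΦ)
  obtain ⟨ξ₂, hξ₂⟩ := hT₂.exists_tuple (isBoundedSpherical_sliceR hΦ)
  have hζ : IsEigenvalueTuple D Φ (EuclideanSpace.finAddEquivProd.symm (ξ₁, ξ₂)) := by
    rw [hΦ']
    refine IsEigenvalueTuple.smoothTensor hL hR ?_ ?_
    · rwa [ContinuousLinearEquiv.apply_symm_apply]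
    · rwa [ContinuousLinearEquiv.apply_symm_apply]
  refine ⟨_, hζ, ?_⟩
  have hmem : EuclideanSpace.finAddEquivProd.symm (ξ₁, ξ₂) ∈ spectrumSet (K₁ × K₂) D :=
    ⟨Φ, hΦ, hζ⟩
  have hTF : (cc : ℂ) • A F = Submodule.Quotient.mk f := hF
  rw [hGA hΦ hζ hmem, ← smul_eq_mul, ← map_smul, hTF, evalOn_mk]

end Product

end GelfandPair

/-! ### Independence of the generating system -/

namespace GelfandPair

section Local

variable {N : Type*} [NormedAddCommGroup N] [NormedSpace ℝ N] [NilpotentLieGroup N]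

/-- Differential operators are local. -/
theorem eventuallyEq_of_mem_diffOps {X : Module.End ℂ (Smooth N)} (hX : X ∈ diffOps N)
    {f g : Smooth N} {x : N} (h : f.1 =ᶠ[𝓝 x] g.1) : (X f).1 =ᶠ[𝓝 x] (X g).1 := by
  induction hX using Algebra.adjoin_induction generalizing f g with
  | mem X hX =>
    obtain ⟨v, rfl⟩ := hX
    -- Equality is propagated as equality of germs, not of values, because only that is stable under
    -- composition.
    filter_upwards [h.eventuallyEq_nhds] with z hz
    have hc : Continuous fun y : N => z * y :=
      (NilpotentLieGroup.contDiff_group_mul (N := N)).continuous.comp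
        (continuous_const.prodMk continuous_id)
    have hz0 : Tendsto (fun y : N => z * y) (𝓝 0) (𝓝 z) := by
      have := hc.tendsto 0
      rwa [NilpotentLieGroup.zero_eq_one, mul_one, ← NilpotentLieGroup.zero_eq_one] at this
    have e : (fun y => f.1 (z * y)) =ᶠ[𝓝 0] fun y => g.1 (z * y) := hz0.eventually hz
    exact congrArg (fun L : N →L[ℝ] ℂ => L v) e.fderiv_eq
  | algebraMap c =>
    filter_upwards [h] with z hz
    exact congrArg (c * ·) hz
  | add X Y _ _ hX hY => exact (hX h).add (hY h)
  | mul X Y _ _ hX hY => exact hX (hY h)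

theorem hasCompactSupport_of_mem_diffOps {X : Module.End ℂ (Smooth N)} (hX : X ∈ diffOps N)
    {f : Smooth N} (hf : HasCompactSupport f.1) : HasCompactSupport (X f).1 := by
  refine hf.mono' fun x hx => ?_
  by_contra hx'
  have h : f.1 =ᶠ[𝓝 x] (0 : Smooth N).1 := notMem_tsupport_iff_eventuallyEq.1 hx'
  have h1 := (eventuallyEq_of_mem_diffOps hX h).eq_of_nhds
  rw [map_zero] at h1
  exact hx h1

end Local

section Pairing

theorem continuous_mul_conj {N : Type*} [NormedAddCommGroup N] [NormedSpace ℝ N] (f g : Smooth N) :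
    Continuous fun x => f.1 x * (starRingEnd ℂ) (g.1 x) :=
  (continuous_smooth f).mul (Complex.continuous_conj.comp (continuous_smooth g))

variable {N : Type*} [NormedAddCommGroup N] [NormedSpace ℝ N] [FiniteDimensional ℝ N]
  [MeasurableSpace N] [BorelSpace N]

/-- The `L²` pairing. -/
noncomputable def pairing (f g : Smooth N) : ℂ :=
  ∫ x, f.1 x * (starRingEnd ℂ) (g.1 x) ∂(Measure.addHaar : Measure N)

theorem integrable_pairing_left {f : Smooth N} (hf : HasCompactSupport f.1) (g : Smooth N) :
    Integrable (fun x => f.1 x * (starRingEnd ℂ) (g.1 x)) (Measure.addHaar : Measure N) :=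
  (continuous_mul_conj f g).integrable_of_hasCompactSupport hf.mul_right

theorem pairing_add_left {f f' : Smooth N} (hf : HasCompactSupport f.1)
    (hf' : HasCompactSupport f'.1) (g : Smooth N) :
    pairing (f + f') g = pairing f g + pairing f' g := by
  rw [pairing, pairing, pairing,
    ← integral_add (integrable_pairing_left hf g) (integrable_pairing_left hf' g)]
  exact integral_congr_ae (Eventually.of_forall fun x => add_mul _ _ _)

theorem pairing_add_right {f : Smooth N} (hf : HasCompactSupport f.1) (g g' : Smooth N) :
    pairing f (g + g') = pairing f g + pairing f g' := by
  rw [pairing, pairing, pairing,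
    ← integral_add (integrable_pairing_left hf g) (integrable_pairing_left hf g')]
  refine integral_congr_ae (Eventually.of_forall fun x => ?_)
  change f.1 x * (starRingEnd ℂ) (g.1 x + g'.1 x) = _
  rw [map_add, mul_add]

theorem pairing_smul_left (c : ℂ) (f g : Smooth N) : pairing (c • f) g = c * pairing f g := by
  rw [pairing, pairing, ← integral_const_mul]
  exact integral_congr_ae (Eventually.of_forall fun x => mul_assoc _ _ _)

theorem pairing_smul_right (c : ℂ) (f g : Smooth N) :
    pairing f (c • g) = (starRingEnd ℂ) c * pairing f g := by
  rw [pairing, pairing, ← integral_const_mul]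
  refine integral_congr_ae (Eventually.of_forall fun x => ?_)
  change f.1 x * (starRingEnd ℂ) (c * g.1 x) = _
  rw [map_mul, mul_left_comm]

theorem eq_zero_of_pairing_self {f : Smooth N} (hf : HasCompactSupport f.1)
    (h : pairing f f = 0) : f = 0 := by
  ext x
  by_contra hx
  have e : ∀ x, f.1 x * (starRingEnd ℂ) (f.1 x) = ((‖f.1 x‖ ^ 2 : ℝ) : ℂ) := fun x => by
    rw [Complex.mul_conj']
    push_cast
    rfl
  rw [pairing] at h
  simp only [e] at h
  rw [integral_complex_ofReal, Complex.ofReal_eq_zero] at h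
  have hs : HasCompactSupport fun x => ‖f.1 x‖ ^ 2 :=
    hf.comp_left (g := fun z : ℂ => ‖z‖ ^ 2) (by simp)
  exact (((continuous_smooth f).norm.pow 2).integral_pos_of_hasCompactSupport_nonneg_nonzero hs
    (fun x => sq_nonneg _) (x := x) (pow_ne_zero 2 (norm_ne_zero_iff.2 hx))).ne' h

end Pairing

section Eigenvalue

variable {N : Type*} [NormedAddCommGroup N] [NormedSpace ℝ N] [NilpotentLieGroup N]
  {d : ℕ} {D : Fin d → Module.End ℂ (Smooth N)}
  [FiniteDimensional ℝ N] [MeasurableSpace N] [BorelSpace N]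

/-- The operators generated by a formally self-adjoint system have formal adjoints, and their
eigenvalues are functions of temperate growth of the eigenvalues of the system. -/
theorem exists_adjoint (hD : ∀ j, D j ∈ diffOps N) (hsa : ∀ j, FormallySelfAdjoint (D j))
    {X : Module.End ℂ (Smooth N)} (hX : X ∈ Algebra.adjoin ℂ (Set.range D)) :
    ∃ X' ∈ diffOps N, (∀ f g : Smooth N, HasCompactSupport f.1 → HasCompactSupport g.1 →
        pairing (X f) g = pairing f (X' g)) ∧
      ∃ P : EuclideanSpace ℝ (Fin d) → ℂ, P.HasTemperateGrowth ∧
        ∀ φ ξ, IsEigenvalueTuple D φ ξ →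
          X φ = P ξ • φ ∧ X' φ = (starRingEnd ℂ) (P ξ) • φ := by
  have hle : Algebra.adjoin ℂ (Set.range D) ≤ diffOps N := by
    refine Algebra.adjoin_le ?_
    rintro _ ⟨j, rfl⟩
    exact hD j
  induction hX using Algebra.adjoin_induction with
  | mem X hX =>
    obtain ⟨j, rfl⟩ := hX
    refine ⟨D j, hD j, hsa j, fun ξ => (ξ j : ℂ), ?_, fun φ ξ h => ?_⟩
    · exact Complex.ofRealCLM.hasTemperateGrowth.comp
        (EuclideanSpace.proj j : EuclideanSpace ℝ (Fin d) →L[ℝ] ℝ).hasTemperateGrowth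
    · rw [Complex.conj_ofReal]
      exact ⟨h j, h j⟩
  | algebraMap c =>
    refine ⟨algebraMap ℂ _ ((starRingEnd ℂ) c), Subalgebra.algebraMap_mem _ _, fun f g _ _ => ?_,
      fun _ => c, Function.HasTemperateGrowth.const c, fun φ ξ _ => ⟨rfl, rfl⟩⟩
    change pairing (c • f) g = pairing f ((starRingEnd ℂ) c • g)
    rw [pairing_smul_left, pairing_smul_right, Complex.conj_conj]
  | add X Y hX hY h₁ h₂ =>
    obtain ⟨X', hX', aX, P, hP, eX⟩ := h₁
    obtain ⟨Y', hY', aY, Q, hQ, eY⟩ := h₂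
    refine ⟨X' + Y', add_mem hX' hY', fun f g hf hg => ?_, P + Q, hP.add hQ, fun φ ξ h => ⟨?_, ?_⟩⟩
    · rw [LinearMap.add_apply, LinearMap.add_apply, pairing_add_left
        (hasCompactSupport_of_mem_diffOps (hle hX) hf)
        (hasCompactSupport_of_mem_diffOps (hle hY) hf), pairing_add_right hf, aX f g hf hg,
        aY f g hf hg]
    · rw [LinearMap.add_apply, (eX φ ξ h).1, (eY φ ξ h).1, ← add_smul]
      rfl
    · rw [LinearMap.add_apply, (eX φ ξ h).2, (eY φ ξ h).2, ← add_smul, ← map_add]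
      rfl
  | mul X Y hX hY h₁ h₂ =>
    obtain ⟨X', hX', aX, P, hP, eX⟩ := h₁
    obtain ⟨Y', hY', aY, Q, hQ, eY⟩ := h₂
    refine ⟨Y' * X', mul_mem hY' hX', fun f g hf hg => ?_, P * Q, hP.mul hQ, fun φ ξ h => ⟨?_, ?_⟩⟩
    · rw [Module.End.mul_apply, Module.End.mul_apply,
        aX _ _ (hasCompactSupport_of_mem_diffOps (hle hY) hf) hg,
        aY _ _ hf (hasCompactSupport_of_mem_diffOps hX' hg)]
    · rw [Module.End.mul_apply, (eY φ ξ h).1, map_smul, (eX φ ξ h).1, smul_smul, mul_comm]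
      rfl
    · rw [Module.End.mul_apply, (eX φ ξ h).2, map_smul, (eY φ ξ h).2, smul_smul, ← map_mul]
      rfl

/-- The eigenvalues of a formally self-adjoint operator generated by a formally self-adjoint system
are real, if those of the system are. -/
theorem exists_real_eigenvalue (hD : ∀ j, D j ∈ diffOps N) (hsa : ∀ j, FormallySelfAdjoint (D j))
    {X : Module.End ℂ (Smooth N)} (hX : X ∈ Algebra.adjoin ℂ (Set.range D))
    (hXsa : FormallySelfAdjoint X) :
    ∃ P : EuclideanSpace ℝ (Fin d) → ℝ, P.HasTemperateGrowth ∧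
      ∀ φ ξ, φ.1 1 = 1 → IsEigenvalueTuple D φ ξ → X φ = (P ξ : ℂ) • φ := by
  obtain ⟨X', hX', aX, P, hP, eX⟩ := exists_adjoint hD hsa hX
  have hXd : X ∈ diffOps N := by
    have hle : Algebra.adjoin ℂ (Set.range D) ≤ diffOps N := by
      refine Algebra.adjoin_le ?_
      rintro _ ⟨j, rfl⟩
      exact hD j
    exact hle hX
  -- `X` and its formal adjoint have the same pairings with test functions, and `(X - X') g` is
  -- itself a test function, so it is orthogonal to itself.
  have hcs : ∀ g : Smooth N, HasCompactSupport g.1 → X g = X' g := fun g hg => by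
    let Y : Module.End ℂ (Smooth N) := X + (-1 : ℂ) • X'
    have hY : Y ∈ diffOps N := add_mem hXd (Subalgebra.smul_mem _ hX' _)
    have h1 := hasCompactSupport_of_mem_diffOps hY hg
    have e : Y g = X g + (-1 : ℂ) • X' g := rfl
    have h2 : pairing (Y g) (X g) = pairing (Y g) (X' g) :=
      (hXsa (Y g) g h1 hg).symm.trans (aX (Y g) g h1 hg)
    have h3 : pairing (Y g) (Y g) = 0 := by
      have h4 := pairing_add_right h1 (X g) ((-1 : ℂ) • X' g)
      rw [pairing_smul_right, h2, map_neg, map_one, neg_one_mul, add_neg_cancel] at h4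
      exact h4
    ext x
    have h4 : (X g).1 x + (-1) * (X' g).1 x = 0 :=
      congrArg (fun f : Smooth N => f.1 x) (eq_zero_of_pairing_self h1 h3)
    linear_combination h4
  refine ⟨fun ξ => (P ξ).re, Complex.reCLM.hasTemperateGrowth.comp hP, fun φ ξ h1 h => ?_⟩
  obtain ⟨e1, e2⟩ := eX φ ξ h
  -- `φ` need not be compactly supported. A cut-off of it with the same germ at the identity is a
  -- test function, and by locality `X φ` and `X' φ` agree at the identity; hence the eigenvalue
  -- equals its conjugate.
  let ρ : ContDiffBump (1 : N) := ⟨1, 2, one_pos, one_lt_two⟩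
  have hφ : ContDiff ℝ ∞ φ.1 := φ.2
  let g : Smooth N := ⟨fun x => (ρ x : ℂ) * φ.1 x, by
    have hρ : ContDiff ℝ ∞ fun x => (ρ x : ℂ) := Complex.ofRealCLM.contDiff.comp ρ.contDiff
    exact hρ.mul hφ⟩
  have hg : HasCompactSupport g.1 := HasCompactSupport.mul_right
    (ρ.hasCompactSupport.comp_left (g := Complex.ofReal) Complex.ofReal_zero)
  have hgφ : g.1 =ᶠ[𝓝 1] φ.1 := by
    filter_upwards [ρ.eventuallyEq_one] with x hx
    change (ρ x : ℂ) * φ.1 x = φ.1 x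
    rw [hx]
    simp
  have e3 := (eventuallyEq_of_mem_diffOps hXd hgφ).eq_of_nhds
  have e4 := (eventuallyEq_of_mem_diffOps hX' hgφ).eq_of_nhds
  rw [hcs g hg, e4, e1, e2] at e3
  have e5 : (starRingEnd ℂ) (P ξ) = P ξ := by
    change (starRingEnd ℂ) (P ξ) * φ.1 1 = P ξ * φ.1 1 at e3
    rwa [h1, mul_one, mul_one] at e3
  rw [e1, Complex.conj_eq_iff_re.1 e5]

variable {e : ℕ} {E : Fin e → Module.End ℂ (Smooth N)}

/-- The eigenvalue tuple for a formally self-adjoint system is a function of temperate growth of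
that for another system, which generates it. -/
theorem exists_tuple_map (hD : ∀ j, D j ∈ diffOps N) (hsa : ∀ j, FormallySelfAdjoint (D j))
    (hE : ∀ j, E j ∈ Algebra.adjoin ℂ (Set.range D)) (hEsa : ∀ j, FormallySelfAdjoint (E j)) :
    ∃ R : EuclideanSpace ℝ (Fin d) → EuclideanSpace ℝ (Fin e), R.HasTemperateGrowth ∧
      ∀ φ ξ, φ.1 1 = 1 → IsEigenvalueTuple D φ ξ → IsEigenvalueTuple E φ (R ξ) := by
  choose P hP hPe using fun j => exists_real_eigenvalue hD hsa (hE j) (hEsa j)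
  refine ⟨fun ξ => ∑ j, P j ξ • EuclideanSpace.single j (1 : ℝ),
    Function.HasTemperateGrowth.sum fun j _ =>
      (hP j).smul (Function.HasTemperateGrowth.const _), fun φ ξ h1 h j => ?_⟩
  have ej : (∑ i, P i ξ • EuclideanSpace.single i (1 : ℝ) : EuclideanSpace ℝ (Fin e)) j =
      P j ξ := by
    simp [Pi.single_apply]
  rw [ej]
  exact hPe j φ ξ h1 h

end Eigenvalue

section Restriction

variable {d e : ℕ}

/-- Schwartz functions can be pulled back along a map of temperate growth to the set where it has a
left inverse of temperate growth. -/
theorem exists_schwartz_pullback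
    {S : EuclideanSpace ℝ (Fin e) → EuclideanSpace ℝ (Fin d)}
    {R : EuclideanSpace ℝ (Fin d) → EuclideanSpace ℝ (Fin e)}
    (hS : S.HasTemperateGrowth) (hR : R.HasTemperateGrowth) :
    ∃ M : 𝓢(EuclideanSpace ℝ (Fin d), ℂ) →L[ℂ] 𝓢(EuclideanSpace ℝ (Fin e), ℂ),
      ∀ f η, R (S η) = η → M f η = f (S η) := by
  let ρ : ContDiffBump (0 : EuclideanSpace ℝ (Fin e)) := ⟨1, 2, one_pos, one_lt_two⟩
  have hρ : HasCompactSupport fun η => (ρ η : ℂ) :=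
    ρ.hasCompactSupport.comp_left (g := Complex.ofReal) Complex.ofReal_zero
  let h : 𝓢(EuclideanSpace ℝ (Fin e), ℂ) :=
    hρ.toSchwartzMap (Complex.ofRealCLM.contDiff.comp ρ.contDiff)
  have h0 : h 0 = 1 := by
    change ((ρ 0 : ℝ) : ℂ) = 1
    rw [ρ.eventuallyEq_one.eq_of_nhds]
    simp
  -- `f ∘ S` need not decay, as `S` may fail to be proper. The pullback of `f ⊗ h` along `Ψ` is `f
  -- (S η) * h (η - R (S η))`, which has the right values where `R (S η) = η`.
  let Ψ : EuclideanSpace ℝ (Fin e) → EuclideanSpace ℝ (Fin d) × EuclideanSpace ℝ (Fin e) :=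
    fun η => (S η, η - R (S η))
  have hRS : (fun η => η - R (S η)).HasTemperateGrowth :=
    Function.HasTemperateGrowth.id'.sub (hR.comp hS)
  have hΨ : Ψ.HasTemperateGrowth := by
    let iL := ContinuousLinearMap.inl ℝ (EuclideanSpace ℝ (Fin d)) (EuclideanSpace ℝ (Fin e))
    let iR := ContinuousLinearMap.inr ℝ (EuclideanSpace ℝ (Fin d)) (EuclideanSpace ℝ (Fin e))
    have hsum : Ψ = (fun η => iL (S η)) + fun η => iR (η - R (S η)) := by
      funext η
      simp [Ψ, iL, iR]
    rw [hsum]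
    exact (iL.hasTemperateGrowth.comp hS).add (iR.hasTemperateGrowth.comp hRS)
  -- `η` is recovered from `Ψ η` as its second component plus `R` of the first, and `R` grows
  -- polynomially; composition with `Ψ` thus preserves Schwartz functions.
  have hup : ∃ (k : ℕ) (C : ℝ), ∀ η, ‖η‖ ≤ C * (1 + ‖Ψ η‖) ^ k := by
    obtain ⟨k, C, hC⟩ := hR.2 0
    simp only [norm_iteratedFDeriv_zero] at hC
    have hC0 : 0 ≤ C := by
      have := (norm_nonneg _).trans (hC 0)
      simpa using this
    refine ⟨k + 1, 1 + C, fun η => ?_⟩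
    have h1 : ‖η‖ ≤ ‖η - R (S η)‖ + ‖R (S η)‖ := by
      simpa using norm_add_le (η - R (S η)) (R (S η))
    have h2 : ‖η - R (S η)‖ ≤ ‖Ψ η‖ := le_max_right _ _
    have h3 : ‖S η‖ ≤ ‖Ψ η‖ := le_max_left _ _
    have hb : 1 ≤ 1 + ‖Ψ η‖ := le_add_of_nonneg_right (norm_nonneg _)
    calc ‖η‖ ≤ (1 + ‖Ψ η‖) + C * (1 + ‖S η‖) ^ k :=
          h1.trans (add_le_add (h2.trans (by linarith)) (hC _))
      _ ≤ (1 + ‖Ψ η‖) ^ (k + 1) + C * (1 + ‖Ψ η‖) ^ (k + 1) := by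
          refine add_le_add (le_self_pow₀ hb (Nat.succ_ne_zero k))
            (mul_le_mul_of_nonneg_left ?_ hC0)
          exact (pow_le_pow_left₀ (by positivity) (by linarith) k).trans
            (pow_le_pow_right₀ hb (Nat.le_succ k))
      _ = _ := by ring
  let L : 𝓢(EuclideanSpace ℝ (Fin d), ℂ) →L[ℂ]
      𝓢(EuclideanSpace ℝ (Fin d) × EuclideanSpace ℝ (Fin e), ℂ) :=
    ⟨SchwartzMap.tensorBilin.flip h,
      SchwartzMap.continuous_tensor.comp (continuous_id.prodMk continuous_const)⟩
  refine ⟨(SchwartzMap.compCLM ℂ hΨ hup).comp L, fun f η hη => ?_⟩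
  change f (S η) * h (η - R (S η)) = f (S η)
  rw [hη, sub_self, h0, mul_one]

variable {A : Set (EuclideanSpace ℝ (Fin d))} {B : Set (EuclideanSpace ℝ (Fin e))}

theorem exists_schwartzOn_pullback
    {S : EuclideanSpace ℝ (Fin e) → EuclideanSpace ℝ (Fin d)}
    {R : EuclideanSpace ℝ (Fin d) → EuclideanSpace ℝ (Fin e)}
    (hS : S.HasTemperateGrowth) (hR : R.HasTemperateGrowth) (hRS : ∀ η ∈ B, R (S η) = η)
    (hSA : ∀ η ∈ B, S η ∈ A) :
    ∃ U : SchwartzOn A →L[ℂ] SchwartzOn B, ∀ u (η : EuclideanSpace ℝ (Fin e)) (hη : η ∈ B),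
      evalOn hη (U u) = evalOn (hSA η hη) u := by
  obtain ⟨M, hM⟩ := exists_schwartz_pullback hS hR
  refine ⟨(vanishingOn A).liftQL ((vanishingOn B).mkQL.comp M) fun f hf => ?_, fun u η hη => ?_⟩
  · refine (Submodule.Quotient.mk_eq_zero _).2 fun η hη => ?_
    exact (hM f η (hRS η hη)).trans (hf _ (hSA η hη))
  · obtain ⟨f, rfl⟩ := Submodule.Quotient.mk_surjective _ u
    exact hM f η (hRS η hη)

end Restriction

/-- Property (S) does not depend on the system of formally self-adjoint generators. -/
theorem PropertySFor.of_isGeneratingSystem {N K : Type*} [NormedAddCommGroup N] [NormedSpace ℝ N]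
    [FiniteDimensional ℝ N] [MeasurableSpace N] [BorelSpace N] [NilpotentLieGroup N]
    [Group K] [TopologicalSpace K] [MulDistribMulAction K N] [ContinuousSMul K N]
    {d e : ℕ} {D : Fin d → Module.End ℂ (Smooth N)} {E : Fin e → Module.End ℂ (Smooth N)}
    (hD : IsGeneratingSystem K D) (hE : IsGeneratingSystem K E) (h : PropertySFor K D) :
    PropertySFor K E := by
  obtain ⟨T, hT⟩ : ∃ T, IsTransform (K := K) (D := D) T := h
  have mD : ∀ j, D j ∈ invDiffOps N K := fun j => hD.1 ▸ Algebra.subset_adjoin ⟨j, rfl⟩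
  have mE : ∀ j, E j ∈ invDiffOps N K := fun j => hE.1 ▸ Algebra.subset_adjoin ⟨j, rfl⟩
  obtain ⟨R, hR, hR'⟩ := exists_tuple_map (fun j => (mD j).1) hD.2
    (fun j => hD.1.symm ▸ mE j) hE.2
  obtain ⟨S, hS, hS'⟩ := exists_tuple_map (fun j => (mE j).1) hE.2
    (fun j => hE.1.symm ▸ mD j) hD.2
  -- Both sides are eigenvalue tuples of the same spherical function. Off the spectra `R` and `S`
  -- need not be inverse to each other.
  have hRS : ∀ η ∈ spectrumSet K E, R (S η) = η := fun η ⟨φ, hφ, hη⟩ =>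
    (hR' φ _ hφ.one (hS' φ η hφ.one hη)).unique hφ.one hη
  have hSR : ∀ ξ ∈ spectrumSet K D, S (R ξ) = ξ := fun ξ ⟨φ, hφ, hξ⟩ =>
    (hS' φ _ hφ.one (hR' φ ξ hφ.one hξ)).unique hφ.one hξ
  have hRm : ∀ ξ ∈ spectrumSet K D, R ξ ∈ spectrumSet K E := fun ξ ⟨φ, hφ, hξ⟩ =>
    ⟨φ, hφ, hR' φ ξ hφ.one hξ⟩
  have hSm : ∀ η ∈ spectrumSet K E, S η ∈ spectrumSet K D := fun η ⟨φ, hφ, hη⟩ =>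
    ⟨φ, hφ, hS' φ η hφ.one hη⟩
  obtain ⟨U, hU⟩ := exists_schwartzOn_pullback hS hR hRS hSm
  obtain ⟨V, hV⟩ := exists_schwartzOn_pullback hR hS hSR hRm
  have hcongr : ∀ {ξ ξ' : EuclideanSpace ℝ (Fin d)} (h : ξ ∈ spectrumSet K D)
      (h' : ξ' ∈ spectrumSet K D) (u : SchwartzOn (spectrumSet K D)), ξ = ξ' →
      evalOn h u = evalOn h' u := by
    rintro ξ _ h h' u rfl
    rfl
  have hcongr' : ∀ {ξ ξ' : EuclideanSpace ℝ (Fin e)} (h : ξ ∈ spectrumSet K E)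
      (h' : ξ' ∈ spectrumSet K E) (u : SchwartzOn (spectrumSet K E)), ξ = ξ' →
      evalOn h u = evalOn h' u := by
    rintro ξ _ h h' u rfl
    rfl
  let W : SchwartzOn (spectrumSet K D) ≃L[ℂ] SchwartzOn (spectrumSet K E) :=
    ContinuousLinearEquiv.equivOfInverse U V
      (fun u => SchwartzOn.ext fun ξ hξ => by rw [hV, hU]; exact hcongr _ _ _ (hSR ξ hξ))
      (fun u => SchwartzOn.ext fun η hη => by rw [hU, hV]; exact hcongr' _ _ _ (hRS η hη))
  refine ⟨T.trans W, fun F g hF φ hφ => ?_⟩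
  obtain ⟨ξ, hξ⟩ := hT.exists_tuple hφ
  have hξm : ξ ∈ spectrumSet K D := ⟨φ, hφ, hξ⟩
  refine ⟨R ξ, hR' φ ξ hφ.one hξ, ?_⟩
  have hUF : U (T F) = Submodule.Quotient.mk g := hF
  rw [hT.eq_evalOn F hφ hξ hξm, ← evalOn_mk (hRm ξ hξm), ← hUF, hU]
  exact hcongr _ _ _ (hSR ξ hξm).symm

end GelfandPair

/-! ### Conclusion -/

theorem mainTheorem6 {N₁ N₂ K₁ K₂ : Type*}
    [NormedAddCommGroup N₁] [NormedSpace ℝ N₁] [FiniteDimensional ℝ N₁]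
    [MeasurableSpace N₁] [BorelSpace N₁] [NilpotentLieGroup N₁]
    [NormedAddCommGroup N₂] [NormedSpace ℝ N₂] [FiniteDimensional ℝ N₂]
    [MeasurableSpace N₂] [BorelSpace N₂] [NilpotentLieGroup N₂]
    [Group K₁] [TopologicalSpace K₁] [IsTopologicalGroup K₁] [CompactSpace K₁] [T2Space K₁]
    [MulDistribMulAction K₁ N₁] [ContinuousSMul K₁ N₁]
    [Group K₂] [TopologicalSpace K₂] [IsTopologicalGroup K₂] [CompactSpace K₂] [T2Space K₂]
    [MulDistribMulAction K₂ N₂] [ContinuousSMul K₂ N₂]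
    (h₁ : GelfandPair.IsNilpotentGelfandPair N₁ K₁)
    (h₂ : GelfandPair.IsNilpotentGelfandPair N₂ K₂)
    (hS₁ : GelfandPair.PropertyS N₁ K₁) (hS₂ : GelfandPair.PropertyS N₂ K₂) :
    GelfandPair.IsNilpotentGelfandPair (N₁ × N₂) (K₁ × K₂) ∧
      GelfandPair.PropertyS (N₁ × N₂) (K₁ × K₂) ∧
      ∀ (d : ℕ) (D : Fin d → Module.End ℂ (GelfandPair.Smooth (N₁ × N₂))),
        GelfandPair.IsGeneratingSystem (K₁ × K₂) D → GelfandPair.PropertySFor (K₁ × K₂) D := by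
  obtain ⟨d₁, D₁, hD₁, T₁, hT₁⟩ := hS₁
  obtain ⟨d₂, D₂, hD₂, T₂, hT₂⟩ := hS₂
  have m₁ : ∀ j, D₁ j ∈ GelfandPair.invDiffOps N₁ K₁ := fun j =>
    hD₁.1 ▸ Algebra.subset_adjoin ⟨j, rfl⟩
  have m₂ : ∀ j, D₂ j ∈ GelfandPair.invDiffOps N₂ K₂ := fun j =>
    hD₂.1 ▸ Algebra.subset_adjoin ⟨j, rfl⟩
  -- The lifts of the two given systems, concatenated, form the one system for which property (S) is
  -- proved directly; all others follow by change of generators.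
  let D : Fin (d₁ + d₂) → Module.End ℂ (GelfandPair.Smooth (N₁ × N₂)) :=
    Fin.append (fun j => GelfandPair.liftL N₂ ⟨D₁ j, (m₁ j).1⟩)
      (fun j => GelfandPair.liftR N₁ ⟨D₂ j, (m₂ j).1⟩)
  have hL : ∀ j, GelfandPair.IsLiftL (D₁ j) (D (Fin.castAdd d₂ j)) := fun j => by
    simp only [D, Fin.append_left]
    exact GelfandPair.isLiftL_liftL _
  have hR : ∀ j, GelfandPair.IsLiftR (D₂ j) (D (Fin.natAdd d₁ j)) := fun j => by
    simp only [D, Fin.append_right]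
    exact GelfandPair.isLiftR_liftR _
  have hgen : GelfandPair.IsGeneratingSystem (K₁ × K₂) D := by
    refine ⟨GelfandPair.adjoin_lift_eq hD₁.1 hD₂.1 hL hR, fun j => ?_⟩
    induction j using Fin.addCases with
    | left j => exact (hL j).formallySelfAdjoint (hD₁.2 j)
    | right j => exact (hR j).formallySelfAdjoint (hD₂.2 j)
  have hS : GelfandPair.PropertySFor (K₁ × K₂) D :=
    GelfandPair.propertySFor_prod hT₁ hT₂ hD₁.1 hL hR
  exact ⟨GelfandPair.isNilpotentGelfandPair_prod h₁ h₂, ⟨_, D, hgen, hS⟩, fun _ _ hE =>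
    hS.of_isGeneratingSystem hgen hE⟩
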